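/- Let $k$ be a commutative ring. A (small) dg category over $k$ is a small category enriched in cochain complexes of $k$-modules, with $d(g\circ f)=dg\circ f+(-1)^{|g|}g\circ df$; a dg functor is a $k$-linear functor preserving degrees and commuting with differentials. * A dg category $\mathcal C$ is *semifree* if, as a $k$-linear category, it is freely generated by a family of homogeneous morphisms $\{f_i\}$ indexed by an ordinal such that each $df_i$ is generated (under $k$-linear combinations, composition and identities) by $\{f_j\mid j<i\}$. Let $\mathrm{dgCat}_s$ be the category of small semifree dg categories over $k$ and all dg functors between them. * A dg functor $F\colon\mathcal C\to\mathcal D$ is a *semifree extension* if it is injective on objects and faithful, and $\mathcal D$ is, as a $k$-linear category, the free extension of $F(\mathcal C)$ by the objects of $\mathcal D$ not in $F(\mathcal C)$ and a family of homogeneous morphisms $\{f_i\}$ indexed by an ordinal such that each $df_i$ is generated by the morphisms of $F(\mathcal C)$ and $\{f_j\mid j<i\}$. * A dg functor $F$ is a *quasi-equivalence* if $H^*(F)$ is fully faithful and $H^0(F)$ is essentially surjective. A *cofibration category* (in the sense of Baues) is a category with two classes of morphisms, cofibrations and weak equivalences, such that: 1. (C1) isomorphisms are cofibrations and weak equivalences,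 weak equivalences satisfy two-out-of-three, and cofibrations are closed under composition; 2. (C2) for a cofibration $i\colon B\to A$ and any $f\colon B\to Y$ the pushout $A\cup_BY$ exists and $\bar\imath\colon Y\to A\cup_BY$ is a cofibration; if $f$ is a weak equivalence, so is $\bar f\colon A\to A\cup_BY$; if $i$ is a weak equivalence, so is $\bar\imath$; 3. (C3) every morphism factors as a cofibration followed by a weak equivalence; 4. (C4) every object $X$ admits a trivial cofibration (a cofibration that is a weak equivalence) $X\to RX$ with $RX$ fibrant, where $R$ is *fibrant* if every trivial cofibration $i\colon R\to Q$ admits a retraction $r\colon Q\to R$, $r\circ i=1_R$. An object $X$ is *cofibrant* if there is an initial object $\emptyset$ and $\emptyset\to X$ is a cofibration. A *category of cofibrant objects* (the dual of Brown's categories of fibrant objects) is a category with finite coproducts and classes of cofibrations and weak equivalences such that (C1) holds, pushouts of cofibrations along arbitrary morphisms exist, cofibrations and trivial cofibrations are stable under pushout, every codiagonal $X\sqcup X\to X$ factors as a cofibration followed by a weak equivalence, and every object is cofibrant. **Theorem.** The category $\mathrm{dgCat}_s$, with the quasi-equivalences as weak equivalences and the semifree extensions as cofibrations, is a cofibration category.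 Every object of $\mathrm{dgCat}_s$ is both fibrant and cofibrant. In particular, with the same two classes of morphisms, $\mathrm{dgCat}_s$ is a category of cofibrant objects. -/

import Mathlib

open CategoryTheory CategoryTheory.Limits

universe u

/-! ### Dg categories and dg functors -/

/-- A dg category structure over `k` on a `k`-linear category `C`: every morphism module is a
cochain complex, given by its homogeneous parts (`hom X Y p` is the module of morphisms of degree
`p`, and the whole morphism module is their internal direct sum) and a differential `d` of
degree `1`; identities have degree `0`, composition is additive on degrees and satisfies the graded
Leibniz rule `d (g ∘ f) = dg ∘ f + (-1)^|g| g ∘ df`. Recall that `f ≫ g` is `g ∘ f`. -/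
class DGCategory (k : Type u) [CommRing k] (C : Type u) [Category.{u} C] [Preadditive C]
    [Linear k C] where
  /-- the submodule of homogeneous morphisms of a given degree -/
  hom (X Y : C) (p : ℤ) : Submodule k (X ⟶ Y)
  isInternal (X Y : C) : DirectSum.IsInternal (hom X Y)
  id_mem (X : C) : 𝟙 X ∈ hom X X 0
  comp_mem {X Y Z : C} {p q : ℤ} {f : X ⟶ Y} {g : Y ⟶ Z} :
    f ∈ hom X Y p → g ∈ hom Y Z q → f ≫ g ∈ hom X Z (p + q)
  /-- the differential -/
  d (X Y : C) : (X ⟶ Y) →ₗ[k] (X ⟶ Y)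
  d_mem {X Y : C} {p : ℤ} {f : X ⟶ Y} : f ∈ hom X Y p → d X Y f ∈ hom X Y (p + 1)
  d_d {X Y : C} (f : X ⟶ Y) : d X Y (d X Y f) = 0
  d_comp {X Y Z : C} {q : ℤ} (f : X ⟶ Y) {g : Y ⟶ Z} : g ∈ hom Y Z q →
    d X Z (f ≫ g) = f ≫ d Y Z g + q.negOnePow • (d X Y f ≫ g)

/-- A small dg category over `k`. -/
structure DGCat (k : Type u) [CommRing k] : Type (u + 1) where
  /-- the type of objects -/
  carrier : Type u
  [category : Category.{u} carrier]
  [preadditive : Preadditive carrier]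
  [linear : Linear k carrier]
  [dg : DGCategory k carrier]

namespace DGCat

variable {k : Type u} [CommRing k]

instance : CoeSort (DGCat k) (Type u) := ⟨DGCat.carrier⟩

attribute [instance] DGCat.category DGCat.preadditive DGCat.linear DGCat.dg

/-- The homogeneous morphisms `X ⟶ Y` of degree `p`. -/
abbrev hom {C : DGCat k} (X Y : C) (p : ℤ) : Submodule k (X ⟶ Y) := DGCategory.hom X Y p

/-- The differential of the morphism complex from `X` to `Y`. -/
abbrev d {C : DGCat k} (X Y : C) : (X ⟶ Y) →ₗ[k] (X ⟶ Y) := DGCategory.d X Y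

end DGCat

/-- A dg functor: a `k`-linear functor that preserves degrees and commutes with differentials. -/
@[ext]
structure DGFunctor {k : Type u} [CommRing k] (C D : DGCat k) : Type u where
  /-- the underlying functor -/
  functor : C ⥤ D
  [additive : functor.Additive]
  [linear : functor.Linear k]
  map_mem {X Y : C} {p : ℤ} {f : X ⟶ Y} : f ∈ DGCat.hom X Y p →
    functor.map f ∈ DGCat.hom (functor.obj X) (functor.obj Y) p
  map_d {X Y : C} (f : X ⟶ Y) :
    functor.map (DGCat.d X Y f) = DGCat.d (functor.obj X) (functor.obj Y) (functor.map f)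

namespace DGFunctor

variable {k : Type u} [CommRing k]

attribute [instance] DGFunctor.additive DGFunctor.linear

/-- The identity dg functor. -/
@[simps]
def id (C : DGCat k) : DGFunctor C C where
  functor := 𝟭 C
  map_mem h := h
  map_d _ := rfl

/-- The composition of dg functors. -/
@[simps]
def comp {C D E : DGCat k} (F : DGFunctor C D) (G : DGFunctor D E) : DGFunctor C E where
  functor := F.functor ⋙ G.functor
  map_mem h := G.map_mem (F.map_mem h)
  map_d f := by simp [F.map_d, G.map_d]

end DGFunctor

/-- The category `dgCat` of small dg categories and dg functors. -/
instance DGCat.instCategory (k : Type u) [CommRing k] : Category.{u} (DGCat k) where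
  Hom C D := DGFunctor C D
  id C := DGFunctor.id C
  comp F G := F.comp G

/-! ### Semifree dg categories and semifree extensions -/

/-- The morphisms generated, as an algebra, by a class `W` of morphisms of a `k`-linear category:
all `k`-linear combinations of composites of morphisms of `W` and of identities. -/
inductive GeneratedBy (k : Type u) [CommRing k] {C : Type u} [Category.{u} C] [Preadditive C]
    [Linear k C] (W : MorphismProperty C) : MorphismProperty C
  | of {X Y : C} (f : X ⟶ Y) : W f → GeneratedBy k W f
  | id (X : C) : GeneratedBy k W (𝟙 X)
  | comp {X Y Z : C} (f : X ⟶ Y) (g : Y ⟶ Z) :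
      GeneratedBy k W f → GeneratedBy k W g → GeneratedBy k W (f ≫ g)
  | zero (X Y : C) : GeneratedBy k W (0 : X ⟶ Y)
  | add {X Y : C} (f g : X ⟶ Y) :
      GeneratedBy k W f → GeneratedBy k W g → GeneratedBy k W (f + g)
  | smul {X Y : C} (r : k) (f : X ⟶ Y) : GeneratedBy k W f → GeneratedBy k W (r • f)

/-- The members of a family of morphisms with index smaller than `i`. -/
inductive FamilyBelow {C : Type u} [Category.{u} C] {ι : Type u} [LT ι] {s t : ι → C}
    (f : ∀ i, s i ⟶ t i) (i : ι) : MorphismProperty C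
  | mk (j : ι) : j < i → FamilyBelow f i (f j)

/-- The morphisms in the image of a functor. -/
inductive ImageMor {C D : Type u} [Category.{u} C] [Category.{u} D] (F : C ⥤ D) :
    MorphismProperty D
  | mk {X Y : C} (g : X ⟶ Y) : ImageMor F (F.map g)

/-- The `k`-linear category `C` is freely generated by the family of morphisms
`f i : s i ⟶ t i`: a `k`-linear functor out of `C` is uniquely determined by arbitrarily prescribed
values on the objects and on the `f i`. -/
def IsFreelyGenerated (k : Type u) [CommRing k] {C : Type u} [Category.{u} C] [Preadditive C]
    [Linear k C] {ι : Type u} {s t : ι → C} (f : ∀ i, s i ⟶ t i) : Prop :=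
  ∀ (E : Type u) [Category.{u} E] [Preadditive E] [Linear k E]
    (o : C → E) (φ : ∀ i, o (s i) ⟶ o (t i)),
    ∃! H : C ⥤ E, H.Additive ∧ H.Linear k ∧
      ∃ h : ∀ X, H.obj X = o X, ∀ i, H.map (f i) = eqToHom (h _) ≫ φ i ≫ eqToHom (h _).symm

/-- The `k`-linear category `D` is a free extension along `F : C ⥤ D` by the family of
morphisms `f i : s i ⟶ t i` (and by the objects outside the image of `F`): every `k`-linear functor
`G` out of `C` extends uniquely to a `k`-linear functor out of `D` with arbitrarily prescribed
values on the `f i` and on the new objects (the map `o` prescribes the values on all objects of `D`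
and has to agree with `G` on those of `C`). -/
def IsFreeExtension (k : Type u) [CommRing k] {C D : Type u} [Category.{u} C] [Preadditive C]
    [Linear k C] [Category.{u} D] [Preadditive D] [Linear k D] (F : C ⥤ D)
    {ι : Type u} {s t : ι → D} (f : ∀ i, s i ⟶ t i) : Prop :=
  ∀ (E : Type u) [Category.{u} E] [Preadditive E] [Linear k E]
    (G : C ⥤ E) [G.Additive] [G.Linear k]
    (o : D → E) (_ : ∀ X, o (F.obj X) = G.obj X) (φ : ∀ i, o (s i) ⟶ o (t i)),
    ∃! H : D ⥤ E, H.Additive ∧ H.Linear k ∧ F ⋙ H = G ∧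
      ∃ h : ∀ X, H.obj X = o X, ∀ i, H.map (f i) = eqToHom (h _) ≫ φ i ≫ eqToHom (h _).symm

section

variable {k : Type u} [CommRing k]

/-- A dg category is semifree if, as a `k`-linear category, it is freely generated by a family of
homogeneous morphisms `f i`, indexed by a well-ordered type, such that each `d (f i)` is
generated by the `f j` with `j < i`. -/
def IsSemifree (C : DGCat k) : Prop :=
  ∃ (ι : Type u) (_ : LinearOrder ι) (_ : WellFoundedLT ι) (s t : ι → C) (f : ∀ i, s i ⟶ t i)
    (deg : ι → ℤ),
    (∀ i, f i ∈ DGCat.hom (s i) (t i) (deg i)) ∧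
    IsFreelyGenerated k f ∧
    ∀ i, GeneratedBy k (FamilyBelow f i) (DGCat.d _ _ (f i))

/-- A dg functor `F : C ⟶ D` is a semifree extension if it is an inclusion and `D` is, as a
`k`-linear category, a free extension of the image of `F` by the objects outside the image and by a
family of homogeneous morphisms `f i`, indexed by a well-ordered type, such that each
`d (f i)` is generated by the morphisms of the image and the `f j` with `j < i`. -/
def IsSemifreeExtension {C D : DGCat k} (F : DGFunctor C D) : Prop :=
  Function.Injective F.functor.obj ∧ F.functor.Faithful ∧
  ∃ (ι : Type u) (_ : LinearOrder ι) (_ : WellFoundedLT ι) (s t : ι → D) (f : ∀ i, s i ⟶ t i)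
    (deg : ι → ℤ),
    (∀ i, f i ∈ DGCat.hom (s i) (t i) (deg i)) ∧
    IsFreeExtension k F.functor f ∧
    ∀ i, GeneratedBy k (ImageMor F.functor ⊔ FamilyBelow f i) (DGCat.d _ _ (f i))

/-! ### Quasi-equivalences -/

/-- The total cohomology `H^*` of the morphism complex from `X` to `Y`. -/
abbrev DGCat.Cohomology {C : DGCat k} (X Y : C) : Type u :=
  LinearMap.ker (DGCat.d X Y) ⧸
    (LinearMap.range (DGCat.d X Y)).submoduleOf (LinearMap.ker (DGCat.d X Y))

/-- The map induced by a dg functor on the total cohomology of morphism complexes. -/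
def DGFunctor.mapCohomology {C D : DGCat k} (F : DGFunctor C D) (X Y : C) :
    DGCat.Cohomology X Y →ₗ[k]
      DGCat.Cohomology (C := D) (F.functor.obj X) (F.functor.obj Y) :=
  Submodule.mapQ _ _
    ((F.functor.mapLinearMap k (X := X) (Y := Y)).restrict
      (p := LinearMap.ker (DGCat.d X Y))
      (q := LinearMap.ker (DGCat.d (C := D) (F.functor.obj X) (F.functor.obj Y)))
      (fun f (hf : DGCat.d X Y f = 0) => by
        simp [LinearMap.mem_ker, ← F.map_d, hf]))
    (by
      rintro ⟨f, hf⟩ ⟨g, hg⟩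
      exact ⟨F.functor.map g, (F.map_d g).symm.trans (congrArg F.functor.map hg)⟩)

/-- The objects `X` and `Y` are isomorphic in the category `H^0(C)`: there are closed morphisms of
degree `0` in both directions that are inverse to each other up to boundaries. -/
def DGCat.IsoInH0 {C : DGCat k} (X Y : C) : Prop :=
  ∃ (f : X ⟶ Y) (g : Y ⟶ X),
    f ∈ DGCat.hom X Y 0 ∧ DGCat.d X Y f = 0 ∧ g ∈ DGCat.hom Y X 0 ∧ DGCat.d Y X g = 0 ∧
    (∃ h ∈ DGCat.hom X X (-1), DGCat.d X X h = 𝟙 X - f ≫ g) ∧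
    (∃ h ∈ DGCat.hom Y Y (-1), DGCat.d Y Y h = 𝟙 Y - g ≫ f)

/-- A dg functor `F` is a quasi-equivalence if `H^*(F)` is fully faithful and `H^0(F)` is
essentially surjective. -/
def IsQuasiEquivalence {C D : DGCat k} (F : DGFunctor C D) : Prop :=
  (∀ X Y : C, Function.Bijective (F.mapCohomology X Y)) ∧
  ∀ Y : D, ∃ X : C, DGCat.IsoInH0 (C := D) (F.functor.obj X) Y

end

/-! ### The category of semifree dg categories -/

/-- The category `dgCat_s` of small semifree dg categories over `k` and dg functors. -/
abbrev SemifreeDGCat (k : Type u) [CommRing k] : Type (u + 1) :=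
  ObjectProperty.FullSubcategory (fun C : DGCat k => IsSemifree C)

/-- The quasi-equivalences between semifree dg categories. -/
def quasiEquivalences (k : Type u) [CommRing k] : MorphismProperty (SemifreeDGCat k) :=
  fun _ _ F => IsQuasiEquivalence F.hom

/-- The semifree extensions between semifree dg categories. -/
def semifreeExtensions (k : Type u) [CommRing k] : MorphismProperty (SemifreeDGCat k) :=
  fun _ _ F => IsSemifreeExtension F.hom

/-! ### Cofibration categories and categories of cofibrant objects -/

section

variable {M : Type*} [Category* M]

/-- An object `R` is fibrant if every trivial cofibration out of `R` has a retraction. -/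
def IsFibrantObject (we cof : MorphismProperty M) (R : M) : Prop :=
  ∀ ⦃Q : M⦄ (i : R ⟶ Q), cof i → we i → ∃ r : Q ⟶ R, i ≫ r = 𝟙 R

/-- An object `X` is cofibrant if the category has an initial object and the morphism from it
to `X` is a cofibration. -/
def IsCofibrantObject (cof : MorphismProperty M) (X : M) : Prop :=
  ∃ (I : M) (hI : IsInitial I), cof (hI.to X)

/-- A cofibration category in the sense of Baues, with weak equivalences `we` and
cofibrations `cof`. -/
structure IsCofibrationCategory (we cof : MorphismProperty M) : Prop where
  /-- composition axiom -/
  we_of_isIso : ∀ ⦃X Y : M⦄ (f : X ⟶ Y), IsIso f → we f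
  cof_of_isIso : ∀ ⦃X Y : M⦄ (f : X ⟶ Y), IsIso f → cof f
  we_two_out_of_three : we.HasTwoOutOfThreeProperty
  cof_comp : cof.IsStableUnderComposition
  /-- pushout axiom: pushouts of cofibrations exist -/
  hasPushout : ∀ ⦃B A Y : M⦄ (i : B ⟶ A) (f : B ⟶ Y), cof i → HasPushout i f
  /-- pushout axiom: the pushout of a cofibration is a cofibration -/
  cof_pushout : ∀ ⦃B A Y P : M⦄ (i : B ⟶ A) (f : B ⟶ Y) (f' : A ⟶ P) (i' : Y ⟶ P),
    IsPushout i f f' i' → cof i → cof i'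
  /-- pushout axiom: the pushout of a weak equivalence along a cofibration is a weak equivalence -/
  we_pushout_along_cof : ∀ ⦃B A Y P : M⦄ (i : B ⟶ A) (f : B ⟶ Y) (f' : A ⟶ P) (i' : Y ⟶ P),
    IsPushout i f f' i' → cof i → we f → we f'
  /-- pushout axiom: the pushout of a trivial cofibration is a weak equivalence -/
  we_pushout_of_trivial_cof : ∀ ⦃B A Y P : M⦄ (i : B ⟶ A) (f : B ⟶ Y) (f' : A ⟶ P) (i' : Y ⟶ P),
    IsPushout i f f' i' → cof i → we i → we i'
  /-- factorization axiom -/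
  factorization : ∀ ⦃B Y : M⦄ (f : B ⟶ Y), ∃ (A : M) (i : B ⟶ A) (g : A ⟶ Y),
    cof i ∧ we g ∧ i ≫ g = f
  /-- axiom on fibrant models -/
  fibrant_model : ∀ X : M, ∃ (R : M) (i : X ⟶ R), cof i ∧ we i ∧ IsFibrantObject we cof R

/-- A category of cofibrant objects (the dual of Brown's categories of fibrant objects), with
weak equivalences `we` and cofibrations `cof`. -/
structure IsCategoryOfCofibrantObjects (we cof : MorphismProperty M) : Prop where
  /-- finite coproducts, in particular an initial object, exist -/
  hasFiniteCoproducts : HasFiniteCoproducts M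
  we_of_isIso : ∀ ⦃X Y : M⦄ (f : X ⟶ Y), IsIso f → we f
  we_two_out_of_three : we.HasTwoOutOfThreeProperty
  cof_of_isIso : ∀ ⦃X Y : M⦄ (f : X ⟶ Y), IsIso f → cof f
  cof_comp : cof.IsStableUnderComposition
  /-- pushouts of cofibrations along arbitrary morphisms exist -/
  hasPushout : ∀ ⦃B A Y : M⦄ (i : B ⟶ A) (f : B ⟶ Y), cof i → HasPushout i f
  cof_pushout : ∀ ⦃B A Y P : M⦄ (i : B ⟶ A) (f : B ⟶ Y) (f' : A ⟶ P) (i' : Y ⟶ P),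
    IsPushout i f f' i' → cof i → cof i'
  we_pushout_of_trivial_cof : ∀ ⦃B A Y P : M⦄ (i : B ⟶ A) (f : B ⟶ Y) (f' : A ⟶ P) (i' : Y ⟶ P),
    IsPushout i f f' i' → cof i → we i → we i'
  /-- every object `X` has a cylinder object: the codiagonal `X ⨿ X ⟶ X` factors as a cofibration
  followed by a weak equivalence -/
  cylinder : ∀ (X : M) (c : BinaryCofan X X) (hc : IsColimit c),
    ∃ (Z : M) (i : c.pt ⟶ Z) (p : Z ⟶ X),
      cof i ∧ we p ∧ i ≫ p = BinaryCofan.IsColimit.desc hc (𝟙 X) (𝟙 X)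
  /-- every object is cofibrant -/
  cofibrant : ∀ X : M, IsCofibrantObject cof X

end

/-!
Every argument rests on two facts about a semifree extension `i : R ⟶ Q`. The first is the lifting
principle `IsSemifreeExtension.exists_lift`: to extend a dg functor from `R` to `Q`, one chooses the
values on the generators by well-founded recursion, and each choice only requires a primitive of a
closed morphism that is already determined. The second is that free extensions can be written down
(`FreeCat`, `FreeBasis.Ext`): over a semifree base, adding objects and generators gives a category
whose morphisms are linear combinations of paths, and a derivation is given by its values on the
generators. Semifree dg categories are exactly the semifree extensions of the empty dg category
(`isSemifree_iff`), so they are cofibrant.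

*Homotopies.* The mapping path dg category `MapPath F` of a dg functor `F : C ⟶ D` has as objects
the homotopy equivalences `F X ⟶ Y` and as morphisms the squares with a homotopy. If `F` is a
quasi-equivalence, dg functors lift along the projection `MapPath F ⟶ D` relative to semifree
extensions (`MapPath.exists_lift`). Lifting the identity of `D` when `F` is a trivial cofibration
shows that `F` is the inclusion of a strong deformation retract (`MapPath.exists_deformation`);
in particular every object is fibrant. Lifting when `F` is an identity is the homotopy extension
property. A dg functor with a homotopy inverse is a quasi-equivalence
(`MapPath.isQuasiEquivalence_of_homotopy`).

*Pushouts.* The pushout of a semifree extension along a dg functor to a semifree dg category is the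
free extension by the same generators (`IsSemifreeExtension.exists_isPushout`). For a trivial
cofibration, the deformation retraction passes to the pushout
(`isQuasiEquivalence_pushout_of_trivialCofibration`).

*Factorizations.* A dg functor `φ : B ⟶ Y` out of a semifree dg category factors as a semifree
extension followed by a trivial fibration (`DGFunctor.exists_factorization`). Instead of iterating
the attachment of cells, all cells are attached at once: there is one generator for every formal
expression `a` in the generators and every parallel morphism `m` of `Y`. Its differential is `a` and
its image is `m` if this is consistent, and both are zero otherwise. Whether it is consistent can be
decided by recursion on `a`, since the differential and the image of `a` only depend on cells that
occur in `a`.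

*Pushouts of weak equivalences.* By the factorization and the two-out-of-three property, a
quasi-equivalence is a trivial cofibration followed by a trivial fibration `q`. Between semifree dg
categories, `q` has a section and is a homotopy equivalence relative to its target, which the
homotopy extension property transports to pushouts
(`IsTrivialFibration.isQuasiEquivalence_pushout`, `IsQuasiEquivalence.pushout`).
-/

/-! ### Internal gradings -/

namespace InternalGrading

variable {k M N : Type u} [CommRing k] [AddCommGroup M] [Module k M] [AddCommGroup N] [Module k N]
  {A : ℤ → Submodule k M} {B : ℤ → Submodule k N}

lemma induction (h : DirectSum.IsInternal A) {P : M → Prop} (h0 : P 0)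
    (hadd : ∀ x y, P x → P y → P (x + y)) (hmem : ∀ p, ∀ x ∈ A p, P x) (x : M) : P x :=
  Submodule.iSup_induction A (motive := P)
    (h.submodule_iSup_eq_top ▸ Submodule.mem_top) hmem h0 hadd

/-- The projection of an internally graded module to its component of degree `p`. -/
noncomputable def proj (h : DirectSum.IsInternal A) (p : ℤ) : M →ₗ[k] M :=
  (A p).subtype ∘ₗ DirectSum.component k ℤ (fun q => A q) p ∘ₗ
    (LinearEquiv.ofBijective (DirectSum.coeLinearMap A) h).symm.toLinearMap

lemma proj_mem (h : DirectSum.IsInternal A) (p : ℤ) (x : M) : proj h p x ∈ A p :=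
  Submodule.coe_mem _

lemma proj_of_mem (h : DirectSum.IsInternal A) {p : ℤ} {x : M} (hx : x ∈ A p) :
    proj h p x = x :=
  congrArg Subtype.val (h.ofBijective_coeLinearMap_same (⟨x, hx⟩ : A p))

lemma proj_of_mem_ne (h : DirectSum.IsInternal A) {p q : ℤ} {x : M} (hx : x ∈ A p) (hpq : p ≠ q) :
    proj h q x = 0 := by
  have := h.ofBijective_coeLinearMap_of_mem_ne hpq hx
  simp only [proj, LinearMap.comp_apply, Submodule.subtype_apply]
  exact congrArg Subtype.val this

/-- A linear map which is homogeneous of degree `r` commutes with the projections. -/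
lemma proj_map (h : DirectSum.IsInternal A) (h' : DirectSum.IsInternal B) (L : M →ₗ[k] N) (r : ℤ)
    (hL : ∀ q, ∀ x ∈ A q, L x ∈ B (q + r)) (p : ℤ) (x : M) :
    proj h' (p + r) (L x) = L (proj h p x) := by
  induction x using induction h with
  | h0 => simp
  | hadd x y hx hy => simp [hx, hy]
  | hmem q x hx =>
    by_cases hq : q = p
    · subst hq
      rw [proj_of_mem h hx, proj_of_mem h' (hL _ _ hx)]
    · rw [proj_of_mem_ne h hx hq, proj_of_mem_ne h' (hL _ _ hx) (by omega), map_zero]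

/-- The sign operator: multiplication by `(-1)^p` in degree `p`. -/
noncomputable def sgn (h : DirectSum.IsInternal A) : M →ₗ[k] M :=
  DirectSum.toModule k ℤ M (fun p => (p.negOnePow : ℤ) • (A p).subtype) ∘ₗ
    (LinearEquiv.ofBijective (DirectSum.coeLinearMap A) h).symm.toLinearMap

lemma sgn_of_mem (h : DirectSum.IsInternal A) {p : ℤ} {x : M} (hx : x ∈ A p) :
    sgn h x = p.negOnePow • x := by
  have : (LinearEquiv.ofBijective (DirectSum.coeLinearMap A) h).symm x =
      DirectSum.lof k ℤ (fun q => A q) p ⟨x, hx⟩ := by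
    refine (LinearEquiv.symm_apply_eq _).2 ?_
    exact (DirectSum.coeLinearMap_lof A p ⟨x, hx⟩).symm
  refine (congrArg (DirectSum.toModule k ℤ M _) this).trans ?_
  rw [DirectSum.toModule_lof]
  simp [Units.smul_def]

/-- A family of submodules is an internal grading as soon as there are candidates for the
projections and the family spans. -/
lemma isInternal_of_proj (π : ℤ → M →ₗ[k] M) (h1 : ∀ p, ∀ x ∈ A p, π p x = x)
    (h2 : ∀ p q, p ≠ q → ∀ x ∈ A p, π q x = 0) (h3 : ⨆ p, A p = ⊤) :
    DirectSum.IsInternal A := by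
  refine DirectSum.isInternal_submodule_of_iSupIndep_of_iSup_eq_top ?_ h3
  refine iSupIndep_def.2 fun p => Submodule.disjoint_def.2 fun x hx hx' => ?_
  rw [← h1 p x hx]
  have : (⨆ q, ⨆ (_ : q ≠ p), A q) ≤ LinearMap.ker (π p) :=
    iSup_le fun q => iSup_le fun hq y hy => h2 q p hq y hy
  exact this hx'

/-- A spanning family of homogeneous submodules exhausts the grading. -/
lemma mem_of_iSup_eq_top (h : DirectSum.IsInternal A) {S : ℤ → Submodule k M}
    (hS : ∀ p, S p ≤ A p) {p : ℤ} {x : M} (hx : x ∈ A p) (hx' : x ∈ ⨆ q, S q) : x ∈ S p := by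
  rw [← proj_of_mem h hx]
  refine Submodule.iSup_induction S (motive := fun y => proj h p y ∈ S p) hx' ?_ (by simp) ?_
  · intro q y hy
    by_cases hq : q = p
    · subst hq
      rwa [proj_of_mem h (hS _ hy)]
    · rw [proj_of_mem_ne h (hS _ hy) hq]
      exact zero_mem _
  · intro y z hy hz
    rw [map_add]
    exact add_mem hy hz

end InternalGrading

/-! ### Signs and components in dg categories -/

namespace DGCat

variable {k : Type u} [CommRing k] {C : DGCat k}

/-- The sign operator on a morphism complex, multiplication by `(-1)^p` in degree `p`. -/
noncomputable def sgn (X Y : C) : (X ⟶ Y) →ₗ[k] (X ⟶ Y) :=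
  InternalGrading.sgn (DGCategory.isInternal X Y)

/-- The component of degree `p` of a morphism. -/
noncomputable def proj (X Y : C) (p : ℤ) : (X ⟶ Y) →ₗ[k] (X ⟶ Y) :=
  InternalGrading.proj (DGCategory.isInternal X Y) p

variable {X Y Z : C}

lemma sgn_of_mem {p : ℤ} {f : X ⟶ Y} (hf : f ∈ hom X Y p) : sgn X Y f = p.negOnePow • f :=
  InternalGrading.sgn_of_mem _ hf

lemma proj_mem (p : ℤ) (f : X ⟶ Y) : proj X Y p f ∈ hom X Y p :=
  InternalGrading.proj_mem _ p f

lemma proj_of_mem {p : ℤ} {f : X ⟶ Y} (hf : f ∈ hom X Y p) : proj X Y p f = f :=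
  InternalGrading.proj_of_mem _ hf

lemma hom_induction {P : (X ⟶ Y) → Prop} (h0 : P 0) (hadd : ∀ x y, P x → P y → P (x + y))
    (hmem : ∀ p, ∀ x ∈ hom X Y p, P x) (x : X ⟶ Y) : P x :=
  InternalGrading.induction (DGCategory.isInternal X Y) h0 hadd hmem x

lemma d_mem {p q : ℤ} {f : X ⟶ Y} (hf : f ∈ hom X Y p) (h : p + 1 = q) : d X Y f ∈ hom X Y q :=
  h ▸ DGCategory.d_mem hf

lemma comp_mem {p q r : ℤ} {f : X ⟶ Y} {g : Y ⟶ Z} (hf : f ∈ hom X Y p) (hg : g ∈ hom Y Z q)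
    (h : p + q = r) : f ≫ g ∈ hom X Z r :=
  h ▸ DGCategory.comp_mem hf hg

lemma id_mem (X : C) : 𝟙 X ∈ hom X X 0 := DGCategory.id_mem (k := k) X

@[simp] lemma d_d (f : X ⟶ Y) : d X Y (d X Y f) = 0 := DGCategory.d_d f

lemma comp_units_smul (f : X ⟶ Y) (u : ℤˣ) (g : Y ⟶ Z) : f ≫ (u • g) = u • (f ≫ g) := by
  simp [Units.smul_def]

lemma units_smul_comp (u : ℤˣ) (f : X ⟶ Y) (g : Y ⟶ Z) : (u • f) ≫ g = u • (f ≫ g) := by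
  simp [Units.smul_def]

/-- The Leibniz rule for arbitrary morphisms. -/
lemma d_comp (f : X ⟶ Y) (g : Y ⟶ Z) :
    d X Z (f ≫ g) = f ≫ d Y Z g + d X Y f ≫ sgn Y Z g := by
  induction g using hom_induction with
  | h0 => simp
  | hadd x y hx hy =>
    simp only [Preadditive.comp_add, map_add, hx, hy]
    abel
  | hmem p x hx => rw [DGCategory.d_comp f hx, sgn_of_mem hx, comp_units_smul]

lemma sgn_of_mem_zero {f : X ⟶ Y} (hf : f ∈ hom X Y 0) : sgn X Y f = f := by
  simp [sgn_of_mem hf]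

lemma d_comp_zero (f : X ⟶ Y) {g : Y ⟶ Z} (hg : g ∈ hom Y Z 0) :
    d X Z (f ≫ g) = f ≫ d Y Z g + d X Y f ≫ g := by
  rw [d_comp, sgn_of_mem_zero hg]

@[simp] lemma sgn_id (X : C) : sgn X X (𝟙 X) = 𝟙 X := sgn_of_mem_zero (id_mem X)

@[simp] lemma d_id (X : C) : d X X (𝟙 X) = 0 := by
  have := d_comp (𝟙 X) (𝟙 X)
  simpa using this

lemma sgn_comp (f : X ⟶ Y) (g : Y ⟶ Z) : sgn X Z (f ≫ g) = sgn X Y f ≫ sgn Y Z g := by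
  induction f using hom_induction with
  | h0 => simp
  | hadd x y hx hy => simp [hx, hy]
  | hmem p f hf =>
    induction g using hom_induction with
    | h0 => simp
    | hadd x y hx hy => simp [hx, hy]
    | hmem q g hg =>
      rw [sgn_of_mem hf, sgn_of_mem hg, sgn_of_mem (comp_mem hf hg rfl), units_smul_comp,
        comp_units_smul, Int.negOnePow_add, mul_smul]

lemma sgn_d (f : X ⟶ Y) : sgn X Y (d X Y f) = - d X Y (sgn X Y f) := by
  induction f using hom_induction with
  | h0 => simp
  | hadd x y hx hy => simp only [map_add, hx, hy]; abel
  | hmem p f hf =>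
    rw [sgn_of_mem hf, sgn_of_mem (d_mem hf rfl), Int.negOnePow_succ]
    simp [Units.smul_def]

@[simp] lemma sgn_sgn (f : X ⟶ Y) : sgn X Y (sgn X Y f) = f := by
  induction f using hom_induction with
  | h0 => simp
  | hadd x y hx hy => simp [hx, hy]
  | hmem p f hf =>
    rw [sgn_of_mem hf, sgn_of_mem (Submodule.smul_of_tower_mem _ _ hf), smul_smul]
    simp

lemma sgn_mem {p : ℤ} {f : X ⟶ Y} (hf : f ∈ hom X Y p) : sgn X Y f ∈ hom X Y p := by
  rw [sgn_of_mem hf]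
  exact Submodule.smul_of_tower_mem _ _ hf

lemma proj_d (p q : ℤ) (h : p + 1 = q) (f : X ⟶ Y) :
    proj X Y q (d X Y f) = d X Y (proj X Y p f) := by
  subst h
  exact InternalGrading.proj_map _ _ (d X Y) 1 (fun _ _ h => d_mem h rfl) p f

/-- Composition with a morphism of degree `0` commutes with taking components. -/
lemma proj_comp_zero (p : ℤ) (f : X ⟶ Y) {g : Y ⟶ Z} (hg : g ∈ hom Y Z 0) :
    proj X Z p (f ≫ g) = proj X Y p f ≫ g := by
  have := InternalGrading.proj_map (DGCategory.isInternal X Y) (DGCategory.isInternal X Z)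
    (Linear.rightComp k X g) 0 (fun _ _ h => comp_mem h hg rfl) p f
  simpa [proj] using this

lemma proj_zero_comp (p : ℤ) {f : X ⟶ Y} (g : Y ⟶ Z) (hf : f ∈ hom X Y 0) :
    proj X Z p (f ≫ g) = f ≫ proj Y Z p g := by
  have := InternalGrading.proj_map (DGCategory.isInternal Y Z) (DGCategory.isInternal X Z)
    (Linear.leftComp k Z f) 0 (fun _ _ h => comp_mem hf h (by omega)) p g
  simpa [proj] using this

/-- A homogeneous boundary is the boundary of a homogeneous morphism. -/
lemma exists_homogeneous_of_boundary {p q : ℤ} (h : p + 1 = q) {f : X ⟶ Y} {g : X ⟶ Y}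
    (hf : f ∈ hom X Y q) (hg : d X Y g = f) : ∃ g' ∈ hom X Y p, d X Y g' = f :=
  ⟨proj X Y p g, proj_mem p g, by rw [← proj_d p q h, hg, proj_of_mem hf]⟩

end DGCat

namespace DGFunctor

open DGCat

variable {k : Type u} [CommRing k] {C D : DGCat k} (F : DGFunctor C D) {X Y : C}

lemma map_proj (p : ℤ) (f : X ⟶ Y) :
    F.functor.map (proj X Y p f) = proj (C := D) _ _ p (F.functor.map f) := by
  have := InternalGrading.proj_map (DGCategory.isInternal X Y)
    (DGCategory.isInternal (F.functor.obj X) (F.functor.obj Y))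
    (F.functor.mapLinearMap k (X := X) (Y := Y)) 0 (fun _ _ h => by simpa using F.map_mem h) p f
  simpa [proj] using this.symm

lemma map_sgn (f : X ⟶ Y) :
    F.functor.map (sgn X Y f) = sgn (C := D) _ _ (F.functor.map f) := by
  induction f using hom_induction with
  | h0 => simp
  | hadd x y hx hy => simp [hx, hy]
  | hmem p f hf =>
    rw [sgn_of_mem hf, sgn_of_mem (F.map_mem hf)]
    simp [Units.smul_def, F.functor.map_zsmul]

end DGFunctor

/-! ### The cohomology category -/

namespace DGCat

variable {k : Type u} [CommRing k] {C : DGCat k}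

/-- The class of a closed morphism in the total cohomology. -/
def cls {X Y : C} (f : X ⟶ Y) (hf : d X Y f = 0) : Cohomology X Y :=
  Submodule.Quotient.mk ⟨f, hf⟩

lemma cls_eq_cls {X Y : C} {f g : X ⟶ Y} {hf : d X Y f = 0} {hg : d X Y g = 0} :
    cls f hf = cls g hg ↔ ∃ h, d X Y h = f - g := by
  refine (Submodule.Quotient.eq _).trans ?_
  rfl

lemma cls_surjective {X Y : C} (x : Cohomology X Y) : ∃ f hf, cls (X := X) (Y := Y) f hf = x := by
  obtain ⟨⟨f, hf⟩, rfl⟩ := Submodule.Quotient.mk_surjective _ x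
  exact ⟨f, hf, rfl⟩

lemma d_comp_eq_zero {X Y Z : C} {f : X ⟶ Y} {g : Y ⟶ Z} (hf : d X Y f = 0) (hg : d Y Z g = 0) :
    d X Z (f ≫ g) = 0 := by
  simp [d_comp, hf, hg]

/-- The cohomology category `H^*(C)`: its morphisms are the total cohomology classes. -/
structure HoCat (C : DGCat k) : Type u where
  /-- the underlying object -/
  of : C

/-- The composition of cohomology classes, defined by means of representatives. -/
noncomputable def compCls {X Y Z : C} (x : Cohomology X Y) (y : Cohomology Y Z) :
    Cohomology X Z :=
  cls ((cls_surjective x).choose ≫ (cls_surjective y).choose)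
    (d_comp_eq_zero (cls_surjective x).choose_spec.choose (cls_surjective y).choose_spec.choose)

lemma compCls_cls {X Y Z : C} {f : X ⟶ Y} {g : Y ⟶ Z} (hf : d X Y f = 0) (hg : d Y Z g = 0) :
    compCls (cls f hf) (cls g hg) = cls (f ≫ g) (d_comp_eq_zero hf hg) := by
  have h₁ := (cls_surjective (cls f hf)).choose_spec.choose_spec
  have h₂ := (cls_surjective (cls g hg)).choose_spec.choose_spec
  have e₂ := (cls_surjective (cls g hg)).choose_spec.choose
  obtain ⟨a, ha⟩ := cls_eq_cls.1 h₁
  obtain ⟨b, hb⟩ := cls_eq_cls.1 h₂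
  refine cls_eq_cls.2 ⟨a ≫ sgn _ _ (cls_surjective (cls g hg)).choose + f ≫ b, ?_⟩
  have e₃ : d Y Z (sgn _ _ (cls_surjective (cls g hg)).choose) = 0 := by
    rw [← neg_eq_zero, ← sgn_d, e₂, map_zero]
  rw [map_add, d_comp, d_comp, e₃, sgn_sgn, hf, ha, hb]
  simp

noncomputable instance : Category (HoCat C) where
  Hom X Y := Cohomology X.of Y.of
  id X := cls (𝟙 X.of) (d_id _)
  comp := compCls
  id_comp {X Y} x := by
    obtain ⟨f, hf, rfl⟩ := cls_surjective x
    simp [compCls_cls]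
  comp_id {X Y} x := by
    obtain ⟨f, hf, rfl⟩ := cls_surjective x
    simp [compCls_cls]
  assoc {W X Y Z} x y z := by
    obtain ⟨f, hf, rfl⟩ := cls_surjective x
    obtain ⟨g, hg, rfl⟩ := cls_surjective y
    obtain ⟨h, hh, rfl⟩ := cls_surjective z
    simp [compCls_cls]

/-- The morphism of `H^*(C)` represented by a closed morphism. -/
def HoCat.mk' {X Y : C} (f : X ⟶ Y) (hf : d X Y f = 0) : HoCat.mk X ⟶ HoCat.mk Y := cls f hf

namespace HoCat

lemma mk'_surjective {X Y : C} (x : HoCat.mk X ⟶ HoCat.mk Y) :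
    ∃ f hf, HoCat.mk' (X := X) (Y := Y) f hf = x := cls_surjective x

lemma mk'_eq_mk' {X Y : C} {f g : X ⟶ Y} {hf : d X Y f = 0} {hg : d X Y g = 0} :
    HoCat.mk' f hf = HoCat.mk' g hg ↔ ∃ h, d X Y h = f - g := cls_eq_cls

lemma mk'_comp {X Y Z : C} {f : X ⟶ Y} {g : Y ⟶ Z} (hf : d X Y f = 0) (hg : d Y Z g = 0) :
    HoCat.mk' f hf ≫ HoCat.mk' g hg = HoCat.mk' (f ≫ g) (d_comp_eq_zero hf hg) :=
  compCls_cls hf hg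

lemma mk'_id (X : C) : HoCat.mk' (𝟙 X) (d_id X) = 𝟙 (HoCat.mk X) := rfl

end HoCat

/-- A homotopy equivalence: a closed morphism of degree `0` that is invertible in `H^*(C)`. Its
inverse is then automatically represented by a closed morphism of degree `0`. -/
structure IsHEquiv {X Y : C} (f : X ⟶ Y) : Prop where
  mem : f ∈ hom X Y 0
  closed : d X Y f = 0
  isIso : IsIso (HoCat.mk' f closed)

lemma IsHEquiv.id (X : C) : IsHEquiv (𝟙 X) :=
  ⟨id_mem X, d_id X, by rw [HoCat.mk'_id]; infer_instance⟩

lemma IsHEquiv.comp {X Y Z : C} {f : X ⟶ Y} {g : Y ⟶ Z} (hf : IsHEquiv f) (hg : IsHEquiv g) :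
    IsHEquiv (f ≫ g) :=
  ⟨comp_mem hf.mem hg.mem (by simp), d_comp_eq_zero hf.closed hg.closed, by
    have := hf.isIso
    have := hg.isIso
    rw [← HoCat.mk'_comp hf.closed hg.closed]
    infer_instance⟩

/-- A homotopy equivalence has an inverse up to homotopy of degree `0`, with homotopies of
degree `-1`. -/
lemma IsHEquiv.exists_inv {X Y : C} {f : X ⟶ Y} (hf : IsHEquiv f) :
    ∃ g : Y ⟶ X, g ∈ hom Y X 0 ∧ d Y X g = 0 ∧ (∃ h ∈ hom X X (-1), d X X h = 𝟙 X - f ≫ g) ∧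
      (∃ h ∈ hom Y Y (-1), d Y Y h = 𝟙 Y - g ≫ f) := by
  have := hf.isIso
  obtain ⟨g, hg, hg'⟩ := HoCat.mk'_surjective (inv (HoCat.mk' f hf.closed))
  have h₁ := IsIso.hom_inv_id (HoCat.mk' f hf.closed)
  have h₂ := IsIso.inv_hom_id (HoCat.mk' f hf.closed)
  rw [← hg', HoCat.mk'_comp, ← HoCat.mk'_id] at h₁ h₂
  obtain ⟨a, ha⟩ := HoCat.mk'_eq_mk'.1 h₁.symm
  obtain ⟨b, hb⟩ := HoCat.mk'_eq_mk'.1 h₂.symm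
  refine ⟨proj _ _ 0 g, proj_mem _ _, ?_, ⟨proj _ _ (-1) a, proj_mem _ _, ?_⟩,
    ⟨proj _ _ (-1) b, proj_mem _ _, ?_⟩⟩
  · rw [← proj_d 0 1 (by simp), hg, map_zero]
  · rw [← proj_d (-1) 0 (by simp), ha, map_sub, proj_of_mem (id_mem X),
      proj_zero_comp _ _ hf.mem]
  · rw [← proj_d (-1) 0 (by simp), hb, map_sub, proj_of_mem (id_mem Y),
      proj_comp_zero _ _ hf.mem]

lemma IsHEquiv.of_inv {X Y : C} {f : X ⟶ Y} {g : Y ⟶ X} (hf : f ∈ hom X Y 0) (hf' : d X Y f = 0)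
    (hg : d Y X g = 0) {a : X ⟶ X} {b : Y ⟶ Y} (ha : d X X a = 𝟙 X - f ≫ g)
    (hb : d Y Y b = 𝟙 Y - g ≫ f) : IsHEquiv f :=
  ⟨hf, hf', ⟨HoCat.mk' g hg, by
    rw [HoCat.mk'_comp, ← HoCat.mk'_id]; exact (HoCat.mk'_eq_mk'.2 ⟨a, ha⟩).symm, by
    rw [HoCat.mk'_comp, ← HoCat.mk'_id]; exact (HoCat.mk'_eq_mk'.2 ⟨b, hb⟩).symm⟩⟩

lemma isoInH0_iff {X Y : C} : IsoInH0 X Y ↔ ∃ f : X ⟶ Y, IsHEquiv f := by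
  constructor
  · rintro ⟨f, g, hf, hf', -, hg, ⟨a, -, ha⟩, ⟨b, -, hb⟩⟩
    exact ⟨f, .of_inv hf hf' hg ha hb⟩
  · rintro ⟨f, hf⟩
    obtain ⟨g, hg, hg', h⟩ := hf.exists_inv
    exact ⟨f, g, hf.mem, hf.closed, hg, hg', h⟩

lemma IsHEquiv.eqToHom {X Y : C} (h : X = Y) : IsHEquiv (eqToHom h) := by
  subst h
  exact .id X

end DGCat

namespace DGFunctor

open DGCat

variable {k : Type u} [CommRing k] {C D E : DGCat k}

/-- The functor `H^*(F)` between cohomology categories. -/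
noncomputable def mapHo (F : DGFunctor C D) : HoCat C ⥤ HoCat D where
  obj X := ⟨F.functor.obj X.of⟩
  map {X Y} := F.mapCohomology X.of Y.of
  map_id X := congrArg (fun f => Submodule.Quotient.mk f) (Subtype.ext (F.functor.map_id X.of))
  map_comp {X Y Z} x y := by
    obtain ⟨f, hf, rfl⟩ := cls_surjective x
    obtain ⟨g, hg, rfl⟩ := cls_surjective y
    change F.mapCohomology X.of Z.of (compCls (cls f hf) (cls g hg)) = compCls _ _
    rw [compCls_cls]
    refine Eq.trans ?_ (compCls_cls (C := D) (f := F.functor.map f) (g := F.functor.map g)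
      (by rw [← F.map_d, hf, F.functor.map_zero])
      (by rw [← F.map_d, hg, F.functor.map_zero])).symm
    exact congrArg (fun f => Submodule.Quotient.mk f) (Subtype.ext (F.functor.map_comp f g))

variable (F : DGFunctor C D)

lemma map_closed {X Y : C} {f : X ⟶ Y} (hf : d X Y f = 0) :
    d (C := D) _ _ (F.functor.map f) = 0 := by
  rw [← F.map_d, hf, F.functor.map_zero]

lemma map_isHEquiv {X Y : C} {f : X ⟶ Y} (hf : IsHEquiv f) :
    IsHEquiv (C := D) (F.functor.map f) :=
  ⟨F.map_mem hf.mem, F.map_closed hf.closed, by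
    have := hf.isIso
    exact inferInstanceAs (IsIso (F.mapHo.map (HoCat.mk' f hf.closed)))⟩

/-- `F` is cohomologically fully faithful. -/
def IsQFF : Prop := ∀ X Y : C, Function.Bijective (F.mapCohomology X Y)

variable {F}

lemma IsQFF.full (h : F.IsQFF) : F.mapHo.Full := ⟨fun {X Y} => (h X.of Y.of).2⟩

lemma IsQFF.faithful (h : F.IsQFF) : F.mapHo.Faithful := ⟨fun {X Y} _ _ e => (h X.of Y.of).1 e⟩

lemma isQFF_of_fullyFaithful (h : F.mapHo.Full) (h' : F.mapHo.Faithful) : F.IsQFF := by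
  intro X Y
  have h₁ := F.mapHo.map_injective (X := HoCat.mk X) (Y := HoCat.mk Y)
  have h₂ := F.mapHo.map_surjective (X := HoCat.mk X) (Y := HoCat.mk Y)
  exact ⟨h₁, h₂⟩

/-- Cohomologically fully faithful dg functors reflect homotopy equivalences. -/
lemma IsQFF.isHEquiv (h : F.IsQFF) {X Y : C} {f : X ⟶ Y} (hf : f ∈ hom X Y 0) (hf' : d X Y f = 0)
    (hF : IsHEquiv (C := D) (F.functor.map f)) : IsHEquiv f :=
  ⟨hf, hf', by
    have := h.full
    have := h.faithful
    have : IsIso (F.mapHo.map (HoCat.mk' f hf')) := hF.isIso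
    exact isIso_of_reflects_iso _ F.mapHo⟩

/-- Isomorphisms in `H^0` lift along cohomologically fully faithful dg functors. -/
lemma IsQFF.isoInH0 (h : F.IsQFF) {X Y : C}
    (hF : IsoInH0 (C := D) (F.functor.obj X) (F.functor.obj Y)) : IsoInH0 X Y := by
  obtain ⟨f, hf⟩ := isoInH0_iff.1 hF
  have := h.full
  obtain ⟨x, hx⟩ := F.mapHo.map_surjective (X := ⟨X⟩) (Y := ⟨Y⟩) (HoCat.mk' f hf.closed)
  obtain ⟨c, hc, rfl⟩ := HoCat.mk'_surjective x
  obtain ⟨b, hb⟩ : ∃ b, d (C := D) (F.functor.obj X) (F.functor.obj Y) b = F.functor.map c - f :=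
    HoCat.mk'_eq_mk'.1 hx
  have hc' : d X Y (proj X Y 0 c) = 0 := by rw [← proj_d 0 1 (by simp), hc, map_zero]
  -- `c` need not be homogeneous, but its component of degree `0` is still mapped to the class of `f`.
  refine isoInH0_iff.2 ⟨proj X Y 0 c, h.isHEquiv (proj_mem _ _) hc'
    ⟨F.map_mem (proj_mem _ _), F.map_closed hc', ?_⟩⟩
  convert hf.isIso using 1
  refine HoCat.mk'_eq_mk'.2 ⟨proj _ _ (-1) b, ?_⟩
  rw [← proj_d (-1) 0 (by simp), hb, map_sub, proj_of_mem hf.mem, map_proj]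

end DGFunctor

open DGCat DGFunctor

variable {k : Type u} [CommRing k] {C D E : DGCat k} {F : DGFunctor C D}

/-- Quasi-equivalences induce equivalences of cohomology categories. -/
lemma IsQuasiEquivalence.isEquivalence (h : IsQuasiEquivalence F) : F.mapHo.IsEquivalence where
  full := IsQFF.full h.1
  faithful := IsQFF.faithful h.1
  essSurj := ⟨fun Y => by
    obtain ⟨X, hX⟩ := h.2 Y.of
    obtain ⟨f, hf⟩ := isoInH0_iff.1 hX
    have := hf.isIso
    exact ⟨⟨X⟩, ⟨asIso (X := HoCat.mk (F.functor.obj X)) (HoCat.mk' f hf.closed)⟩⟩⟩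

/-- Essential surjectivity of `H^0(F)` is required separately: isomorphisms in the category
`HoCat D`, whose morphisms have arbitrary degrees, need not have degree `0`. -/
lemma IsQuasiEquivalence.of_isEquivalence [F.mapHo.IsEquivalence]
    (h : ∀ Y : D, ∃ X : C, IsoInH0 (C := D) (F.functor.obj X) Y) : IsQuasiEquivalence F :=
  ⟨isQFF_of_fullyFaithful inferInstance inferInstance, h⟩

/-- `H^*` is compatible with composition. -/
noncomputable def DGFunctor.mapHoComp (F : DGFunctor C D) (G : DGFunctor D E) :
    F.mapHo ⋙ G.mapHo ≅ (F.comp G).mapHo :=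
  NatIso.ofComponents (fun _ => Iso.refl _) (fun {X Y} x => by
    obtain ⟨f, hf, rfl⟩ := cls_surjective x
    exact (Category.comp_id _).trans (Category.id_comp _).symm)

/-- `H^*` is compatible with identities. -/
noncomputable def DGFunctor.mapHoId (C : DGCat k) : 𝟭 _ ≅ (DGFunctor.id C).mapHo :=
  NatIso.ofComponents (fun _ => Iso.refl _) (fun {X Y} x => by
    obtain ⟨f, hf, rfl⟩ := cls_surjective x
    exact (Category.comp_id _).trans (Category.id_comp _).symm)

lemma IsQuasiEquivalence.comp {G : DGFunctor D E} (hF : IsQuasiEquivalence F)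
    (hG : IsQuasiEquivalence G) : IsQuasiEquivalence (F.comp G) := by
  have := hF.isEquivalence
  have := hG.isEquivalence
  have : (F.comp G).mapHo.IsEquivalence :=
    Functor.isEquivalence_of_iso (mapHoComp F G)
  refine .of_isEquivalence fun Z => ?_
  obtain ⟨Y, hY⟩ := hG.2 Z
  obtain ⟨X, hX⟩ := hF.2 Y
  obtain ⟨f, hf⟩ := isoInH0_iff.1 hX
  obtain ⟨g, hg⟩ := isoInH0_iff.1 hY
  exact ⟨X, isoInH0_iff.2 ⟨G.functor.map f ≫ g, (G.map_isHEquiv hf).comp hg⟩⟩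

lemma IsQuasiEquivalence.of_comp_left {G : DGFunctor D E} (hF : IsQuasiEquivalence F)
    (hFG : IsQuasiEquivalence (F.comp G)) : IsQuasiEquivalence G := by
  have := hF.isEquivalence
  have := hFG.isEquivalence
  have := Functor.isEquivalence_of_iso (mapHoComp F G).symm
  have := Functor.isEquivalence_of_comp_left F.mapHo G.mapHo
  refine .of_isEquivalence fun Z => ?_
  obtain ⟨X, hX⟩ := hFG.2 Z
  exact ⟨F.functor.obj X, hX⟩

lemma IsQuasiEquivalence.of_comp_right {G : DGFunctor D E} (hG : IsQuasiEquivalence G)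
    (hFG : IsQuasiEquivalence (F.comp G)) : IsQuasiEquivalence F := by
  have := hG.isEquivalence
  have := hFG.isEquivalence
  have := Functor.isEquivalence_of_iso (mapHoComp F G).symm
  have := Functor.isEquivalence_of_comp_right F.mapHo G.mapHo
  refine .of_isEquivalence fun Y => ?_
  obtain ⟨X, hX⟩ := hFG.2 (G.functor.obj Y)
  exact ⟨X, IsQFF.isoInH0 hG.1 hX⟩

lemma IsQuasiEquivalence.id (C : DGCat k) : IsQuasiEquivalence (DGFunctor.id C) := by
  have : (DGFunctor.id C).mapHo.IsEquivalence :=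
    Functor.isEquivalence_of_iso (mapHoId C)
  exact .of_isEquivalence fun Y => ⟨Y, isoInH0_iff.2 ⟨𝟙 Y, .id Y⟩⟩

/-! ### Functors out of free extensions -/

section FreeExtension

variable {k : Type u} [CommRing k]

/-- All members of a family of morphisms. -/
inductive FamilyMor {C : Type u} [Category.{u} C] {ι : Type u} {s t : ι → C}
    (f : ∀ i, s i ⟶ t i) : MorphismProperty C
  | mk (i : ι) : FamilyMor f (f i)

variable {C D E : Type u} [Category.{u} C] [Preadditive C] [Linear k C]
  [Category.{u} D] [Preadditive D] [Linear k D] [Category.{u} E] [Preadditive E] [Linear k E]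

namespace IsFreeExtension

variable {F : C ⥤ D} {ι : Type u} {s t : ι → D} {f : ∀ i, s i ⟶ t i}
  (hF : IsFreeExtension k F f) (G : C ⥤ E) [G.Additive] [G.Linear k] (o : D → E)
  (ho : ∀ X, o (F.obj X) = G.obj X) (φ : ∀ i, o (s i) ⟶ o (t i))

/-- The functor given by the universal property of a free extension, arranged so that its values
on objects are the prescribed ones by definition. -/
noncomputable def lift : D ⥤ E :=
  (hF E G o ho φ).choose.copyObj o
    (fun X => eqToIso ((hF E G o ho φ).choose_spec.1.2.2.2.choose X))

lemma lift_eq : hF.lift G o ho φ = (hF E G o ho φ).choose :=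
  CategoryTheory.Functor.ext (fun X => ((hF E G o ho φ).choose_spec.1.2.2.2.choose X).symm)
    (fun X Y m => by simp [lift, Functor.copyObj])

instance lift_additive : (hF.lift G o ho φ).Additive := by
  rw [lift_eq]
  exact (hF E G o ho φ).choose_spec.1.1

instance lift_linear : (hF.lift G o ho φ).Linear k := by
  rw [lift_eq]
  exact (hF E G o ho φ).choose_spec.1.2.1

lemma comp_lift : F ⋙ hF.lift G o ho φ = G := by
  rw [lift_eq]
  exact (hF E G o ho φ).choose_spec.1.2.2.1

lemma lift_map_gen (i : ι) : (hF.lift G o ho φ).map (f i) = φ i := by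
  have h := (hF E G o ho φ).choose_spec.1.2.2.2
  change eqToHom (h.choose _).symm ≫ (hF E G o ho φ).choose.map (f i) ≫ eqToHom (h.choose _) = φ i
  rw [h.choose_spec i]
  simp

lemma lift_map_map {X Y : C} (g : X ⟶ Y) :
    (hF.lift G o ho φ).map (F.map g) = eqToHom (ho X) ≫ G.map g ≫ eqToHom (ho Y).symm :=
  Functor.congr_hom (hF.comp_lift G o ho φ) g

lemma hom_ext [F.Additive] [F.Linear k] (hF : IsFreeExtension k F f) {H H' : D ⥤ E}
    [H.Additive] [H.Linear k] [H'.Additive] [H'.Linear k]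
    (hobj : ∀ X, H.obj X = H'.obj X) (hFH : F ⋙ H = F ⋙ H')
    (hf : ∀ i, HEq (H.map (f i)) (H'.map (f i))) : H = H' := by
  refine (hF E (F ⋙ H') H'.obj (fun _ => rfl) (fun i => H'.map (f i))).unique
    ⟨inferInstance, inferInstance, hFH, hobj, fun i => ?_⟩
    ⟨inferInstance, inferInstance, rfl, fun _ => rfl, fun i => by simp⟩
  exact (conj_eqToHom_iff_heq _ _ _ (hobj _)).2 (hf i)

end IsFreeExtension

/-! ### Subcategories generated by morphisms -/

/-- The wide `k`-linear subcategory generated by a class of morphisms. -/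
structure GenCat (k : Type u) [CommRing k] {C : Type u} [Category.{u} C] [Preadditive C]
    [Linear k C] (W : MorphismProperty C) : Type u where
  /-- the underlying object -/
  of : C

/-- The submodule of generated morphisms. -/
def genSubmodule (k : Type u) [CommRing k] {C : Type u} [Category.{u} C] [Preadditive C]
    [Linear k C] (W : MorphismProperty C) (X Y : C) : Submodule k (X ⟶ Y) where
  carrier := {f | GeneratedBy k W f}
  add_mem' hf hg := .add _ _ hf hg
  zero_mem' := .zero _ _
  smul_mem' r _ hf := .smul r _ hf

variable (k) in
instance (W : MorphismProperty C) : Category (GenCat k W) where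
  Hom X Y := genSubmodule k W X.of Y.of
  id X := ⟨𝟙 X.of, .id _⟩
  comp f g := ⟨f.1 ≫ g.1, .comp _ _ f.2 g.2⟩
  id_comp f := Subtype.ext (Category.id_comp f.1)
  comp_id f := Subtype.ext (Category.comp_id f.1)
  assoc f g h := Subtype.ext (Category.assoc f.1 g.1 h.1)

variable (k) in
instance (W : MorphismProperty C) : Preadditive (GenCat k W) where
  homGroup X Y := inferInstanceAs (AddCommGroup (genSubmodule k W X.of Y.of))
  add_comp _ _ _ f f' g := Subtype.ext (Preadditive.add_comp _ _ _ f.1 f'.1 g.1)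
  comp_add _ _ _ f g g' := Subtype.ext (Preadditive.comp_add _ _ _ f.1 g.1 g'.1)

variable (k) in
instance (W : MorphismProperty C) : Linear k (GenCat k W) where
  homModule X Y := inferInstanceAs (Module k (genSubmodule k W X.of Y.of))
  smul_comp _ _ _ r f g := Subtype.ext (Linear.smul_comp _ _ _ r f.1 g.1)
  comp_smul _ _ _ f r g := Subtype.ext (Linear.comp_smul _ _ _ f.1 r g.1)

namespace GenCat

variable (k) (W : MorphismProperty C)

/-- The inclusion of the subcategory generated by `W`. -/
def incl : GenCat k W ⥤ C where
  obj X := X.of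
  map f := f.1
  map_id _ := rfl
  map_comp _ _ := rfl

instance : (incl k W).Additive where
  map_add := rfl

instance : (incl k W).Linear k where
  map_smul _ _ := rfl

variable {k W}

/-- A functor with values in generated morphisms factors through the generated subcategory. -/
def factor (G : E ⥤ C) (hG : ∀ ⦃X Y : E⦄ (f : X ⟶ Y), GeneratedBy k W (G.map f)) :
    E ⥤ GenCat k W where
  obj X := ⟨G.obj X⟩
  map f := ⟨G.map f, hG f⟩
  map_id X := Subtype.ext (G.map_id X)
  map_comp f g := Subtype.ext (G.map_comp f g)

instance (G : E ⥤ C) [G.Additive] (hG : ∀ ⦃X Y : E⦄ (f : X ⟶ Y), GeneratedBy k W (G.map f)) :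
    (factor G hG).Additive where
  map_add := Subtype.ext G.map_add

instance (G : E ⥤ C) [G.Linear k] (hG : ∀ ⦃X Y : E⦄ (f : X ⟶ Y), GeneratedBy k W (G.map f)) :
    (factor G hG).Linear k where
  map_smul f r := Subtype.ext (Functor.Linear.map_smul (F := G) f r)

end GenCat

/-- In a free extension, every morphism is generated by the image and the family: the universal
property gives a retraction onto the generated subcategory. -/
lemma IsFreeExtension.generated {F : C ⥤ D} [F.Additive] [F.Linear k] {ι : Type u} {s t : ι → D}
    {f : ∀ i, s i ⟶ t i} (hF : IsFreeExtension k F f) {X Y : D} (m : X ⟶ Y) :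
    GeneratedBy k (ImageMor F ⊔ FamilyMor f) m := by
  let W := ImageMor F ⊔ FamilyMor f
  have hG := fun ⦃X Y : C⦄ (g : X ⟶ Y) =>
    GeneratedBy.of (k := k) (W := W) (F.map g) (Or.inl ⟨g⟩)
  let G := GenCat.factor F hG
  have : G.Additive := inferInstanceAs (GenCat.factor F hG).Additive
  have : G.Linear k := inferInstanceAs ((GenCat.factor F hG).Linear k)
  let H := hF.lift G (fun X => GenCat.mk X) (fun _ => rfl)
    (fun i => ⟨f i, .of _ (Or.inr ⟨i⟩)⟩)
  have : H.Additive := hF.lift_additive _ _ _ _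
  have : H.Linear k := hF.lift_linear _ _ _ _
  have key : H ⋙ GenCat.incl k W = 𝟭 D := by
    refine hF.hom_ext (fun _ => rfl) ?_ (fun i => ?_)
    · rw [← Functor.assoc, show F ⋙ H = G from hF.comp_lift _ _ _ _]
      rfl
    · refine heq_of_eq ?_
      change (H.map (f i)).1 = f i
      exact congrArg Subtype.val (hF.lift_map_gen G (fun X => GenCat.mk X) (fun _ => rfl) _ i)
  have h2 : (H.map m).1 = 𝟙 X ≫ m ≫ 𝟙 Y := Functor.congr_hom key m
  rw [Category.comp_id, Category.id_comp] at h2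
  rw [← h2]
  exact (H.map m).2

lemma GeneratedBy.mono {W W' : MorphismProperty C} (h : W ≤ W') {X Y : C} {m : X ⟶ Y}
    (hm : GeneratedBy k W m) : GeneratedBy k W' m := by
  induction hm with
  | of f hf => exact .of _ (h _ hf)
  | id X => exact .id X
  | comp f g _ _ hf hg => exact .comp _ _ hf hg
  | zero X Y => exact .zero _ _
  | add f g _ _ hf hg => exact .add _ _ hf hg
  | smul r f _ hf => exact .smul _ _ hf

lemma GeneratedBy.eqToHom {W : MorphismProperty C} {X Y : C} (h : X = Y) :
    GeneratedBy k W (CategoryTheory.eqToHom h) := by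
  subst h
  exact .id X

lemma GeneratedBy.map (F : C ⥤ D) [F.Additive] [F.Linear k] {W : MorphismProperty C}
    {W' : MorphismProperty D} (h : ∀ ⦃X Y : C⦄ (f : X ⟶ Y), W f → GeneratedBy k W' (F.map f))
    {X Y : C} {m : X ⟶ Y} (hm : GeneratedBy k W m) : GeneratedBy k W' (F.map m) := by
  induction hm with
  | of f hf => exact h _ hf
  | id X => rw [F.map_id]; exact .id _
  | comp f g _ _ hf hg => rw [F.map_comp]; exact .comp _ _ hf hg
  | zero X Y => rw [F.map_zero]; exact .zero _ _
  | add f g _ _ hf hg => rw [F.map_add]; exact .add _ _ hf hg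
  | smul r f _ hf => rw [F.map_smul]; exact .smul _ _ hf

end FreeExtension

/-! ### Functors preserving gradings and differentials -/

/-- A grading and a graded derivation on a `k`-linear category; the derivation need not be
homogeneous and its square need not vanish. -/
structure PreDG (k : Type u) [CommRing k] (E : Type u) [Category.{u} E] [Preadditive E]
    [Linear k E] where
  /-- the submodule of homogeneous morphisms of a given degree -/
  hom (X Y : E) (p : ℤ) : Submodule k (X ⟶ Y)
  /-- the derivation -/
  d (X Y : E) : (X ⟶ Y) →ₗ[k] (X ⟶ Y)
  id_mem (X : E) : 𝟙 X ∈ hom X X 0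
  comp_mem {X Y Z : E} {p q : ℤ} {f : X ⟶ Y} {g : Y ⟶ Z} :
    f ∈ hom X Y p → g ∈ hom Y Z q → f ≫ g ∈ hom X Z (p + q)
  d_comp {X Y Z : E} {q : ℤ} (f : X ⟶ Y) {g : Y ⟶ Z} : g ∈ hom Y Z q →
    d X Z (f ≫ g) = f ≫ d Y Z g + q.negOnePow • (d X Y f ≫ g)

/-- The grading and differential of a dg category. -/
def DGCat.preDG {k : Type u} [CommRing k] (C : DGCat k) : PreDG k C where
  hom := DGCategory.hom
  d := DGCategory.d
  id_mem := DGCategory.id_mem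
  comp_mem := DGCategory.comp_mem
  d_comp := DGCategory.d_comp

namespace PreDG

variable {k : Type u} [CommRing k] {E : Type u} [Category.{u} E] [Preadditive E] [Linear k E]
  (P : PreDG k E)

lemma d_id (X : E) : P.d X X (𝟙 X) = 0 := by
  have := P.d_comp (𝟙 X) (P.id_mem X)
  simpa using this

variable {C D : DGCat k}

/-- The functor `H` preserves degrees and commutes with the derivations. -/
structure Preserves (H : D ⥤ E) : Prop where
  map_mem {X Y : D} {p : ℤ} {f : X ⟶ Y} : f ∈ DGCat.hom X Y p → H.map f ∈ P.hom _ _ p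
  map_d {X Y : D} (f : X ⟶ Y) : H.map (DGCat.d X Y f) = P.d _ _ (H.map f)

variable (H : D ⥤ E) [H.Additive] [H.Linear k]

/-- The homogeneous morphisms whose degree and differential are preserved by `H`. -/
def compat (X Y : D) (p : ℤ) : Submodule k (X ⟶ Y) :=
  DGCat.hom X Y p ⊓ (P.hom _ _ p).comap (H.mapLinearMap k) ⊓
    LinearMap.eqLocus (H.mapLinearMap k ∘ₗ DGCat.d X Y) (P.d _ _ ∘ₗ H.mapLinearMap k)

variable {P H}

lemma mem_compat {X Y : D} {p : ℤ} {x : X ⟶ Y} : x ∈ P.compat H X Y p ↔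
    x ∈ DGCat.hom X Y p ∧ H.map x ∈ P.hom _ _ p ∧ H.map (DGCat.d X Y x) = P.d _ _ (H.map x) :=
  and_assoc

lemma compat_comp {X Y Z : D} {p q : ℤ} {x : X ⟶ Y} {y : Y ⟶ Z} (hx : x ∈ P.compat H X Y p)
    (hy : y ∈ P.compat H Y Z q) : x ≫ y ∈ P.compat H X Z (p + q) := by
  rw [mem_compat] at *
  refine ⟨DGCat.comp_mem hx.1 hy.1 rfl, ?_, ?_⟩
  · rw [H.map_comp]
    exact P.comp_mem hx.2.1 hy.2.1
  · rw [DGCategory.d_comp x hy.1, H.map_comp, P.d_comp _ hy.2.1, H.map_add, H.map_comp,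
      Units.smul_def, Units.smul_def, H.map_zsmul, H.map_comp, ← hx.2.2, ← hy.2.2]

lemma iSup_compat_comp {X Y Z : D} {x : X ⟶ Y} {y : Y ⟶ Z} (hx : x ∈ ⨆ p, P.compat H X Y p)
    (hy : y ∈ ⨆ p, P.compat H Y Z p) : x ≫ y ∈ ⨆ p, P.compat H X Z p := by
  refine Submodule.iSup_induction _ (motive := fun x => x ≫ y ∈ ⨆ p, P.compat H X Z p) hx ?_
    (by simp) (fun a b ha hb => by rw [Preadditive.add_comp]; exact add_mem ha hb)
  intro p x hx
  refine Submodule.iSup_induction _ (motive := fun y => x ≫ y ∈ ⨆ p, P.compat H X Z p) hy ?_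
    (by simp) (fun a b ha hb => by rw [Preadditive.comp_add]; exact add_mem ha hb)
  intro q y hy
  exact Submodule.mem_iSup_of_mem (p + q) (compat_comp hx hy)

/-- The morphisms all of whose components are compatible with `H` form a subcategory, hence contain
everything that is generated by such morphisms. -/
lemma mem_iSup_compat_of_generatedBy {W : MorphismProperty D}
    (hW : ∀ ⦃X Y : D⦄ (w : X ⟶ Y), W w → w ∈ ⨆ p, P.compat H X Y p) {X Y : D} {m : X ⟶ Y}
    (hm : GeneratedBy k W m) : m ∈ ⨆ p, P.compat H X Y p := by
  induction hm with
  | of f hf => exact hW _ hf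
  | id X =>
    refine Submodule.mem_iSup_of_mem 0 (mem_compat.2 ⟨DGCat.id_mem X, ?_, ?_⟩)
    · rw [H.map_id]; exact P.id_mem _
    · rw [DGCat.d_id, H.map_id, P.d_id, H.map_zero]
  | comp f g _ _ hf hg => exact iSup_compat_comp hf hg
  | zero X Y => exact zero_mem _
  | add f g _ _ hf hg => exact add_mem hf hg
  | smul r f _ hf => exact Submodule.smul_mem _ r hf

lemma mem_compat_of_mem_iSup {X Y : D} {p : ℤ} {m : X ⟶ Y} (hm : m ∈ ⨆ p, P.compat H X Y p)
    (hp : m ∈ DGCat.hom X Y p) : m ∈ P.compat H X Y p :=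
  InternalGrading.mem_of_iSup_eq_top (DGCategory.isInternal X Y)
    (fun _ _ h => (mem_compat.1 h).1) hp hm

lemma map_d_of_mem_iSup {X Y : D} {m : X ⟶ Y} (hm : m ∈ ⨆ p, P.compat H X Y p) :
    H.map (DGCat.d X Y m) = P.d _ _ (H.map m) := by
  refine Submodule.iSup_induction _
    (motive := fun m => H.map (DGCat.d X Y m) = P.d _ _ (H.map m)) hm
    (fun p x hx => (mem_compat.1 hx).2.2) (by simp) (fun a b ha hb => ?_)
  simp only [map_add, H.map_add, ha, hb]

lemma Preserves.map_mem_iSup {F : DGFunctor C D} (h : P.Preserves (F.functor ⋙ H)) {X Y : C}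
    (c : X ⟶ Y) : F.functor.map c ∈ ⨆ p, P.compat H _ _ p := by
  induction c using DGCat.hom_induction with
  | h0 => simp
  | hadd x y hx hy => rw [F.functor.map_add]; exact add_mem hx hy
  | hmem p x hx =>
    refine Submodule.mem_iSup_of_mem p (mem_compat.2 ⟨F.map_mem hx, h.map_mem hx, ?_⟩)
    rw [← F.map_d]
    exact h.map_d x

/-- A `k`-linear functor out of a free extension preserves degrees and derivations as soon as it
does so on the base and on the generators. -/
lemma preserves_of_isFreeExtension {F : DGFunctor C D} {ι : Type u} {s t : ι → D}
    {f : ∀ i, s i ⟶ t i} {deg : ι → ℤ} (hdeg : ∀ i, f i ∈ DGCat.hom (s i) (t i) (deg i))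
    (hF : IsFreeExtension k F.functor f) (h : P.Preserves (F.functor ⋙ H))
    (hf : ∀ i, H.map (f i) ∈ P.hom _ _ (deg i))
    (hfd : ∀ i, H.map (DGCat.d _ _ (f i)) = P.d _ _ (H.map (f i))) : P.Preserves H := by
  have key : ∀ {X Y : D} (m : X ⟶ Y), m ∈ ⨆ p, P.compat H X Y p := fun m => by
    refine mem_iSup_compat_of_generatedBy ?_ (hF.generated m)
    rintro X Y w (⟨⟨c⟩⟩ | ⟨⟨i⟩⟩)
    · exact h.map_mem_iSup c
    · exact Submodule.mem_iSup_of_mem (deg i) (mem_compat.2 ⟨hdeg i, hf i, hfd i⟩)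
  exact ⟨fun hp => (mem_compat.1 (mem_compat_of_mem_iSup (key _) hp)).2.1,
    fun m => map_d_of_mem_iSup (key m)⟩

lemma preserves_dgFunctor (F : DGFunctor C D) : D.preDG.Preserves F.functor :=
  ⟨F.map_mem, F.map_d⟩

/-- The dg functor underlying a functor that preserves degrees and differentials. -/
def Preserves.toDGFunctor {H : C ⥤ D} [H.Additive] [H.Linear k] (h : D.preDG.Preserves H) :
    DGFunctor C D where
  functor := H
  map_mem := h.map_mem
  map_d := h.map_d

lemma Preserves.comp {F : DGFunctor C D} {H : D ⥤ E} (h : P.Preserves H) :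
    P.Preserves (F.functor ⋙ H) where
  map_mem hf := h.map_mem (F.map_mem hf)
  map_d f := (congrArg H.map (F.map_d f)).trans (h.map_d _)

end PreDG

/-! ### Composition of semifree extensions -/

section

variable {k : Type u} [CommRing k]

section Linear

lemma familyBelow_of {C : Type u} [Category.{u} C] {ι : Type u} {_ : LT ι} {s t : ι → C}
    (f : ∀ i, s i ⟶ t i) {i : ι} (j : ι) (h : j < i) : FamilyBelow f i (f j) := ⟨j, h⟩

variable {C D E : Type u} [Category.{u} C] [Preadditive C] [Linear k C]
  [Category.{u} D] [Preadditive D] [Linear k D] [Category.{u} E] [Preadditive E] [Linear k E]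

/-- The image of a family `f` under `G`, together with a family `g`. -/
def sumFamily (G : D ⥤ E) {ι κ : Type u} {s t : ι → D} {s' t' : κ → E} (f : ∀ i, s i ⟶ t i)
    (g : ∀ j, s' j ⟶ t' j) : ∀ i : ι ⊕ κ, (Sum.elim (fun i => G.obj (s i)) s' i : E) ⟶
      Sum.elim (fun i => G.obj (t i)) t' i
  | .inl i => G.map (f i)
  | .inr j => g j

lemma IsFreeExtension.comp {F : C ⥤ D} {G : D ⥤ E} [F.Additive] [F.Linear k] [G.Additive]
    [G.Linear k] {ι κ : Type u} {s t : ι → D} {s' t' : κ → E} {f : ∀ i, s i ⟶ t i}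
    {g : ∀ j, s' j ⟶ t' j} (hF : IsFreeExtension k F f) (hG : IsFreeExtension k G g) :
    IsFreeExtension k (F ⋙ G) (sumFamily G f g) := by
  intro B _ _ _ K _ _ o ho φ
  let H₁ := hF.lift K (fun X => o (G.obj X)) ho (fun i => φ (.inl i))
  have : H₁.Additive := hF.lift_additive _ _ _ _
  have : H₁.Linear k := hF.lift_linear _ _ _ _
  have e₁ : F ⋙ H₁ = K := hF.comp_lift _ _ _ _
  have hf₁ : ∀ i, H₁.map (f i) = φ (.inl i) := hF.lift_map_gen _ _ _ _
  let H₂ := hG.lift H₁ o (fun _ => rfl) (fun j => φ (.inr j))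
  have : H₂.Additive := hG.lift_additive _ _ _ _
  have : H₂.Linear k := hG.lift_linear _ _ _ _
  have e₂ : G ⋙ H₂ = H₁ := hG.comp_lift _ _ _ _
  have hf₂ : ∀ j, H₂.map (g j) = φ (.inr j) := hG.lift_map_gen _ _ _ _
  have hGf : ∀ i, H₂.map (G.map (f i)) = φ (.inl i) := fun i => by
    rw [← hf₁]
    exact (Functor.congr_hom e₂ (f i)).trans ((Category.id_comp _).trans (Category.comp_id _))
  refine ⟨H₂, ⟨inferInstance, inferInstance, by rw [Functor.assoc, e₂, e₁], fun _ => rfl, ?_⟩, ?_⟩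
  · rintro (i | j)
    · exact (hGf i).trans ((Category.id_comp _).trans (Category.comp_id _)).symm
    · exact (hf₂ j).trans ((Category.id_comp _).trans (Category.comp_id _)).symm
  · rintro H' ⟨_, _, e, h, hf⟩
    refine hG.hom_ext h ?_ fun j => ?_
    · rw [e₂]
      refine hF.hom_ext (fun X => h (G.obj X)) ?_ fun i => ?_
      · rw [e₁, ← Functor.assoc, e]
      · rw [hf₁]
        exact (conj_eqToHom_iff_heq _ _ _ (h _)).1 (hf (.inl i))
    · rw [hf₂]
      exact (conj_eqToHom_iff_heq _ _ _ (h _)).1 (hf (.inr j))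

/-- An isomorphism is a free extension by the empty family. -/
lemma isFreeExtension_of_iso {F : C ⥤ D} (I : D ⥤ C) [I.Additive] [I.Linear k]
    (h₁ : F ⋙ I = 𝟭 C) (h₂ : I ⋙ F = 𝟭 D) {s t : PEmpty.{u + 1} → D} (f : ∀ i, s i ⟶ t i) :
    IsFreeExtension k F f := by
  intro B _ _ _ K _ _ o ho φ
  refine ⟨I ⋙ K, ⟨inferInstance, inferInstance, ?_, fun X => ?_, fun i => i.elim⟩, ?_⟩
  · rw [← Functor.assoc, h₁, Functor.id_comp]
  · exact (ho (I.obj X)).symm.trans (congrArg o (Functor.congr_obj h₂ X))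
  · rintro H ⟨_, _, e, -⟩
    rw [← e, ← Functor.assoc, h₂, Functor.id_comp]

end Linear

variable {C D E : DGCat k}

lemma IsSemifreeExtension.comp {F : DGFunctor C D} {G : DGFunctor D E}
    (hF : IsSemifreeExtension F) (hG : IsSemifreeExtension G) :
    IsSemifreeExtension (F.comp G) := by
  obtain ⟨hF₁, hF₂, ι, _, _, s, t, f, deg, hdeg, hf, hd⟩ := hF
  obtain ⟨hG₁, hG₂, κ, _, _, s', t', g, deg', hdeg', hg, hd'⟩ := hG
  refine ⟨hG₁.comp hF₁, inferInstanceAs (F.functor ⋙ G.functor).Faithful, ι ⊕ κ,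
    inferInstanceAs (LinearOrder (ι ⊕ₗ κ)), ⟨Sum.lex_wf IsWellFounded.wf IsWellFounded.wf⟩, _, _,
    sumFamily G.functor f g, Sum.elim deg deg', ?_, hf.comp hg, ?_⟩
  · rintro (i | j)
    · exact G.map_mem (hdeg i)
    · exact hdeg' j
  · rintro (i | j)
    · change GeneratedBy k _ (DGCat.d (C := E) _ _ (G.functor.map (f i)))
      rw [← G.map_d]
      refine (hd i).map G.functor ?_
      rintro X Y m (⟨⟨c⟩⟩ | ⟨⟨j, hj⟩⟩)
      · exact .of _ (Or.inl ⟨c⟩)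
      · exact .of _ (Or.inr (familyBelow_of (sumFamily G.functor f g) (Sum.inl j)
          (Sum.Lex.inl hj)))
    · refine (hd' j).map (𝟭 E) ?_
      rintro X Y m (⟨⟨c⟩⟩ | ⟨⟨j, hj⟩⟩)
      · refine (hf.generated c).map G.functor ?_
        rintro X Y m (⟨⟨c⟩⟩ | ⟨⟨i⟩⟩)
        · exact .of _ (Or.inl ⟨c⟩)
        · exact .of _ (Or.inr (familyBelow_of (sumFamily G.functor f g) (Sum.inl i)
            (Sum.Lex.sep _ _)))
      · exact .of _ (Or.inr (familyBelow_of (sumFamily G.functor f g) (Sum.inr j)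
            (Sum.Lex.inr hj)))

lemma isSemifreeExtension_of_inverse {F : DGFunctor C D} {G : DGFunctor D C}
    (h₁ : F.comp G = DGFunctor.id C) (h₂ : G.comp F = DGFunctor.id D) :
    IsSemifreeExtension F := by
  have e₁ : F.functor ⋙ G.functor = 𝟭 C := congrArg DGFunctor.functor h₁
  have e₂ : G.functor ⋙ F.functor = 𝟭 D := congrArg DGFunctor.functor h₂
  refine ⟨fun X Y h => ?_, ⟨fun {X Y} f g h => ?_⟩, PEmpty, inferInstance, inferInstance,
    PEmpty.elim, PEmpty.elim, fun i => i.elim, PEmpty.elim, fun i => i.elim,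
    isFreeExtension_of_iso G.functor e₁ e₂ _, fun i => i.elim⟩
  · exact (Functor.congr_obj e₁ X).symm.trans
      ((congrArg G.functor.obj h).trans (Functor.congr_obj e₁ Y))
  · have : (F.functor ⋙ G.functor).Faithful := by rw [e₁]; infer_instance
    exact (F.functor ⋙ G.functor).map_injective (congrArg G.functor.map h)

/-! ### The empty dg category -/

variable (k) in
/-- The dg category without objects. -/
def DGCat.empty : DGCat k :=
  letI : Category.{u} PEmpty.{u + 1} :=
    { Hom X _ := X.elim
      id X := X.elim
      comp {X} := X.elim
      id_comp {X} := X.elim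
      comp_id {X} := X.elim
      assoc {X} := X.elim }
  letI : Preadditive PEmpty.{u + 1} :=
    { homGroup X := X.elim
      add_comp X := X.elim
      comp_add X := X.elim }
  letI : Linear k PEmpty.{u + 1} :=
    { homModule X := X.elim
      smul_comp X := X.elim
      comp_smul X := X.elim }
  { carrier := PEmpty
    dg :=
      { hom X := X.elim
        isInternal X := X.elim
        id_mem X := X.elim
        comp_mem {X} := X.elim
        d X := X.elim
        d_mem {X} := X.elim
        d_d {X} := X.elim
        d_comp {X} := X.elim } }

namespace DGCat.empty

lemma elim (X : DGCat.empty k) : False := PEmpty.elim X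

/-- The functor from the empty dg category to any category. -/
def functorTo (E : Type u) [Category.{u} E] : DGCat.empty k ⥤ E where
  obj X := (elim X).elim
  map {X} := (elim X).elim
  map_id X := (elim X).elim
  map_comp {X} := (elim X).elim

instance (E : Type u) [Category.{u} E] [Preadditive E] :
    (functorTo (k := k) E).Additive := ⟨fun {X} => (elim X).elim⟩

instance (E : Type u) [Category.{u} E] [Preadditive E] [Linear k E] :
    (functorTo (k := k) E).Linear k := ⟨fun {X} => (elim X).elim⟩

lemma functor_eq {E : Type u} [Category.{u} E] (F G : DGCat.empty k ⥤ E) : F = G :=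
  CategoryTheory.Functor.ext (fun X => (elim X).elim) (fun X => (elim X).elim)

/-- The dg functor from the empty dg category to any dg category. -/
def desc (C : DGCat k) : DGFunctor (DGCat.empty k) C where
  functor := functorTo C
  map_mem {X} := (elim X).elim
  map_d {X} := (elim X).elim

lemma dgFunctor_eq {C : DGCat k} (F G : DGFunctor (DGCat.empty k) C) : F = G :=
  DGFunctor.ext (functor_eq _ _)

end DGCat.empty

lemma isFreelyGenerated_iff (F : DGFunctor (DGCat.empty k) C) {ι : Type u} {s t : ι → C}
    (f : ∀ i, s i ⟶ t i) : IsFreelyGenerated k f ↔ IsFreeExtension k F.functor f := by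
  constructor
  · intro h E _ _ _ G _ _ o ho φ
    obtain ⟨H, hH, hH'⟩ := h E o φ
    exact ⟨H, ⟨hH.1, hH.2.1, DGCat.empty.functor_eq _ _, hH.2.2⟩,
      fun H' h' => hH' H' ⟨h'.1, h'.2.1, h'.2.2.2⟩⟩
  · intro h E _ _ _ o φ
    obtain ⟨H, hH, hH'⟩ := h E (DGCat.empty.functorTo E) o (fun X => (DGCat.empty.elim X).elim) φ
    exact ⟨H, ⟨hH.1, hH.2.1, hH.2.2.2⟩,
      fun H' h' => hH' H' ⟨h'.1, h'.2.1, DGCat.empty.functor_eq _ _, h'.2.2⟩⟩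

/-- A dg category is semifree if and only if it is a semifree extension of the empty one. -/
lemma isSemifree_iff (F : DGFunctor (DGCat.empty k) C) :
    IsSemifree C ↔ IsSemifreeExtension F := by
  constructor
  · rintro ⟨ι, i₁, i₂, s, t, f, deg, hdeg, hf, hd⟩
    exact ⟨fun X => (DGCat.empty.elim X).elim, ⟨fun {X} => (DGCat.empty.elim X).elim⟩,
      ι, i₁, i₂, s, t, f, deg, hdeg, (isFreelyGenerated_iff F f).1 hf,
      fun i => (hd i).mono le_sup_right⟩
  · rintro ⟨-, -, ι, i₁, i₂, s, t, f, deg, hdeg, hf, hd⟩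
    refine ⟨ι, i₁, i₂, s, t, f, deg, hdeg, (isFreelyGenerated_iff F f).2 hf, fun i => ?_⟩
    refine (hd i).mono ?_
    rintro X Y m (⟨@⟨Z, _, _⟩⟩ | h)
    · exact (DGCat.empty.elim Z).elim
    · exact h

lemma IsSemifreeExtension.isSemifree {F : DGFunctor C D} (hF : IsSemifreeExtension F)
    (hC : IsSemifree C) : IsSemifree D :=
  (isSemifree_iff _).2 (((isSemifree_iff (DGCat.empty.desc C)).1 hC).comp hF)

lemma isSemifree_empty : IsSemifree (DGCat.empty k) :=
  (isSemifree_iff (DGFunctor.id _)).2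
    (isSemifreeExtension_of_inverse (G := DGFunctor.id _) (DGCat.empty.dgFunctor_eq _ _)
      (DGCat.empty.dgFunctor_eq _ _))

end

/-! ### The mapping path dg category -/

section

variable {k : Type u} [CommRing k] {C D D' : DGCat k}

open DGCat

/-- The objects of the mapping path dg category of `F : C ⟶ D`: homotopy equivalences
`F X ⟶ Y`. -/
structure MapPath (F : DGFunctor C D) : Type u where
  /-- the source, an object of `C` -/
  fst : C
  /-- the target, an object of `D` -/
  snd : D
  /-- the homotopy equivalence -/
  eqv : F.functor.obj fst ⟶ snd
  isHEquiv : IsHEquiv eqv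

namespace MapPath

variable {F : DGFunctor C D}

/-- A morphism from `f : F X ⟶ Y` to `f' : F X' ⟶ Y'` is a triple of morphisms `a : X ⟶ X'`,
`b : Y ⟶ Y'` and `h : F X ⟶ Y'`; a closed one of degree `0` is a square commuting up to the
homotopy `h`. The sign in the composition is the one required by the Leibniz rule, `h` having
degree one less than `a` and `b`. -/
noncomputable instance : Category (MapPath F) where
  Hom P Q := (P.fst ⟶ Q.fst) × (P.snd ⟶ Q.snd) × (F.functor.obj P.fst ⟶ Q.snd)
  id P := (𝟙 _, 𝟙 _, 0)
  comp {P Q R} m n :=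
    (m.1 ≫ n.1, m.2.1 ≫ n.2.1, F.functor.map m.1 ≫ n.2.2 + m.2.2 ≫ sgn _ _ n.2.1)
  id_comp {P Q} m := by simp
  comp_id {P Q} m := by simp
  assoc {P Q R S} m n o := by simp [sgn_comp, add_assoc]

variable {P Q R : MapPath F}

lemma hom_ext {m n : P ⟶ Q} (h₁ : m.1 = n.1) (h₂ : m.2.1 = n.2.1) (h₃ : m.2.2 = n.2.2) : m = n :=
  Prod.ext h₁ (Prod.ext h₂ h₃)

@[simp] lemma comp_fst (m : P ⟶ Q) (n : Q ⟶ R) : (m ≫ n).1 = m.1 ≫ n.1 := rfl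
@[simp] lemma comp_snd (m : P ⟶ Q) (n : Q ⟶ R) : (m ≫ n).2.1 = m.2.1 ≫ n.2.1 := rfl
@[simp] lemma comp_hty (m : P ⟶ Q) (n : Q ⟶ R) :
    (m ≫ n).2.2 = F.functor.map m.1 ≫ n.2.2 + m.2.2 ≫ sgn _ _ n.2.1 := rfl

noncomputable instance : Preadditive (MapPath F) where
  homGroup P Q := inferInstanceAs
    (AddCommGroup ((P.fst ⟶ Q.fst) × (P.snd ⟶ Q.snd) × (F.functor.obj P.fst ⟶ Q.snd)))
  add_comp P Q R m m' n := hom_ext (Preadditive.add_comp _ _ _ _ _ _)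
    (Preadditive.add_comp _ _ _ _ _ _) (by
      change F.functor.map (m.1 + m'.1) ≫ n.2.2 + (m.2.2 + m'.2.2) ≫ sgn _ _ n.2.1 =
        (F.functor.map m.1 ≫ n.2.2 + m.2.2 ≫ sgn _ _ n.2.1) +
        (F.functor.map m'.1 ≫ n.2.2 + m'.2.2 ≫ sgn _ _ n.2.1)
      rw [F.functor.map_add, Preadditive.add_comp, Preadditive.add_comp]
      abel)
  comp_add P Q R m n n' := hom_ext (Preadditive.comp_add _ _ _ _ _ _)
    (Preadditive.comp_add _ _ _ _ _ _) (by
      change F.functor.map m.1 ≫ (n.2.2 + n'.2.2) + m.2.2 ≫ sgn _ _ (n.2.1 + n'.2.1) =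
        (F.functor.map m.1 ≫ n.2.2 + m.2.2 ≫ sgn _ _ n.2.1) +
        (F.functor.map m.1 ≫ n'.2.2 + m.2.2 ≫ sgn _ _ n'.2.1)
      rw [map_add, Preadditive.comp_add, Preadditive.comp_add]
      abel)

@[simp] lemma add_fst (m n : P ⟶ Q) : (m + n).1 = m.1 + n.1 := rfl
@[simp] lemma add_snd (m n : P ⟶ Q) : (m + n).2.1 = m.2.1 + n.2.1 := rfl
@[simp] lemma add_hty (m n : P ⟶ Q) : (m + n).2.2 = m.2.2 + n.2.2 := rfl

noncomputable instance : Linear k (MapPath F) where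
  homModule P Q := inferInstanceAs
    (Module k ((P.fst ⟶ Q.fst) × (P.snd ⟶ Q.snd) × (F.functor.obj P.fst ⟶ Q.snd)))
  smul_comp P Q R r m n := hom_ext (Linear.smul_comp _ _ _ _ _ _)
    (Linear.smul_comp _ _ _ _ _ _) (by
      change F.functor.map (r • m.1) ≫ n.2.2 + (r • m.2.2) ≫ sgn _ _ n.2.1 =
        r • (F.functor.map m.1 ≫ n.2.2 + m.2.2 ≫ sgn _ _ n.2.1)
      rw [F.functor.map_smul, Linear.smul_comp, Linear.smul_comp, smul_add])
  comp_smul P Q R m r n := hom_ext (Linear.comp_smul _ _ _ _ _ _)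
    (Linear.comp_smul _ _ _ _ _ _) (by
      change F.functor.map m.1 ≫ (r • n.2.2) + m.2.2 ≫ sgn _ _ (r • n.2.1) =
        r • (F.functor.map m.1 ≫ n.2.2 + m.2.2 ≫ sgn _ _ n.2.1)
      rw [map_smul, Linear.comp_smul, Linear.comp_smul, smul_add])

@[simp] lemma smul_hty (r : k) (m : P ⟶ Q) : (r • m).2.2 = r • m.2.2 := rfl

/-- The homogeneous morphisms; the homotopy component of a morphism of degree `p` has
degree `p - 1`. -/
def homDeg (P Q : MapPath F) (p : ℤ) : Submodule k (P ⟶ Q) where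
  carrier := {m | m.1 ∈ hom P.fst Q.fst p ∧ m.2.1 ∈ hom P.snd Q.snd p ∧
    m.2.2 ∈ hom (F.functor.obj P.fst) Q.snd (p - 1)}
  add_mem' h h' := ⟨add_mem h.1 h'.1, add_mem h.2.1 h'.2.1, add_mem h.2.2 h'.2.2⟩
  zero_mem' := ⟨zero_mem _, zero_mem _, zero_mem _⟩
  smul_mem' r _ h := ⟨Submodule.smul_mem _ r h.1, Submodule.smul_mem _ r h.2.1,
    Submodule.smul_mem _ r h.2.2⟩

lemma mem_homDeg {p : ℤ} {m : P ⟶ Q} : m ∈ homDeg P Q p ↔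
    m.1 ∈ hom P.fst Q.fst p ∧ m.2.1 ∈ hom P.snd Q.snd p ∧
      m.2.2 ∈ hom (F.functor.obj P.fst) Q.snd (p - 1) := Iff.rfl

/-- The differential of the mapping path dg category. -/
noncomputable def diff (P Q : MapPath F) : (P ⟶ Q) →ₗ[k] (P ⟶ Q) where
  toFun m := (d _ _ m.1, d _ _ m.2.1,
    P.eqv ≫ m.2.1 - F.functor.map m.1 ≫ Q.eqv - d _ _ m.2.2)
  map_add' m n := hom_ext (map_add _ _ _) (map_add _ _ _) (by
    change P.eqv ≫ (m.2.1 + n.2.1) - F.functor.map (m.1 + n.1) ≫ Q.eqv - d _ _ (m.2.2 + n.2.2) =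
      (P.eqv ≫ m.2.1 - F.functor.map m.1 ≫ Q.eqv - d _ _ m.2.2) +
      (P.eqv ≫ n.2.1 - F.functor.map n.1 ≫ Q.eqv - d _ _ n.2.2)
    rw [map_add, F.functor.map_add, Preadditive.comp_add, Preadditive.add_comp]
    abel)
  map_smul' r m := hom_ext (map_smul _ _ _) (map_smul _ _ _) (by
    change P.eqv ≫ (r • m.2.1) - F.functor.map (r • m.1) ≫ Q.eqv - d _ _ (r • m.2.2) =
      r • (P.eqv ≫ m.2.1 - F.functor.map m.1 ≫ Q.eqv - d _ _ m.2.2)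
    rw [map_smul, F.functor.map_smul, Linear.comp_smul, Linear.smul_comp, smul_sub, smul_sub])

@[simp] lemma diff_fst (m : P ⟶ Q) : (diff P Q m).1 = d _ _ m.1 := rfl
@[simp] lemma diff_snd (m : P ⟶ Q) : (diff P Q m).2.1 = d _ _ m.2.1 := rfl
@[simp] lemma diff_hty (m : P ⟶ Q) : (diff P Q m).2.2 =
    P.eqv ≫ m.2.1 - F.functor.map m.1 ≫ Q.eqv - d _ _ m.2.2 := rfl

/-- The projection to the component of degree `p`. -/
noncomputable def projDeg (P Q : MapPath F) (p : ℤ) : (P ⟶ Q) →ₗ[k] (P ⟶ Q) where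
  toFun m := (proj _ _ p m.1, proj _ _ p m.2.1, proj _ _ (p - 1) m.2.2)
  map_add' _ _ := hom_ext (map_add _ _ _) (map_add _ _ _) (map_add _ _ _)
  map_smul' _ _ := hom_ext (map_smul _ _ _) (map_smul _ _ _) (map_smul _ _ _)

lemma isInternal (P Q : MapPath F) : DirectSum.IsInternal (homDeg P Q) := by
  refine InternalGrading.isInternal_of_proj (projDeg P Q) ?_ ?_ ?_
  · rintro p m ⟨h₁, h₂, h₃⟩
    exact hom_ext (proj_of_mem h₁) (proj_of_mem h₂) (proj_of_mem h₃)
  · rintro p q hpq m ⟨h₁, h₂, h₃⟩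
    exact hom_ext (InternalGrading.proj_of_mem_ne _ h₁ hpq)
      (InternalGrading.proj_of_mem_ne _ h₂ hpq)
      (InternalGrading.proj_of_mem_ne _ h₃ (by omega))
  · refine eq_top_iff.2 fun m _ => ?_
    have h₁ : ∀ a : P.fst ⟶ Q.fst, ((a, 0, 0) : P ⟶ Q) ∈ ⨆ p, homDeg P Q p := fun a => by
      induction a using hom_induction with
      | h0 => exact zero_mem _
      | hadd x y hx hy =>
        convert add_mem hx hy using 1
        exact hom_ext rfl (add_zero _).symm (add_zero _).symm
      | hmem p x hx => exact Submodule.mem_iSup_of_mem p ⟨hx, zero_mem _, zero_mem _⟩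
    have h₂ : ∀ a : P.snd ⟶ Q.snd, ((0, a, 0) : P ⟶ Q) ∈ ⨆ p, homDeg P Q p := fun a => by
      induction a using hom_induction with
      | h0 => exact zero_mem _
      | hadd x y hx hy =>
        convert add_mem hx hy using 1
        exact hom_ext (add_zero _).symm rfl (add_zero _).symm
      | hmem p x hx => exact Submodule.mem_iSup_of_mem p ⟨zero_mem _, hx, zero_mem _⟩
    have h₃ : ∀ a : F.functor.obj P.fst ⟶ Q.snd,
        ((0, 0, a) : P ⟶ Q) ∈ ⨆ p, homDeg P Q p := fun a => by
      induction a using hom_induction with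
      | h0 => exact zero_mem _
      | hadd x y hx hy =>
        convert add_mem hx hy using 1
        exact hom_ext (add_zero _).symm (add_zero _).symm rfl
      | hmem p x hx =>
        exact Submodule.mem_iSup_of_mem (p + 1) ⟨zero_mem _, zero_mem _, by simpa using hx⟩
    have e : m = (((m.1, 0, 0) : P ⟶ Q) + ((0, m.2.1, 0) : P ⟶ Q)) + ((0, 0, m.2.2) : P ⟶ Q) := ?_
    · rw [e]
      exact add_mem (add_mem (h₁ m.1) (h₂ m.2.1)) (h₃ m.2.2)
    refine hom_ext ?_ ?_ ?_
    · change m.1 = m.1 + 0 + 0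
      simp
    · change m.2.1 = 0 + m.2.1 + 0
      simp
    · change m.2.2 = 0 + 0 + m.2.2
      simp

noncomputable instance : DGCategory k (MapPath F) where
  hom := homDeg
  isInternal := isInternal
  id_mem P := mem_homDeg.2 ⟨DGCat.id_mem P.fst, DGCat.id_mem P.snd, zero_mem _⟩
  comp_mem {P Q R p q m n} hm hn := ⟨comp_mem hm.1 hn.1 rfl, comp_mem hm.2.1 hn.2.1 rfl,
    add_mem (comp_mem (F.map_mem hm.1) hn.2.2 (by omega))
      (comp_mem hm.2.2 (sgn_mem hn.2.1) (by omega))⟩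
  d := diff
  d_mem {P Q p m} hm := ⟨d_mem hm.1 rfl, d_mem hm.2.1 rfl,
    sub_mem (sub_mem (comp_mem P.isHEquiv.mem hm.2.1 (by omega))
      (comp_mem (F.map_mem hm.1) Q.isHEquiv.mem (by omega))) (d_mem hm.2.2 (by omega))⟩
  d_d {P Q} m := hom_ext (d_d _) (d_d _) (by
    change P.eqv ≫ d _ _ m.2.1 - F.functor.map (d _ _ m.1) ≫ Q.eqv -
      d _ _ (P.eqv ≫ m.2.1 - F.functor.map m.1 ≫ Q.eqv - d _ _ m.2.2) = 0
    rw [map_sub, map_sub, d_d, d_comp, d_comp_zero _ Q.isHEquiv.mem, P.isHEquiv.closed,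
      Q.isHEquiv.closed, F.map_d]
    simp)
  d_comp {P Q R q} m {n} hn := by
    have h₁ : ((q.negOnePow • (diff P Q m ≫ n)).1 : P.fst ⟶ R.fst) =
      q.negOnePow • (diff P Q m ≫ n).1 := rfl
    have h₂ : ((q.negOnePow • (diff P Q m ≫ n)).2.1 : P.snd ⟶ R.snd) =
      q.negOnePow • (diff P Q m ≫ n).2.1 := rfl
    have h₃ : ((q.negOnePow • (diff P Q m ≫ n)).2.2 : F.functor.obj P.fst ⟶ R.snd) =
      q.negOnePow • (diff P Q m ≫ n).2.2 := rfl
    refine hom_ext ?_ ?_ ?_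
    · rw [add_fst, h₁, comp_fst, comp_fst, diff_fst, diff_fst, diff_fst, comp_fst,
        DGCategory.d_comp _ hn.1]
    · rw [add_snd, h₂, comp_snd, comp_snd, diff_snd, diff_snd, diff_snd, comp_snd,
        DGCategory.d_comp _ hn.2.1]
    · have e₁ : ∀ {X : D} (x : X ⟶ Q.snd),
          q.negOnePow • (x ≫ sgn _ _ n.2.1) = x ≫ n.2.1 := fun x => by
        rw [sgn_of_mem hn.2.1, comp_units_smul, smul_smul]
        simp
      have e₂ : ∀ {X : D} (x : X ⟶ F.functor.obj Q.fst),
          q.negOnePow • (x ≫ n.2.2) = - (x ≫ sgn _ _ n.2.2) := fun x => by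
        rw [sgn_of_mem hn.2.2, comp_units_smul, Int.negOnePow_sub]
        simp [Units.smul_def]
      rw [add_hty, h₃, diff_hty]
      simp only [comp_fst, comp_snd, comp_hty, diff_fst, diff_snd, diff_hty, map_add]
      rw [smul_add, e₁, e₂, d_comp, d_comp, sgn_d, sgn_sgn, F.functor.map_comp, F.map_d]
      simp only [Preadditive.comp_sub, Preadditive.sub_comp, Preadditive.comp_neg, Category.assoc]
      abel

variable (F)

/-- The mapping path dg category of a dg functor `F`. -/
noncomputable abbrev dgCat : DGCat k := DGCat.mk (MapPath F)

/-- The projection to the source. -/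
noncomputable def fstF : DGFunctor (dgCat F) C where
  functor :=
    { obj P := MapPath.fst P
      map m := Prod.fst m }
  additive := ⟨rfl⟩
  linear := ⟨fun _ _ => rfl⟩
  map_mem h := h.1
  map_d _ := rfl

/-- The projection to the target. -/
noncomputable def sndF : DGFunctor (dgCat F) D where
  functor :=
    { obj P := MapPath.snd P
      map m := (Prod.snd m).1 }
  additive := ⟨rfl⟩
  linear := ⟨fun _ _ => rfl⟩
  map_mem h := h.2.1
  map_d _ := rfl

/-- The dg functor sending `X` to the identity of `F X`. -/
noncomputable def const : DGFunctor C (dgCat F) where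
  functor :=
    { obj X := MapPath.mk X (F.functor.obj X) (𝟙 _) (.id _)
      map m := (m, F.functor.map m, 0)
      map_id X := hom_ext rfl (F.functor.map_id X) rfl
      map_comp m n := hom_ext rfl (F.functor.map_comp m n) (by simp) }
  additive := ⟨hom_ext rfl F.functor.map_add (add_zero _).symm⟩
  linear := ⟨fun f r => hom_ext rfl (F.functor.map_smul r f) (smul_zero _).symm⟩
  map_mem h := mem_homDeg.2 ⟨h, F.map_mem h, zero_mem _⟩
  map_d f := hom_ext rfl (F.map_d f) (by
    change 0 = 𝟙 _ ≫ F.functor.map f - F.functor.map f ≫ 𝟙 _ - d _ _ 0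
    simp)

/-- The path dg category of `D`, whose objects are the homotopy equivalences in `D`. -/
noncomputable abbrev path (D : DGCat k) : DGCat k := dgCat (DGFunctor.id D)

/-- The functor underlying `toPath`. -/
@[simps]
noncomputable def toPathFunctor (V : DGFunctor D D') :
    MapPath F ⥤ MapPath (DGFunctor.id D') where
  obj P := ⟨V.functor.obj (F.functor.obj P.fst), V.functor.obj P.snd, V.functor.map P.eqv,
    V.map_isHEquiv P.isHEquiv⟩
  map m := (V.functor.map (F.functor.map m.1), V.functor.map m.2.1, V.functor.map m.2.2)
  map_id P := hom_ext ((congrArg V.functor.map (F.functor.map_id _)).trans (V.functor.map_id _))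
    (V.functor.map_id _) (V.functor.map_zero _ _)
  map_comp m n := hom_ext
    ((congrArg V.functor.map (F.functor.map_comp _ _)).trans (V.functor.map_comp _ _))
    (V.functor.map_comp _ _) (by
      refine V.functor.map_add.trans ?_
      rw [V.functor.map_comp, V.functor.map_comp, V.map_sgn]
      rfl)

instance (V : DGFunctor D D') : (toPathFunctor F V).Additive :=
  ⟨hom_ext ((congrArg V.functor.map F.functor.map_add).trans V.functor.map_add)
    V.functor.map_add V.functor.map_add⟩

instance (V : DGFunctor D D') : (toPathFunctor F V).Linear k :=
  ⟨fun _ r => hom_ext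
    ((congrArg V.functor.map (F.functor.map_smul r _)).trans (V.functor.map_smul r _))
    (V.functor.map_smul r _) (V.functor.map_smul r _)⟩

lemma toPathFunctor_diff (V : DGFunctor D D') {P Q : MapPath F} (m : P ⟶ Q) :
    (toPathFunctor F V).map (diff P Q m) = diff _ _ ((toPathFunctor F V).map m) := by
  refine hom_ext ?_ ?_ ?_
  · exact (congrArg V.functor.map (F.map_d _)).trans (V.map_d _)
  · exact V.map_d _
  · simp only [toPathFunctor_map, diff_hty, V.functor.map_sub, V.map_d, V.functor.map_comp]
    rfl

/-- The dg functor from the mapping path dg category of `F : C ⟶ D` to the path dg category of `D'`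
induced by `V : D ⟶ D'`. -/
noncomputable def toPath (V : DGFunctor D D') : DGFunctor (dgCat F) (path D') where
  functor := toPathFunctor F V
  additive := inferInstanceAs (toPathFunctor F V).Additive
  linear := inferInstanceAs ((toPathFunctor F V).Linear k)
  map_mem h := mem_homDeg.2 ⟨V.map_mem (F.map_mem h.1), V.map_mem h.2.1, V.map_mem h.2.2⟩
  map_d f := toPathFunctor_diff F V f

variable {F}

lemma heq_hom {P Q P' Q' : MapPath F} {m : P ⟶ Q} {m' : P' ⟶ Q'} (hP : P = P') (hQ : Q = Q')
    (h₁ : HEq m.1 m'.1) (h₂ : HEq m.2.1 m'.2.1) (h₃ : HEq m.2.2 m'.2.2) : HEq m m' := by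
  subst hP hQ
  exact heq_of_eq (hom_ext (eq_of_heq h₁) (eq_of_heq h₂) (eq_of_heq h₃))

/-- Dg functors into a mapping path dg category are equal if their components are. -/
lemma functor_ext {B : DGCat k} {G G' : DGFunctor B (dgCat F)}
    (h₁ : G.comp (fstF F) = G'.comp (fstF F)) (h₂ : G.comp (sndF F) = G'.comp (sndF F))
    (he : ∀ X : B, HEq (MapPath.eqv (G.functor.obj X)) (MapPath.eqv (G'.functor.obj X)))
    (hh : ∀ {X Y : B} (m : X ⟶ Y),
      HEq (Prod.snd (G.functor.map m)).2 (Prod.snd (G'.functor.map m)).2) : G = G' := by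
  have e₁ := congrArg DGFunctor.functor h₁
  have e₂ := congrArg DGFunctor.functor h₂
  have hobj : ∀ X, G.functor.obj X = G'.functor.obj X := fun X => by
    have a₁ : MapPath.fst (G.functor.obj X) = MapPath.fst (G'.functor.obj X) :=
      Functor.congr_obj e₁ X
    have a₂ : MapPath.snd (G.functor.obj X) = MapPath.snd (G'.functor.obj X) :=
      Functor.congr_obj e₂ X
    have a₃ := he X
    revert a₁ a₂ a₃
    generalize G.functor.obj X = P
    generalize G'.functor.obj X = P'
    obtain ⟨x, y, f, hf⟩ := P
    obtain ⟨x', y', f', hf'⟩ := P'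
    intro a₁ a₂ a
    obtain rfl : x = x' := a₁
    obtain rfl : y = y' := a₂
    obtain rfl := eq_of_heq a
    rfl
  refine DGFunctor.ext (Functor.hext hobj fun X Y m => ?_)
  exact heq_hom (hobj X) (hobj Y) (Functor.hcongr_hom e₁ m) (Functor.hcongr_hom e₂ m) (hh m)

end MapPath

end

/-! ### Lifting along semifree extensions -/

section

variable {k : Type u} [CommRing k]

open DGCat

/-- A dg functor with prescribed values on objects. Keeping these fixed definitionally makes it
possible to relate `m` and the value on `m` without transporting along equalities of objects. -/
structure DGFunctorOn {Q T : DGCat k} (o : Q → T) where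
  /-- the values on morphisms -/
  map {X Y : Q} : (X ⟶ Y) → (o X ⟶ o Y)
  map_id (X : Q) : map (𝟙 X) = 𝟙 (o X)
  map_comp {X Y Z : Q} (f : X ⟶ Y) (g : Y ⟶ Z) : map (f ≫ g) = map f ≫ map g
  map_add {X Y : Q} (f g : X ⟶ Y) : map (f + g) = map f + map g
  map_smul {X Y : Q} (r : k) (f : X ⟶ Y) : map (r • f) = r • map f
  map_mem {X Y : Q} {p : ℤ} {f : X ⟶ Y} : f ∈ hom X Y p → map f ∈ hom (o X) (o Y) p
  map_d {X Y : Q} (f : X ⟶ Y) : map (d X Y f) = d (o X) (o Y) (map f)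

/-- The underlying dg functor. -/
def DGFunctorOn.toDGFunctor {Q T : DGCat k} {o : Q → T} (H : DGFunctorOn o) : DGFunctor Q T where
  functor :=
    { obj := o
      map := H.map
      map_id := H.map_id
      map_comp := H.map_comp }
  additive := ⟨H.map_add _ _⟩
  linear := ⟨fun f r => H.map_smul r f⟩
  map_mem := H.map_mem
  map_d := H.map_d

/-- The lifting principle for a semifree extension `i : R ⟶ Q`. The relation `Good m x` between
morphisms of `Q` and of `T` expresses that `x` lies over `m`. If every closed `z` lying over
`d m` is the boundary of some `x` lying over `m`, then every dg functor `G` on `R` lying over `i`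
extends to a dg functor on `Q` lying over the identity. -/
theorem IsSemifreeExtension.exists_lift {R Q T : DGCat k} {i : DGFunctor R Q}
    (hi : IsSemifreeExtension i) (G : DGFunctor R T) (o : Q → T)
    (ho : ∀ X, o (i.functor.obj X) = G.functor.obj X)
    (Good : ∀ {X Y : Q}, (X ⟶ Y) → (o X ⟶ o Y) → Prop)
    (hid : ∀ X, Good (𝟙 X) (𝟙 (o X)))
    (hcomp : ∀ {X Y Z : Q} (m : X ⟶ Y) (n : Y ⟶ Z) (x : o X ⟶ o Y) (y : o Y ⟶ o Z),
      Good m x → Good n y → Good (m ≫ n) (x ≫ y))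
    (hzero : ∀ X Y : Q, Good (0 : X ⟶ Y) 0)
    (hadd : ∀ {X Y : Q} (m n : X ⟶ Y) (x y : o X ⟶ o Y), Good m x → Good n y →
      Good (m + n) (x + y))
    (hsmul : ∀ {X Y : Q} (r : k) (m : X ⟶ Y) (x : o X ⟶ o Y), Good m x → Good (r • m) (r • x))
    (hG : ∀ {X Y : R} (g : X ⟶ Y), Good (i.functor.map g)
      (eqToHom (ho X) ≫ G.functor.map g ≫ eqToHom (ho Y).symm))
    (hlift : ∀ {X Y : Q} (p : ℤ) (m : X ⟶ Y) (z : o X ⟶ o Y), m ∈ hom X Y p →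
      z ∈ hom (o X) (o Y) (p + 1) → d _ _ z = 0 → Good (d X Y m) z →
      ∃ x ∈ hom (o X) (o Y) p, d _ _ x = z ∧ Good m x) :
    ∃ H : DGFunctorOn o, i.comp H.toDGFunctor = G ∧ ∀ {X Y : Q} (m : X ⟶ Y), Good m (H.map m) := by
  classical
  obtain ⟨-, -, ι, _, _, s, t, f, deg, hdeg, hf, hd⟩ := hi
  let Φ : (∀ i, o (s i) ⟶ o (t i)) → (Q ⥤ T) := fun φ => hf.lift G.functor o ho φ
  have hΦadd : ∀ φ, (Φ φ).Additive := fun φ => hf.lift_additive _ _ _ _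
  have hΦlin : ∀ φ, (Φ φ).Linear k := fun φ => hf.lift_linear _ _ _ _
  have hΦG : ∀ φ, i.functor ⋙ Φ φ = G.functor := fun φ => hf.comp_lift _ _ _ _
  have hΦmap : ∀ φ {X Y : R} (g : X ⟶ Y), (Φ φ).map (i.functor.map g) =
    eqToHom (ho X) ≫ G.functor.map g ≫ eqToHom (ho Y).symm :=
      fun φ _ _ g => hf.lift_map_map _ _ _ _ g
  have hΦf : ∀ φ j, (Φ φ).map (f j) = φ j := fun φ j => hf.lift_map_gen _ _ _ _ j
  -- The values on the generators are chosen by well-founded recursion: the generators of index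
  -- at least `i` do not enter `d (f i)`, so they may be sent to `0` when the value on `f i` is
  -- chosen.
  let trunc : ∀ i, (∀ j, j < i → (o (s j) ⟶ o (t j))) → ∀ j, o (s j) ⟶ o (t j) :=
    fun i prev j => if h : j < i then prev j h else 0
  let step : ∀ i, (∀ j, j < i → (o (s j) ⟶ o (t j))) → (o (s i) ⟶ o (t i)) := fun i prev =>
    if h : ∃ x ∈ hom (o (s i)) (o (t i)) (deg i),
      d _ _ x = (Φ (trunc i prev)).map (d _ _ (f i)) ∧ Good (f i) x then h.choose else 0
  have hwf : WellFounded (fun i j : ι => i < j) := IsWellFounded.wf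
  let φ : ∀ i, o (s i) ⟶ o (t i) := hwf.fix step
  have hφ : ∀ i, φ i = step i (fun j _ => φ j) := fun i => hwf.fix_eq step i
  have agree : ∀ (i : ι) {X Y : Q} (m : X ⟶ Y),
      GeneratedBy k (ImageMor (DGFunctor.functor ‹DGFunctor R Q›) ⊔ FamilyBelow f i) m →
      (Φ (trunc i (fun j _ => φ j))).map m = (Φ φ).map m := by
    intro i X Y m hm
    induction hm with
    | of m hm =>
      obtain ⟨⟨c⟩⟩ | ⟨⟨j, hj⟩⟩ := hm
      · rw [hΦmap, hΦmap]
      · rw [hΦf, hΦf]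
        exact dif_pos hj
    | id X => exact ((Φ _).map_id X).trans ((Φ φ).map_id X).symm
    | comp f g _ _ hf hg =>
      exact ((Φ _).map_comp f g).trans
        ((congrArg₂ (fun a b => a ≫ b) hf hg).trans ((Φ _).map_comp f g).symm)
    | zero X Y => exact ((Φ _).map_zero X Y).trans ((Φ φ).map_zero X Y).symm
    | add f g _ _ hf hg =>
      exact (Φ _).map_add.trans ((congrArg₂ (fun a b => a + b) hf hg).trans (Φ _).map_add.symm)
    | smul r f _ hf =>
      exact ((Φ _).map_smul r f).trans
        ((congrArg (fun a => r • a) hf).trans ((Φ _).map_smul r f).symm)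
  have good : ∀ (W : MorphismProperty Q), (∀ {X Y : Q} (m : X ⟶ Y), W m → Good m ((Φ φ).map m)) →
      ∀ {X Y : Q} (m : X ⟶ Y), GeneratedBy k W m → Good m ((Φ φ).map m) := by
    intro W hW X Y m hm
    induction hm with
    | of m hm => exact hW m hm
    | id X => exact ((Φ φ).map_id X).symm ▸ hid X
    | comp f g _ _ hf hg => exact ((Φ φ).map_comp f g).symm ▸ hcomp _ _ _ _ hf hg
    | zero X Y => exact ((Φ φ).map_zero X Y).symm ▸ hzero X Y
    | add f g _ _ hf hg => exact (Φ φ).map_add.symm ▸ hadd _ _ _ _ hf hg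
    | smul r f _ hf => exact ((Φ φ).map_smul r f).symm ▸ hsmul _ _ _ hf
  have hpres : T.preDG.Preserves (i.functor ⋙ Φ φ) := by
    rw [hΦG]
    exact PreDG.preserves_dgFunctor G
  have main : ∀ i, φ i ∈ hom (o (s i)) (o (t i)) (deg i) ∧
      d _ _ (φ i) = (Φ φ).map (d _ _ (f i)) ∧ Good (f i) (φ i) := by
    intro j
    induction j using hwf.induction with
    | _ j ih =>
    have hsup : d _ _ (f j) ∈ ⨆ p, T.preDG.compat (Φ φ) _ _ p := by
      refine PreDG.mem_iSup_compat_of_generatedBy ?_ (hd j)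
      rintro X Y m (⟨⟨c⟩⟩ | ⟨⟨l, hl⟩⟩)
      · exact hpres.map_mem_iSup c
      · refine Submodule.mem_iSup_of_mem (deg l) (PreDG.mem_compat.2 ⟨hdeg l, ?_, ?_⟩)
        · rw [hΦf]
          exact (ih l hl).1
        · rw [hΦf]
          exact (ih l hl).2.1.symm
    have hmem := (PreDG.mem_compat.1 (PreDG.mem_compat_of_mem_iSup hsup (d_mem (hdeg j) rfl))).2.1
    have hcl : d _ _ ((Φ φ).map (d _ _ (f j))) = 0 := by
      refine (PreDG.map_d_of_mem_iSup hsup).symm.trans ?_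
      rw [d_d, (Φ φ).map_zero]
    have hgood : Good (d _ _ (f j)) ((Φ φ).map (d _ _ (f j))) := by
      refine good _ ?_ _ (hd j)
      rintro X Y m (⟨⟨c⟩⟩ | ⟨⟨l, hl⟩⟩)
      · rw [hΦmap]
        exact hG c
      · rw [hΦf]
        exact (ih l hl).2.2
    have hex : ∃ x ∈ hom (o (s j)) (o (t j)) (deg j),
        d _ _ x = (Φ (trunc j (fun l _ => φ l))).map (d _ _ (f j)) ∧ Good (f j) x := by
      rw [agree j _ (hd j)]
      exact hlift (deg j) (f j) _ (hdeg j) hmem hcl hgood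
    have hφj : φ j = hex.choose := (hφ j).trans (dif_pos hex)
    have hspec := hex.choose_spec
    rw [← hφj, agree j _ (hd j)] at hspec
    exact hspec
  have hP : T.preDG.Preserves (Φ φ) := by
    refine PreDG.preserves_of_isFreeExtension hdeg hf hpres (fun j => ?_) (fun j => ?_)
    · rw [hΦf]
      exact (main j).1
    · rw [hΦf]
      exact (main j).2.1.symm
  refine ⟨⟨(Φ φ).map, (Φ φ).map_id, (Φ φ).map_comp, fun _ _ => (Φ φ).map_add,
    fun r f => (Φ φ).map_smul r f, hP.map_mem, hP.map_d⟩, DGFunctor.ext (hΦG φ), fun m => ?_⟩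
  refine good _ ?_ m (hf.generated m)
  rintro X Y m (⟨⟨c⟩⟩ | ⟨⟨l⟩⟩)
  · rw [hΦmap]
    exact hG c
  · rw [hΦf]
    exact (main l).2.2

namespace MapPath

variable {C D : DGCat k} {F : DGFunctor C D}

/-- If `F` is cohomologically fully faithful, then the projection from the mapping path dg category
to `D` has the lifting property with respect to the attachment of a generator. -/
lemma exists_boundary (hF : F.IsQFF) {P Q : MapPath F} {p : ℤ} {m : P.snd ⟶ Q.snd}
    (hm : m ∈ hom P.snd Q.snd p) {z : P ⟶ Q} (hz : z ∈ homDeg P Q (p + 1))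
    (hdz : diff P Q z = 0) (hmz : z.2.1 = d _ _ m) :
    ∃ x ∈ homDeg P Q p, diff P Q x = z ∧ x.2.1 = m := by
  have := hF.full
  have := hF.faithful
  have := Q.isHEquiv.isIso
  have h₁ : d _ _ z.1 = 0 := congrArg Prod.fst hdz
  have h₃ : P.eqv ≫ z.2.1 - F.functor.map z.1 ≫ Q.eqv - d _ _ z.2.2 = 0 :=
    congrArg (fun x => x.2.2) hdz
  rw [hmz] at h₃
  -- The class of `z.1` is mapped to a boundary, so that `z.1` is a boundary `d a₁`.
  obtain ⟨a, ha⟩ : ∃ a, d _ _ a = z.1 := by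
    have e : HoCat.mk' (C := D) (F.functor.map z.1) (F.map_closed h₁) =
        HoCat.mk' (F.functor.map 0) (F.map_closed (map_zero _)) := by
      rw [← cancel_mono (HoCat.mk' Q.eqv Q.isHEquiv.closed), HoCat.mk'_comp, HoCat.mk'_comp]
      refine HoCat.mk'_eq_mk'.2 ⟨P.eqv ≫ m - z.2.2, ?_⟩
      rw [map_sub, d_comp, P.isHEquiv.closed, F.functor.map_zero, ← sub_eq_zero, ← h₃]
      simp only [zero_comp]
      abel
    obtain ⟨a, ha⟩ := HoCat.mk'_eq_mk'.1
      (F.mapHo.map_injective (a₁ := HoCat.mk' z.1 h₁) (a₂ := HoCat.mk' 0 (map_zero _)) e)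
    exact ⟨a, ha.trans (sub_zero _)⟩
  obtain ⟨a₁, ha₁, hda₁⟩ := exists_homogeneous_of_boundary rfl hz.1 ha
  -- The defect `u` is a closed morphism, hence homologous to the image of a closed morphism `c`.
  let u : F.functor.obj P.fst ⟶ Q.snd := P.eqv ≫ m - z.2.2 - F.functor.map a₁ ≫ Q.eqv
  have hu : u ∈ hom (F.functor.obj P.fst) Q.snd p :=
    sub_mem (sub_mem (comp_mem P.isHEquiv.mem hm (by simp)) (by simpa using hz.2.2))
      (comp_mem (F.map_mem ha₁) Q.isHEquiv.mem (by simp))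
  have hdu : d _ _ u = 0 := by
    rw [map_sub, map_sub, d_comp, d_comp_zero _ Q.isHEquiv.mem, ← F.map_d, hda₁,
      P.isHEquiv.closed, Q.isHEquiv.closed, ← h₃]
    simp only [zero_comp, comp_zero]
    abel
  let v : HoCat.mk (F.functor.obj P.fst) ⟶ HoCat.mk (F.functor.obj Q.fst) :=
    HoCat.mk' u hdu ≫ inv (HoCat.mk' Q.eqv Q.isHEquiv.closed)
  obtain ⟨x, hx⟩ := F.mapHo.map_surjective (X := HoCat.mk P.fst) (Y := HoCat.mk Q.fst) v
  obtain ⟨c, hc, rfl⟩ := HoCat.mk'_surjective x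
  have hx' : HoCat.mk' (C := D) (F.functor.map c) (F.map_closed hc) ≫
      HoCat.mk' Q.eqv Q.isHEquiv.closed = HoCat.mk' u hdu := by
    rw [← IsIso.eq_comp_inv]
    exact hx
  rw [HoCat.mk'_comp] at hx'
  obtain ⟨h, hh⟩ := HoCat.mk'_eq_mk'.1 hx'.symm
  have hh' : d _ _ (proj _ _ (p - 1) h) = u - F.functor.map (proj _ _ p c) ≫ Q.eqv := by
    rw [← proj_d (p - 1) p (by simp), hh, map_sub, proj_of_mem hu,
      proj_comp_zero _ _ Q.isHEquiv.mem, F.map_proj]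
  have hc' : d _ _ (proj _ _ p c) = 0 := by rw [← proj_d p (p + 1) rfl, hc, map_zero]
  refine ⟨(a₁ + proj _ _ p c, m, proj _ _ (p - 1) h),
    ⟨add_mem ha₁ (proj_mem _ _), hm, proj_mem _ _⟩, hom_ext ?_ hmz.symm ?_, rfl⟩
  · change d _ _ (a₁ + proj _ _ p c) = z.1
    rw [map_add, hda₁, hc', add_zero]
  · change P.eqv ≫ m - F.functor.map (a₁ + proj _ _ p c) ≫ Q.eqv - d _ _ (proj _ _ (p - 1) h) =
      z.2.2
    rw [hh', F.functor.map_add, Preadditive.add_comp]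
    simp only [u]
    abel

/-- The target of an object of the mapping path dg category may be replaced by an equal one. -/
lemma mk_eqToHom {P : MapPath F} {X : D} (h : P.snd = X) :
    (⟨P.fst, X, P.eqv ≫ eqToHom h, P.isHEquiv.comp (.eqToHom h)⟩ : MapPath F) = P := by
  subst h
  simp

/-- For a quasi-equivalence `F : C ⟶ Q`, dg functors lift along the projection from the mapping
path dg category to `Q`, relative to a semifree extension `i : R ⟶ Q`. -/
theorem exists_lift {R Q C : DGCat k} {F : DGFunctor C Q} (hF : IsQuasiEquivalence F)
    {i : DGFunctor R Q} (hi : IsSemifreeExtension i) (G : DGFunctor R (dgCat F))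
    (hG : G.comp (sndF F) = i) :
    ∃ K : DGFunctor Q (dgCat F), i.comp K = G ∧ K.comp (sndF F) = DGFunctor.id Q := by
  have hG' : G.functor ⋙ (sndF F).functor = i.functor := congrArg DGFunctor.functor hG
  have hobj : ∀ r : R, MapPath.snd (G.functor.obj r) = i.functor.obj r :=
    fun r => Functor.congr_obj hG' r
  -- On objects outside the image of `i`, essential surjectivity of `H^0(F)` provides the value.
  have key : ∀ X : Q, ∃ P : MapPath F, P.snd = X ∧ ∀ r, i.functor.obj r = X →
      P = G.functor.obj r := by
    intro X
    by_cases h : ∃ r, i.functor.obj r = X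
    · obtain ⟨r, rfl⟩ := h
      refine ⟨G.functor.obj r, hobj r, fun r' hr' => ?_⟩
      rw [hi.1 hr']
    · obtain ⟨c, hc⟩ := hF.2 X
      obtain ⟨f, hf⟩ := isoInH0_iff.1 hc
      exact ⟨⟨c, X, f, hf⟩, rfl, fun r hr => (h ⟨r, hr⟩).elim⟩
  choose P hP hPG using key
  -- The chosen objects are modified so as to lie over the objects of `Q` by definition.
  let o : Q → MapPath F := fun X => ⟨(P X).fst, X, (P X).eqv ≫ eqToHom (hP X),
    (P X).isHEquiv.comp (.eqToHom _)⟩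
  have hoP : ∀ X, o X = P X := fun X => mk_eqToHom (hP X)
  obtain ⟨H, hH, hH'⟩ := hi.exists_lift (T := dgCat F) G o
    (fun r => (hoP _).trans (hPG _ r rfl))
    (fun {X Y} m x => (Prod.snd x).1 = m) (fun _ => rfl)
    (fun m n x y hx hy => congrArg₂ (fun a b => a ≫ b) hx hy) (fun _ _ => rfl)
    (fun m n x y hx hy => congrArg₂ (fun a b => a + b) hx hy)
    (fun r m x hx => congrArg (fun a => r • a) hx)
    (fun {X Y} g => by
      change (sndF F).functor.map (_ ≫ G.functor.map g ≫ _) = _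
      rw [Functor.map_comp, Functor.map_comp, eqToHom_map, eqToHom_map]
      have := Functor.congr_hom hG'.symm g
      rw [this]
      rfl)
    (fun p m z hm hz hdz hmz => exists_boundary hF.1 hm hz hdz hmz)
  refine ⟨H.toDGFunctor, hH, DGFunctor.ext ?_⟩
  exact Functor.hext (fun _ => rfl) (fun X Y m => heq_of_eq (hH' m))

end MapPath

end

/-! ### Homotopies and pushouts of weak equivalences -/

lemma InternalGrading.mem_of_proj_mem {k M : Type u} [CommRing k] [AddCommGroup M] [Module k M]
    {A : ℤ → Submodule k M} (h : DirectSum.IsInternal A) (S : Submodule k M) {x : M}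
    (hx : ∀ p, proj h p x ∈ S) : x ∈ S := by
  classical
  have e : x = DirectSum.coeLinearMap A
      ((LinearEquiv.ofBijective (DirectSum.coeLinearMap A) h).symm x) :=
    ((LinearEquiv.ofBijective (DirectSum.coeLinearMap A) h).apply_symm_apply x).symm
  rw [e, DirectSum.coeLinearMap_eq_dfinsuppSum]
  exact Submodule.sum_mem _ fun p _ => hx p

section

variable {k : Type u} [CommRing k]

open DGCat

namespace MapPath

variable {B C D D' E : DGCat k}

/-- The image of a constant homotopy is constant. -/
lemma const_toPath (F : DGFunctor C D) (V : DGFunctor D D') :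
    (const F).comp (toPath F V) = (F.comp V).comp (const (DGFunctor.id D')) :=
  functor_ext rfl rfl (fun X => heq_of_eq (V.functor.map_id (F.functor.obj X)))
    (fun _ => heq_of_eq (V.functor.map_zero _ _))

/-- The isomorphism in the cohomology category given by a homotopy equivalence. -/
noncomputable def hoIso {X Y : D} {f : X ⟶ Y} (hf : IsHEquiv f) : HoCat.mk X ≅ HoCat.mk Y :=
  haveI := hf.isIso
  asIso (HoCat.mk' f hf.closed)

/-- A dg functor to the path dg category is a homotopy; homotopic dg functors induce isomorphic
functors on cohomology. -/
noncomputable def mapHoIso (K : DGFunctor B (path D)) :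
    (K.comp (fstF _)).mapHo ≅ (K.comp (sndF _)).mapHo :=
  NatIso.ofComponents
    (fun X => hoIso (D := D) (MapPath.isHEquiv (K.functor.obj X.of)))
    (fun {X Y} x => by
      obtain ⟨m, hm, rfl⟩ := cls_surjective x
      let P : MapPath (DGFunctor.id D) := K.functor.obj X.of
      let Q : MapPath (DGFunctor.id D) := K.functor.obj Y.of
      let n : P ⟶ Q := K.functor.map m
      let f : P.fst ⟶ P.snd := P.eqv
      let f' : Q.fst ⟶ Q.snd := Q.eqv
      let h : P.fst ⟶ Q.snd := n.2.2
      have hn : diff P Q n = 0 := K.map_closed hm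
      have h' : f ≫ n.2.1 - n.1 ≫ f' - d _ _ h = 0 := congrArg (fun x => x.2.2) hn
      have e₁ := HoCat.mk'_comp (C := D) (f := n.1) (g := f') (congrArg Prod.fst hn)
        Q.isHEquiv.closed
      have e₂ := HoCat.mk'_comp (C := D) (f := f) (g := n.2.1) P.isHEquiv.closed
        (congrArg (fun x => x.2.1) hn)
      refine e₁.trans (Eq.trans ?_ e₂.symm)
      refine HoCat.mk'_eq_mk'.2 ⟨-h, ?_⟩
      rw [map_neg, ← sub_eq_zero, ← h']
      abel)

/-- A dg functor with a two-sided homotopy inverse is a quasi-equivalence. -/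
lemma isQuasiEquivalence_of_homotopy {q : DGFunctor C D} {s : DGFunctor D C}
    (K : DGFunctor C (path C)) (hK : K.comp (fstF _) = q.comp s)
    (hK' : K.comp (sndF _) = DGFunctor.id C)
    (L : DGFunctor D (path D)) (hL : L.comp (fstF _) = s.comp q)
    (hL' : L.comp (sndF _) = DGFunctor.id D) : IsQuasiEquivalence q := by
  have η : q.mapHo ⋙ s.mapHo ≅ 𝟭 _ :=
    (DGFunctor.mapHoComp q s).trans ((eqToIso (congrArg DGFunctor.mapHo hK.symm)).trans
      ((mapHoIso K).trans ((eqToIso (congrArg DGFunctor.mapHo hK')).trans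
        (DGFunctor.mapHoId C).symm)))
  have ε : s.mapHo ⋙ q.mapHo ≅ 𝟭 _ :=
    (DGFunctor.mapHoComp s q).trans ((eqToIso (congrArg DGFunctor.mapHo hL.symm)).trans
      ((mapHoIso L).trans ((eqToIso (congrArg DGFunctor.mapHo hL')).trans
        (DGFunctor.mapHoId D).symm)))
  have : q.mapHo.IsEquivalence :=
    (CategoryTheory.Equivalence.mk q.mapHo s.mapHo η.symm ε).isEquivalence_functor
  refine .of_isEquivalence fun Y => ⟨s.functor.obj Y, isoInH0_iff.2 ?_⟩
  have h₁ : MapPath.fst (L.functor.obj Y) = q.functor.obj (s.functor.obj Y) :=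
    Functor.congr_obj (congrArg DGFunctor.functor hL) Y
  have h₂ : MapPath.snd (L.functor.obj Y) = Y :=
    Functor.congr_obj (congrArg DGFunctor.functor hL') Y
  have := MapPath.isHEquiv (L.functor.obj Y)
  exact ⟨eqToHom h₁.symm ≫ MapPath.eqv (L.functor.obj Y) ≫ eqToHom h₂,
    (IsHEquiv.eqToHom h₁.symm).comp (this.comp (.eqToHom h₂))⟩

/-- A trivial cofibration is a strong deformation retract. -/
lemma exists_deformation {i : DGFunctor C D} (hi : IsSemifreeExtension i)
    (hi' : IsQuasiEquivalence i) : ∃ K : DGFunctor D (dgCat i), i.comp K = const i ∧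
      K.comp (sndF i) = DGFunctor.id D :=
  exists_lift hi' hi (const i) rfl

end MapPath

open MapPath

variable {A B P Y : DGCat k}

/-- Trivial cofibrations are stable under pushout: a deformation of `A` into `B` induces one of the
pushout into `Y`. -/
lemma isQuasiEquivalence_pushout_of_trivialCofibration {i : B ⟶ A} {f : B ⟶ Y} {f' : A ⟶ P}
    {i' : Y ⟶ P} (h : IsPushout i f f' i') (hi : IsSemifreeExtension (C := B) (D := A) i)
    (hi' : IsQuasiEquivalence (C := B) (D := A) i) :
    IsQuasiEquivalence (C := Y) (D := P) i' := by
  obtain ⟨K, hK, hK'⟩ := exists_deformation hi hi'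
  let K' : A ⟶ dgCat i := K
  let fs : dgCat i ⟶ B := fstF i
  let sn : dgCat i ⟶ A := sndF i
  let c : P ⟶ path P := const (DGFunctor.id P)
  let T : dgCat i ⟶ path P := toPath i f'
  let fsP : path P ⟶ P := fstF _
  let snP : path P ⟶ P := sndF _
  have hK₁ : i ≫ K' = (show B ⟶ dgCat i from const i) := hK
  have hK₂ : K' ≫ sn = 𝟙 A := hK'
  have hr : i ≫ K' ≫ fs = 𝟙 B := by
    rw [← Category.assoc, hK₁]
    rfl
  let r : P ⟶ Y := h.desc (K' ≫ fs ≫ f) (𝟙 Y) (by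
    rw [← Category.assoc, ← Category.assoc, Category.assoc i, hr, Category.id_comp,
      Category.comp_id])
  have hr₁ : f' ≫ r = K' ≫ fs ≫ f := h.inl_desc _ _ _
  have hr₂ : i' ≫ r = 𝟙 Y := h.inr_desc _ _ _
  let L : P ⟶ path P := h.desc (K' ≫ T) (i' ≫ c) (by
    rw [← Category.assoc, hK₁, ← Category.assoc, ← h.w]
    exact const_toPath i f')
  have hL₁ : f' ≫ L = K' ≫ T := h.inl_desc _ _ _
  have hL₂ : i' ≫ L = i' ≫ c := h.inr_desc _ _ _
  have e₁ : L ≫ fsP = r ≫ i' := by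
    apply h.hom_ext
    · rw [← Category.assoc, hL₁, ← Category.assoc, hr₁, Category.assoc, Category.assoc,
        Category.assoc, ← h.w]
      rfl
    · rw [← Category.assoc, hL₂, ← Category.assoc, hr₂, Category.id_comp]
      rfl
  have e₂ : L ≫ snP = 𝟙 P := by
    apply h.hom_ext
    · rw [← Category.assoc, hL₁, Category.assoc, show T ≫ snP = sn ≫ f' from rfl,
        ← Category.assoc, hK₂, Category.id_comp, Category.comp_id]
    · rw [← Category.assoc, hL₂]
      rfl
  exact isQuasiEquivalence_of_homotopy (const (DGFunctor.id Y)) hr₂.symm rfl L e₁ e₂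

/-! ### Trivial fibrations -/

/-- A dg functor that is surjective on objects and has the lifting property with respect to the
attachment of a generator. Equivalently, it is surjective on objects and a surjective
quasi-isomorphism on morphism complexes. -/
structure IsTrivialFibration {B Y : DGCat k} (q : DGFunctor B Y) : Prop where
  surjective_obj : ∀ y : Y, ∃ b : B, q.functor.obj b = y
  exists_boundary : ∀ {b b' : B} {p : ℤ} {a : b ⟶ b'}
    {m : q.functor.obj b ⟶ q.functor.obj b'}, a ∈ hom b b' (p + 1) → d _ _ a = 0 →
    m ∈ hom (C := Y) _ _ p → d (C := Y) _ _ m = q.functor.map a →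
    ∃ e ∈ hom b b' p, d _ _ e = a ∧ q.functor.map e = m

namespace IsTrivialFibration

variable {q : DGFunctor B Y}

lemma isQuasiEquivalence (hq : IsTrivialFibration q) : IsQuasiEquivalence q := by
  refine ⟨fun b b' => ⟨?_, ?_⟩, fun y => ?_⟩
  -- The lifting property applies to homogeneous morphisms only, hence to the components.
  · refine (injective_iff_map_eq_zero _).2 fun x hx => ?_
    obtain ⟨a, ha, rfl⟩ := cls_surjective x
    obtain ⟨w, hw⟩ : ∃ w, d (C := Y) _ _ w = q.functor.map a - 0 :=
      cls_eq_cls (C := Y) (f := q.functor.map a) (g := 0) (hf := q.map_closed ha)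
        (hg := map_zero _) |>.1 hx
    rw [sub_zero] at hw
    have : a ∈ LinearMap.range (d b b') := by
      refine InternalGrading.mem_of_proj_mem (DGCategory.isInternal b b') _ fun p => ?_
      obtain ⟨e, -, he, -⟩ := hq.exists_boundary (p := p - 1) (a := proj _ _ p a)
        (m := proj _ _ (p - 1) w) (by simpa using proj_mem p a)
        (by rw [← proj_d p (p + 1) rfl, ha, map_zero]) (proj_mem _ _)
        (by rw [← proj_d (p - 1) p (by simp), hw, q.map_proj])
      exact ⟨e, he⟩
    obtain ⟨e, he⟩ := this
    exact (cls_eq_cls (g := 0) (hg := map_zero _)).2 ⟨e, by rw [he, sub_zero]⟩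
  · intro x
    obtain ⟨m, hm, rfl⟩ := cls_surjective x
    have : m ∈ (LinearMap.ker (d b b')).map (q.functor.mapLinearMap k) := by
      refine InternalGrading.mem_of_proj_mem (DGCategory.isInternal (C := Y) _ _) _ fun p => ?_
      obtain ⟨e, -, he, he'⟩ := hq.exists_boundary (p := p) (a := 0) (m := proj _ _ p m)
        (zero_mem _) (map_zero _) (proj_mem _ _)
        (by rw [← proj_d p (p + 1) rfl, hm, map_zero, q.functor.map_zero])
      exact ⟨e, he, he'⟩
    obtain ⟨c, hc, rfl⟩ := this
    exact ⟨cls c hc, rfl⟩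
  · obtain ⟨b, rfl⟩ := hq.surjective_obj y
    exact ⟨b, isoInH0_iff.2 ⟨𝟙 _, .id _⟩⟩

/-- A trivial fibration over a semifree dg category has a section. -/
lemma exists_section (hq : IsTrivialFibration q) (hY : IsSemifree Y) :
    ∃ s : DGFunctor Y B, s.comp q = DGFunctor.id Y := by
  choose o ho using hq.surjective_obj
  obtain ⟨H, -, hH⟩ := ((isSemifree_iff (DGCat.empty.desc Y)).1 hY).exists_lift
    (DGCat.empty.desc B) o (fun X => (DGCat.empty.elim X).elim)
    (fun {X X'} m x => q.functor.map x = eqToHom (ho X) ≫ m ≫ eqToHom (ho X').symm)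
    (by simp) (fun m n x y hx hy => by simp [hx, hy]) (by simp)
    (fun m n x y hx hy => by simp [hx, hy]) (fun r m x hx => by simp [hx])
    (fun {X} => (DGCat.empty.elim X).elim) (fun {X X'} p m z hm hz hdz hmz => by
      refine (hq.exists_boundary hz hdz
        (m := eqToHom (ho X) ≫ m ≫ eqToHom (ho X').symm) ?_ ?_)
      · refine comp_mem (IsHEquiv.eqToHom _).mem (comp_mem hm (IsHEquiv.eqToHom _).mem rfl) ?_
        simp
      · rw [hmz, d_comp, d_comp, (IsHEquiv.eqToHom _).closed, (IsHEquiv.eqToHom _).closed,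
          sgn_of_mem_zero (IsHEquiv.eqToHom _).mem]
        simp)
  refine ⟨H.toDGFunctor, DGFunctor.ext (CategoryTheory.Functor.ext ho fun X X' m => ?_)⟩
  exact hH m

/-- A section `s` of a trivial fibration `q` satisfies `q ≫ s ≃ 𝟙` by a homotopy over the base. -/
lemma exists_homotopy (hq : IsTrivialFibration q) (hB : IsSemifree B) {s : DGFunctor Y B}
    (hs : s.comp q = DGFunctor.id Y) :
    ∃ H : DGFunctor B (path B), H.comp (fstF _) = q.comp s ∧ H.comp (sndF _) = DGFunctor.id B ∧
      H.comp (toPath _ q) = q.comp (const (DGFunctor.id Y)) := by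
  have hs' : s.functor ⋙ q.functor = 𝟭 Y := congrArg DGFunctor.functor hs
  have hobj : ∀ y, q.functor.obj (s.functor.obj y) = y := fun y => Functor.congr_obj hs' y
  have hmap : ∀ {y y' : Y} (m : y ⟶ y'), q.functor.map (s.functor.map m) =
      eqToHom (hobj y) ≫ m ≫ eqToHom (hobj y').symm := fun m => Functor.congr_hom hs' m
  have key : ∀ b : B, ∃ f : s.functor.obj (q.functor.obj b) ⟶ b, IsHEquiv f ∧
      q.functor.map f = eqToHom (hobj (q.functor.obj b)) := fun b => by
    have he := IsHEquiv.eqToHom (hobj (q.functor.obj b))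
    obtain ⟨f, hf, hdf, hqf⟩ := hq.exists_boundary (p := 0) (a := 0) (zero_mem _) (map_zero _)
      he.mem (he.closed.trans (q.functor.map_zero _ _).symm)
    exact ⟨f, DGFunctor.IsQFF.isHEquiv hq.isQuasiEquivalence.1 hf hdf (hqf ▸ he), hqf⟩
  choose f hf hqf using key
  let o : B → MapPath (DGFunctor.id B) := fun b => ⟨s.functor.obj (q.functor.obj b), b, f b, hf b⟩
  obtain ⟨H, -, hH⟩ := ((isSemifree_iff (DGCat.empty.desc B)).1 hB).exists_lift (T := path B)
    (DGCat.empty.desc _) o (fun X => (DGCat.empty.elim X).elim)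
    (fun m x => Prod.fst x = s.functor.map (q.functor.map m) ∧ (Prod.snd x).1 = m ∧
      q.functor.map (Prod.snd x).2 = 0)
    (fun X => ⟨by simp; rfl, rfl, q.functor.map_zero _ _⟩)
    (fun m n x y hx hy => by
      refine ⟨?_, congrArg₂ (fun a b => a ≫ b) hx.2.1 hy.2.1, ?_⟩
      · rw [q.functor.map_comp, s.functor.map_comp, ← hx.1, ← hy.1]
        rfl
      · refine (congrArg q.functor.map (comp_hty _ _)).trans ?_
        rw [q.functor.map_add, q.functor.map_comp, q.functor.map_comp, hx.2.2, hy.2.2]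
        simp)
    (fun X X' => ⟨by rw [q.functor.map_zero, s.functor.map_zero]; rfl, rfl,
      q.functor.map_zero _ _⟩)
    (fun m n x y hx hy => by
      refine ⟨?_, congrArg₂ (fun a b => a + b) hx.2.1 hy.2.1, ?_⟩
      · rw [q.functor.map_add, s.functor.map_add, ← hx.1, ← hy.1]
        rfl
      · refine (congrArg q.functor.map (add_hty _ _)).trans ?_
        rw [q.functor.map_add, hx.2.2, hy.2.2, add_zero])
    (fun r m x hx => by
      refine ⟨?_, congrArg (fun a => r • a) hx.2.1, ?_⟩
      · rw [q.functor.map_smul, s.functor.map_smul, ← hx.1]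
        rfl
      · refine (congrArg q.functor.map (smul_hty _ _)).trans ?_
        rw [q.functor.map_smul, hx.2.2, smul_zero])
    (fun {X} => (DGCat.empty.elim X).elim) (fun {X X'} p m z hm hz hdz hmz => by
      let z₁ : s.functor.obj (q.functor.obj X) ⟶ s.functor.obj (q.functor.obj X') := Prod.fst z
      let z₂ : X ⟶ X' := (Prod.snd z).1
      let z₃ : s.functor.obj (q.functor.obj X) ⟶ X' := (Prod.snd z).2
      have hz₃ : z₃ ∈ hom _ _ (p + 1 - 1) := hz.2.2
      have hqz : q.functor.map z₃ = 0 := hmz.2.2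
      have h₁ : z₁ = s.functor.map (q.functor.map (d _ _ m)) := hmz.1
      have h₂ : z₂ = d _ _ m := hmz.2.1
      have h₃ : f X ≫ z₂ - z₁ ≫ f X' - d _ _ z₃ = 0 :=
        congrArg (fun x => (Prod.snd x).2) hdz
      -- The homotopy component has to be a primitive of the following closed morphism, which
      -- vanishes in the base.
      let w : s.functor.obj (q.functor.obj X) ⟶ X' :=
        f X ≫ m - s.functor.map (q.functor.map m) ≫ f X' - z₃
      have hsm : s.functor.map (q.functor.map m) ∈ hom _ _ p := s.map_mem (q.map_mem hm)
      have hw : w ∈ hom _ _ (p - 1 + 1) := by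
        rw [sub_add_cancel]
        exact sub_mem (sub_mem (comp_mem (hf X).mem hm (by simp))
          (comp_mem hsm (hf X').mem (by simp))) (by simpa using hz₃)
      have hdw : d _ _ w = 0 := by
        rw [map_sub, map_sub, d_comp, d_comp_zero _ (hf X').mem, (hf X).closed, (hf X').closed,
          ← s.map_d, ← q.map_d, ← h₁, ← h₃, h₂]
        simp
      have hqw : q.functor.map w = 0 := by
        rw [q.functor.map_sub, q.functor.map_sub, hqz, q.functor.map_comp, q.functor.map_comp,
          hqf, hqf, hmap]
        simp
      obtain ⟨h, hh, hdh, hqh⟩ := hq.exists_boundary (m := 0) hw hdw (zero_mem _)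
        ((map_zero _).trans hqw.symm)
      refine ⟨(s.functor.map (q.functor.map m), m, h), ⟨hsm, hm, hh⟩, ?_, rfl, rfl, hqh⟩
      refine MapPath.hom_ext ?_ hmz.2.1.symm ?_
      · exact (s.map_d _).symm.trans ((congrArg s.functor.map (q.map_d m).symm).trans hmz.1.symm)
      · change f X ≫ m - s.functor.map (q.functor.map m) ≫ f X' - d _ _ h = z₃
        rw [hdh]
        simp only [w]
        abel)
  have h₁ : H.toDGFunctor.comp (fstF _) = q.comp s :=
    DGFunctor.ext (Functor.hext (fun _ => rfl) (fun _ _ m => heq_of_eq (hH m).1))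
  have h₂ : H.toDGFunctor.comp (sndF _) = DGFunctor.id B :=
    DGFunctor.ext (Functor.hext (fun _ => rfl) (fun _ _ m => heq_of_eq (hH m).2.1))
  refine ⟨H.toDGFunctor, h₁, h₂, functor_ext ?_ ?_ (fun X => ?_) (fun {X X'} m => ?_)⟩
  · change (H.toDGFunctor.comp (fstF _)).comp q = q
    rw [h₁]
    exact congrArg q.comp hs
  · change (H.toDGFunctor.comp (sndF _)).comp q = q
    rw [h₂]
    rfl
  · change HEq (q.functor.map (f X)) (𝟙 (q.functor.obj X))
    rw [hqf]
    exact eqToHom_heq_id_cod _ _ _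
  · change HEq (q.functor.map (Prod.snd (H.map m)).2)
      (0 : q.functor.obj X ⟶ q.functor.obj X')
    rw [(hH m).2.2]
    change HEq (0 : q.functor.obj (s.functor.obj (q.functor.obj X)) ⟶ q.functor.obj X') _
    rw [hobj]

/-- The pushout of a trivial fibration between semifree dg categories along a cofibration is a
quasi-equivalence. The homotopy from `q ≫ s` to the identity of `B` extends along the cofibration to
a homotopy on `A` ending at the identity. It starts at a dg functor that descends to the pushout and
is homotopy inverse to `q'`, where the second homotopy is glued from the first one and a constant
one on `Y`. -/
lemma isQuasiEquivalence_pushout {q : B ⟶ Y} (hq : IsTrivialFibration (B := B) (Y := Y) q)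
    (hB : IsSemifree B) (hY : IsSemifree Y) {i : B ⟶ A} {q' : A ⟶ P} {i' : Y ⟶ P}
    (h : IsPushout i q q' i') (hi : IsSemifreeExtension (C := B) (D := A) i) :
    IsQuasiEquivalence (C := A) (D := P) q' := by
  obtain ⟨s₀, hs₀⟩ := hq.exists_section hY
  obtain ⟨H₀, hH₁, hH₂, hH₃⟩ := hq.exists_homotopy hB hs₀
  obtain ⟨K₀, hK₁, hK₂⟩ := MapPath.exists_lift (IsQuasiEquivalence.id A) hi
    (H₀.comp (toPath _ i)) (congrArg (fun V => DGFunctor.comp V i) hH₂)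
  let s : Y ⟶ B := s₀
  let H : B ⟶ path B := H₀
  let K : A ⟶ path A := K₀
  let fsA : path A ⟶ A := fstF _
  let snA : path A ⟶ A := sndF _
  let fsP : path P ⟶ P := fstF _
  let snP : path P ⟶ P := sndF _
  let c : P ⟶ path P := const (DGFunctor.id P)
  let T : path A ⟶ path P := toPath _ q'
  let Ti : path B ⟶ path A := toPath _ i
  have hs : s ≫ q = 𝟙 Y := hs₀
  have hK₁' : i ≫ K = H ≫ Ti := hK₁
  have hu : i ≫ K ≫ fsA = q ≫ s ≫ i := by
    rw [← Category.assoc, hK₁']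
    exact congrArg (fun V => DGFunctor.comp V i) hH₁
  let s' : P ⟶ A := h.desc (K ≫ fsA) (s ≫ i) hu
  have hs₁ : q' ≫ s' = K ≫ fsA := h.inl_desc _ _ _
  have hs₂ : i' ≫ s' = s ≫ i := h.inr_desc _ _ _
  let L : P ⟶ path P := h.desc (K ≫ T) (i' ≫ c) (by
    have e₁ : Ti ≫ T = (show path B ⟶ path P from toPath _ (i ≫ q')) := rfl
    have e₂ : (show path B ⟶ path P from toPath _ (q ≫ i')) =
      (show path B ⟶ path Y from toPath _ q) ≫ (show path Y ⟶ path P from toPath _ i') := rfl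
    rw [← Category.assoc, hK₁', Category.assoc, e₁, h.w, e₂, ← Category.assoc]
    refine (congrArg (fun V => V ≫ (show path Y ⟶ path P from toPath _ i')) hH₃).trans ?_
    exact congrArg (fun V => q ≫ V) (const_toPath (DGFunctor.id Y) i'))
  have hL₁ : q' ≫ L = K ≫ T := h.inl_desc _ _ _
  have hL₂ : i' ≫ L = i' ≫ c := h.inr_desc _ _ _
  have e₁ : L ≫ fsP = s' ≫ q' := by
    apply h.hom_ext
    · rw [← Category.assoc, hL₁, ← Category.assoc, hs₁]
      rfl
    · rw [← Category.assoc, hL₂, ← Category.assoc, hs₂, Category.assoc s i q', h.w,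
        ← Category.assoc, hs, Category.id_comp]
      rfl
  have e₂ : L ≫ snP = 𝟙 P := by
    apply h.hom_ext
    · rw [← Category.assoc, hL₁, Category.assoc, show T ≫ snP = snA ≫ q' from rfl,
        ← Category.assoc, show K ≫ snA = 𝟙 A from hK₂, Category.id_comp, Category.comp_id]
    · rw [← Category.assoc, hL₂]
      rfl
  exact isQuasiEquivalence_of_homotopy K hs₁.symm hK₂ L e₁ e₂

end IsTrivialFibration

end

/-! ### Free linear categories -/

/-- The paths of a quiver with vertices `V` and edges `ι`. -/
inductive FPath {V ι : Type u} (s t : ι → V) (X : V) : V → Type u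
  | nil : FPath s t X X
  | cons (i : ι) (p : FPath s t X (s i)) : FPath s t X (t i)

namespace FPath

variable {V ι : Type u} {s t : ι → V}

/-- Concatenation of paths. -/
def comp {X Y : V} (p : FPath s t X Y) : ∀ {Z : V}, FPath s t Y Z → FPath s t X Z
  | _, nil => p
  | _, cons i q => cons i (p.comp q)

lemma nil_comp {X Y : V} (p : FPath s t X Y) : (nil : FPath s t X X).comp p = p := by
  induction p with
  | nil => rfl
  | cons i p ih => rw [comp, ih]

lemma comp_assoc {W X Y Z : V} (p : FPath s t W X) (q : FPath s t X Y) (r : FPath s t Y Z) :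
    (p.comp q).comp r = p.comp (q.comp r) := by
  induction r with
  | nil => rfl
  | cons i r ih => rw [comp, comp, comp, ih]

/-- The degree of a path. -/
def degree (deg : ι → ℤ) {X : V} : ∀ {Y : V}, FPath s t X Y → ℤ
  | _, nil => 0
  | _, cons i p => p.degree deg + deg i

end FPath

/-- The free `k`-linear category on a quiver. -/
structure FreeCat (k : Type u) [CommRing k] {V ι : Type u} (s t : ι → V) : Type u where
  /-- the underlying vertex -/
  of : V

namespace FreeCat

variable {k : Type u} [CommRing k] {V ι : Type u} {s t : ι → V}

/-- Bilinear extension of the concatenation of paths. -/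
noncomputable def compL (X Y Z : V) : (FPath s t X Y →₀ k) →ₗ[k] (FPath s t Y Z →₀ k) →ₗ[k]
    (FPath s t X Z →₀ k) :=
  Finsupp.linearCombination k (fun p => Finsupp.lmapDomain k k p.comp)

lemma compL_single {X Y Z : V} (p : FPath s t X Y) (q : FPath s t Y Z) (a b : k) :
    compL X Y Z (Finsupp.single p a) (Finsupp.single q b) = Finsupp.single (p.comp q) (a * b) := by
  simp [compL, Finsupp.linearCombination_single, Finsupp.mapDomain_single]

noncomputable instance : Category (FreeCat k s t) where
  Hom X Y := FPath s t X.of Y.of →₀ k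
  id X := Finsupp.single .nil 1
  comp f g := compL _ _ _ f g
  id_comp f := by
    induction f using Finsupp.induction_linear with
    | zero => exact map_zero _
    | add f g hf hg => rw [map_add, hf, hg]
    | single p a => rw [compL_single, FPath.nil_comp, one_mul]
  comp_id f := by
    induction f using Finsupp.induction_linear with
    | zero => rw [map_zero, LinearMap.zero_apply]
    | add f g hf hg => rw [map_add, LinearMap.add_apply, hf, hg]
    | single p a => rw [compL_single, FPath.comp, mul_one]
  assoc f g h := by
    induction f using Finsupp.induction_linear with
    | zero => simp only [map_zero, LinearMap.zero_apply]
    | add f f' hf hf' => simp only [map_add, LinearMap.add_apply, hf, hf']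
    | single p a =>
      induction g using Finsupp.induction_linear with
      | zero => simp only [map_zero, LinearMap.zero_apply]
      | add f f' hf hf' => simp only [map_add, LinearMap.add_apply, hf, hf']
      | single q b =>
        induction h using Finsupp.induction_linear with
        | zero => simp only [map_zero]
        | add f f' hf hf' => simp only [map_add, hf, hf']
        | single r c => simp only [compL_single, FPath.comp_assoc, mul_assoc]

noncomputable instance : Preadditive (FreeCat k s t) where
  homGroup X Y := inferInstanceAs (AddCommGroup (FPath s t X.of Y.of →₀ k))
  add_comp X Y Z f f' g := LinearMap.map_add₂ (compL X.of Y.of Z.of) f f' g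
  comp_add X Y Z f g g' := LinearMap.map_add (compL X.of Y.of Z.of f) g g'

noncomputable instance : Linear k (FreeCat k s t) where
  homModule X Y := inferInstanceAs (Module k (FPath s t X.of Y.of →₀ k))
  smul_comp X Y Z r f g := LinearMap.map_smul₂ (compL X.of Y.of Z.of) r f g
  comp_smul X Y Z f r g := LinearMap.map_smul (compL X.of Y.of Z.of f) r g

/-- The morphism given by a path. -/
noncomputable def word {X Y : FreeCat k s t} (p : FPath s t X.of Y.of) : X ⟶ Y :=
  Finsupp.single p (1 : k)

variable (k s t) in
/-- The generating morphisms. -/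
noncomputable def gen (i : ι) : (⟨s i⟩ : FreeCat k s t) ⟶ ⟨t i⟩ :=
  word (.cons i .nil)

lemma word_cons {X : FreeCat k s t} (i : ι) (p : FPath s t X.of (s i)) :
    word (X := X) (Y := ⟨t i⟩) (.cons i p) = word (Y := ⟨s i⟩) p ≫ gen k s t i := by
  refine ((compL_single _ _ _ _).trans ?_).symm
  rw [mul_one]
  rfl

/-- Linear extension of a function on paths. -/
noncomputable def extend {M : Type u} [AddCommGroup M] [Module k M] {X Y : FreeCat k s t}
    (h : FPath s t X.of Y.of → M) : (X ⟶ Y) →ₗ[k] M :=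
  Finsupp.linearCombination k h

lemma extend_word {M : Type u} [AddCommGroup M] [Module k M] {X Y : FreeCat k s t}
    (h : FPath s t X.of Y.of → M) (p : FPath s t X.of Y.of) : extend h (word p) = h p :=
  (Finsupp.linearCombination_single k 1 p).trans (one_smul k _)

lemma span_word (X Y : FreeCat k s t) :
    Submodule.span k (Set.range (word (X := X) (Y := Y))) = ⊤ := by
  refine eq_top_iff.2 fun f _ => ?_
  induction f using Finsupp.induction_linear with
  | zero => exact zero_mem _
  | add f g hf hg => exact add_mem (hf trivial) (hg trivial)
  | single p a =>
    have : (Finsupp.single p a : FPath s t X.of Y.of →₀ k) = a • Finsupp.single p 1 := by simp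
    rw [this]
    exact Submodule.smul_mem _ _ (Submodule.subset_span ⟨p, rfl⟩)

/-- Linear maps on morphisms agree if they agree on paths. -/
lemma linear_ext {M : Type u} [AddCommGroup M] [Module k M] {X Y : FreeCat k s t}
    {a b : (X ⟶ Y) →ₗ[k] M} (h : ∀ p, a (word p) = b (word p)) : a = b :=
  LinearMap.ext_on_range (span_word X Y) h

section Lift

variable {E : Type u} [Category.{u} E] (o : V → E) (φ : ∀ i, o (s i) ⟶ o (t i))

/-- The composite of the values on the edges of a path. -/
def pathMap {X : V} : ∀ {Y : V}, FPath s t X Y → (o X ⟶ o Y)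
  | _, .nil => 𝟙 _
  | _, .cons i p => pathMap p ≫ φ i

lemma pathMap_comp {X Y Z : V} (p : FPath s t X Y) (q : FPath s t Y Z) :
    pathMap o φ (p.comp q) = pathMap o φ p ≫ pathMap o φ q := by
  induction q with
  | nil => simp [FPath.comp, pathMap]
  | cons i q ih => simp [FPath.comp, pathMap, ih]

lemma word_comp {X Y Z : FreeCat k s t} (p : FPath s t X.of Y.of) (q : FPath s t Y.of Z.of) :
    word p ≫ word q = word (Y := Z) (p.comp q) :=
  (compL_single _ _ _ _).trans (by rw [mul_one]; rfl)

variable [Preadditive E] [Linear k E]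

/-- The `k`-linear functor out of a free `k`-linear category with prescribed values. -/
noncomputable def lift : FreeCat k s t ⥤ E where
  obj X := o X.of
  map {X Y} := extend (pathMap o φ)
  map_id X := extend_word _ _
  map_comp {X Y Z} f g := by
    have : extend (pathMap o φ) ∘ₗ Linear.leftComp k Z f =
        Linear.leftComp k _ (extend (pathMap o φ) f) ∘ₗ extend (pathMap o φ) := by
      refine linear_ext fun q => ?_
      have : extend (pathMap o φ) ∘ₗ Linear.rightComp k X (word q) =
          Linear.rightComp k _ (pathMap o φ q) ∘ₗ extend (pathMap o φ) := by
        refine linear_ext fun p => ?_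
        simp [word_comp, extend_word, pathMap_comp]
      have := LinearMap.congr_fun this f
      simpa [extend_word] using this
    simpa using LinearMap.congr_fun this g

instance : (lift (k := k) o φ).Additive := ⟨map_add _ _ _⟩

instance : (lift (k := k) o φ).Linear k := ⟨fun f r => map_smul _ r f⟩

lemma lift_gen (i : ι) : (lift (k := k) o φ).map (gen k s t i) = φ i := by
  have h : pathMap o φ (.cons i .nil) = φ i := Category.id_comp (φ i)
  exact (extend_word (Y := ⟨t i⟩) (pathMap o φ) _).trans h

end Lift

/-- Two `k`-linear functors out of a free `k`-linear category agree if they agree on objects and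
generators. -/
lemma functor_ext {E : Type u} [Category.{u} E] [Preadditive E] [Linear k E]
    {H H' : FreeCat k s t ⥤ E} [H.Additive] [H.Linear k] [H'.Additive] [H'.Linear k]
    (hobj : ∀ X, H.obj X = H'.obj X)
    (hgen : ∀ i, HEq (H.map (gen k s t i)) (H'.map (gen k s t i))) : H = H' := by
  refine CategoryTheory.Functor.ext hobj fun X Y f => ?_
  have key : ∀ {Y : V} (p : FPath s t X.of Y), H.map (word (Y := ⟨Y⟩) p) =
      eqToHom (hobj X) ≫ H'.map (word (Y := ⟨Y⟩) p) ≫ eqToHom (hobj ⟨Y⟩).symm := by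
    intro Y p
    induction p with
    | nil =>
      change H.map (𝟙 X) = eqToHom _ ≫ H'.map (𝟙 X) ≫ eqToHom _
      simp
    | cons i p ih =>
      rw [word_cons, H.map_comp, H'.map_comp, ih,
        (conj_eqToHom_iff_heq _ _ (hobj _) (hobj _)).2 (hgen i)]
      simp
  have : H.mapLinearMap k (X := X) (Y := Y) =
      Linear.leftComp k _ (eqToHom (hobj X)) ∘ₗ
        Linear.rightComp k _ (eqToHom (hobj Y).symm) ∘ₗ H'.mapLinearMap k := by
    refine linear_ext fun p => ?_
    simpa using key p
  simpa using LinearMap.congr_fun this f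

/-! ### Gradings and derivations on free linear categories -/

variable (deg : ι → ℤ)

/-- The morphisms of a given degree, spanned by the paths of that degree. -/
noncomputable def homDeg (X Y : FreeCat k s t) (p : ℤ) : Submodule k (X ⟶ Y) :=
  Submodule.span k {f | ∃ w : FPath s t X.of Y.of, w.degree deg = p ∧ word w = f}

lemma word_mem {X Y : FreeCat k s t} (w : FPath s t X.of Y.of) :
    word w ∈ homDeg deg X Y (w.degree deg) :=
  Submodule.subset_span ⟨w, rfl, rfl⟩

lemma gen_mem (i : ι) : gen k s t i ∈ homDeg deg _ _ (deg i) := by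
  have := word_mem (k := k) (X := ⟨s i⟩) (Y := ⟨t i⟩) deg (.cons i .nil)
  rwa [FPath.degree, FPath.degree, zero_add] at this

lemma id_mem (X : FreeCat k s t) : 𝟙 X ∈ homDeg deg X X 0 := word_mem (Y := X) deg .nil

lemma degree_comp {X Y Z : V} (p : FPath s t X Y) (q : FPath s t Y Z) :
    (p.comp q).degree deg = p.degree deg + q.degree deg := by
  induction q with
  | nil => simp [FPath.comp, FPath.degree]
  | cons i q ih => simp [FPath.comp, FPath.degree, ih, add_assoc]

lemma comp_mem {X Y Z : FreeCat k s t} {p q : ℤ} {f : X ⟶ Y} {g : Y ⟶ Z}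
    (hf : f ∈ homDeg deg X Y p) (hg : g ∈ homDeg deg Y Z q) : f ≫ g ∈ homDeg deg X Z (p + q) := by
  have : homDeg deg X Y p ≤ (homDeg deg X Z (p + q)).comap (Linear.rightComp k X g) := by
    refine Submodule.span_le.2 ?_
    rintro _ ⟨v, rfl, rfl⟩
    have : homDeg deg Y Z q ≤
        (homDeg deg X Z (v.degree deg + q)).comap (Linear.leftComp k Z (word v)) := by
      refine Submodule.span_le.2 ?_
      rintro _ ⟨w, rfl, rfl⟩
      change word v ≫ word w ∈ homDeg deg X Z _
      rw [word_comp, ← degree_comp]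
      exact word_mem deg _
    exact this hg
  exact this hf

lemma isInternal (X Y : FreeCat k s t) : DirectSum.IsInternal (homDeg deg X Y) := by
  classical
  refine InternalGrading.isInternal_of_proj
    (fun p => extend (fun w => if w.degree deg = p then word w else 0)) ?_ ?_ ?_
  · intro p
    have : homDeg deg X Y p ≤ LinearMap.eqLocus
        (extend (fun w => if w.degree deg = p then word w else 0)) LinearMap.id := by
      refine Submodule.span_le.2 ?_
      rintro _ ⟨w, rfl, rfl⟩
      exact (extend_word _ _).trans (if_pos rfl)
    exact fun x hx => this hx
  · intro p q hpq
    have : homDeg deg X Y p ≤ LinearMap.ker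
        (extend (fun w => if w.degree deg = q then word w else 0)) := by
      refine Submodule.span_le.2 ?_
      rintro _ ⟨w, rfl, rfl⟩
      exact (extend_word _ _).trans (if_neg hpq)
    exact fun x hx => this hx
  · rw [eq_top_iff, ← span_word]
    refine Submodule.span_le.2 ?_
    rintro _ ⟨w, rfl⟩
    exact Submodule.mem_iSup_of_mem _ (word_mem deg w)

variable (dgen : ∀ i, (⟨s i⟩ : FreeCat k s t) ⟶ ⟨t i⟩)

/-- The values of a derivation on paths, given its values on edges. -/
noncomputable def dPath (X : FreeCat k s t) : ∀ {Y : V}, FPath s t X.of Y → (X ⟶ ⟨Y⟩)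
  | _, .nil => 0
  | _, .cons i p => word (Y := ⟨s i⟩) p ≫ dgen i + (deg i).negOnePow • (dPath X p ≫ gen k s t i)

/-- The derivation with prescribed values on the generators. -/
noncomputable def der (X Y : FreeCat k s t) : (X ⟶ Y) →ₗ[k] (X ⟶ Y) :=
  extend (dPath deg dgen X)

lemma der_id (X : FreeCat k s t) : der deg dgen X X (𝟙 X) = 0 := extend_word _ _

lemma der_comp_gen {X : FreeCat k s t} (i : ι) (f : X ⟶ ⟨s i⟩) :
    der deg dgen _ _ (f ≫ gen k s t i) =
      f ≫ dgen i + (deg i).negOnePow • (der deg dgen _ _ f ≫ gen k s t i) := by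
  have : der deg dgen _ _ ∘ₗ Linear.rightComp k X (gen k s t i) =
      Linear.rightComp k X (dgen i) + ((deg i).negOnePow : ℤ) •
        (Linear.rightComp k X (gen k s t i) ∘ₗ der deg dgen _ _) := by
    refine linear_ext fun p => ?_
    change der deg dgen _ _ (word p ≫ gen k s t i) = word p ≫ dgen i + ((deg i).negOnePow : ℤ) •
      (der deg dgen _ _ (word p) ≫ gen k s t i)
    rw [← word_cons]
    refine (extend_word _ _).trans ?_
    rw [dPath, der, extend_word]
    rfl
  exact LinearMap.congr_fun this f

lemma der_gen (i : ι) : der deg dgen _ _ (gen k s t i) = dgen i := by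
  have := der_comp_gen deg dgen i (𝟙 _)
  simpa [der_id] using this

lemma der_comp_word {X Y : FreeCat k s t} (f : X ⟶ Y) {Z : V} (w : FPath s t Y.of Z) :
    der deg dgen _ _ (f ≫ word (Y := ⟨Z⟩) w) = f ≫ der deg dgen _ _ (word (Y := ⟨Z⟩) w) +
      (w.degree deg).negOnePow • (der deg dgen _ _ f ≫ word (Y := ⟨Z⟩) w) := by
  induction w with
  | nil =>
    change der deg dgen X Y (f ≫ 𝟙 Y) = f ≫ der deg dgen Y Y (𝟙 Y) +
      (0 : ℤ).negOnePow • (der deg dgen X Y f ≫ 𝟙 Y)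
    rw [der_id]
    simp
  | cons i w ih =>
    rw [word_cons, der_comp_gen, ← Category.assoc, der_comp_gen, ih]
    simp only [Units.smul_def, FPath.degree, Int.negOnePow_add, Preadditive.comp_add,
      Preadditive.add_comp, Preadditive.comp_zsmul, Preadditive.zsmul_comp, smul_add, smul_smul,
      Category.assoc, Units.val_mul, mul_comm, add_assoc]

/-- The grading and derivation on a free `k`-linear category given by the degrees of the generators
and the values on the generators. -/
@[simps]
noncomputable def preDG : PreDG k (FreeCat k s t) where
  hom := homDeg deg
  d := der deg dgen
  id_mem := id_mem deg
  comp_mem := comp_mem deg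
  d_comp {X Y Z q} f g hg := by
    have : homDeg deg Y Z q ≤ LinearMap.eqLocus (der deg dgen X Z ∘ₗ Linear.leftComp k Z f)
        (Linear.leftComp k Z f ∘ₗ der deg dgen Y Z +
          (q.negOnePow : ℤ) • Linear.leftComp k Z (der deg dgen X Y f)) := by
      refine Submodule.span_le.2 ?_
      rintro _ ⟨w, rfl, rfl⟩
      exact der_comp_word deg dgen f w
    exact this hg

variable {deg dgen}

lemma der_mem (hdeg : ∀ i, dgen i ∈ homDeg deg _ _ (deg i + 1)) {X Y : FreeCat k s t} {p : ℤ}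
    {f : X ⟶ Y} (hf : f ∈ homDeg deg X Y p) : der deg dgen X Y f ∈ homDeg deg X Y (p + 1) := by
  have key : ∀ {Y : V} (w : FPath s t X.of Y),
      der deg dgen X ⟨Y⟩ (word w) ∈ homDeg deg X ⟨Y⟩ (w.degree deg + 1) := by
    intro Y w
    induction w with
    | nil =>
      change der deg dgen X X (𝟙 X) ∈ homDeg deg X X _
      rw [der_id]
      exact zero_mem _
    | cons i w ih =>
      rw [word_cons, der_comp_gen, FPath.degree]
      refine add_mem ?_ (Submodule.smul_of_tower_mem _ _ ?_)
      · have := comp_mem deg (word_mem (Y := ⟨s i⟩) deg w) (hdeg i)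
        rwa [← add_assoc] at this
      · have := comp_mem deg ih (gen_mem deg i)
        rwa [add_right_comm] at this
  have : homDeg deg X Y p ≤ (homDeg deg X Y (p + 1)).comap (der deg dgen X Y) := by
    refine Submodule.span_le.2 ?_
    rintro _ ⟨w, rfl, rfl⟩
    exact key w
  exact this hf

lemma der_der (hdeg : ∀ i, dgen i ∈ homDeg deg _ _ (deg i + 1))
    (hdd : ∀ i, der deg dgen _ _ (dgen i) = 0) {X Y : FreeCat k s t} (f : X ⟶ Y) :
    der deg dgen X Y (der deg dgen X Y f) = 0 := by
  have key : ∀ {Y : V} (w : FPath s t X.of Y),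
      der deg dgen X ⟨Y⟩ (der deg dgen X ⟨Y⟩ (word w)) = 0 := by
    intro Y w
    induction w with
    | nil =>
      change der deg dgen X X (der deg dgen X X (𝟙 X)) = 0
      rw [der_id, map_zero]
    | cons i w ih =>
      have h₁ := (preDG deg dgen).d_comp (word (X := X) (Y := ⟨s i⟩) w) (hdeg i)
      simp only [preDG_d] at h₁
      rw [word_cons, der_comp_gen, map_add, h₁, Units.smul_def (deg i).negOnePow, map_zsmul,
        der_comp_gen, ih, hdd, Int.negOnePow_succ]
      simp [Units.smul_def]
  have : der deg dgen X Y ∘ₗ der deg dgen X Y = 0 := linear_ext key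
  exact LinearMap.congr_fun this f

end FreeCat

/-! ### Free extensions of semifree dg categories -/

section

variable {k : Type u} [CommRing k]

/-- A family of homogeneous morphisms that freely generates a dg category as a `k`-linear
category. -/
structure FreeBasis (Y : DGCat k) where
  /-- the index type of the generators -/
  ι : Type u
  /-- the source of a generator -/
  s : ι → Y
  /-- the target of a generator -/
  t : ι → Y
  /-- the generators -/
  gen (j : ι) : s j ⟶ t j
  /-- the degree of a generator -/
  deg : ι → ℤ
  gen_mem (j : ι) : gen j ∈ DGCat.hom (s j) (t j) (deg j)
  free : IsFreeExtension k (DGCat.empty.desc Y).functor gen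

lemma IsSemifree.nonempty_freeBasis {Y : DGCat k} (hY : IsSemifree Y) : Nonempty (FreeBasis Y) := by
  obtain ⟨ι, _, _, s, t, f, deg, hdeg, hf, -⟩ := hY
  exact ⟨⟨ι, s, t, f, deg, hdeg, (isFreelyGenerated_iff _ f).1 hf⟩⟩

namespace FreeBasis

variable {Y : DGCat k} (b : FreeBasis Y) {N ι : Type u} (s t : ι → Y ⊕ N)

/-- The free extension of a freely generated `k`-linear category by new objects `N` and new
morphisms with sources `s` and targets `t`. -/
abbrev Ext : Type u :=
  FreeCat k (Sum.elim (fun j => Sum.inl (b.s j)) s) (Sum.elim (fun j => Sum.inl (b.t j)) t)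

/-- The new generators. -/
noncomputable def newGen (i : ι) : (⟨s i⟩ : b.Ext s t) ⟶ ⟨t i⟩ :=
  FreeCat.gen k (Sum.elim (fun j => Sum.inl (b.s j)) s) (Sum.elim (fun j => Sum.inl (b.t j)) t)
    (Sum.inr i)

/-- The generators of the base, in the extension. -/
noncomputable def oldGen (j : b.ι) : (⟨.inl (b.s j)⟩ : b.Ext s t) ⟶ ⟨.inl (b.t j)⟩ :=
  FreeCat.gen k (Sum.elim (fun j => Sum.inl (b.s j)) s) (Sum.elim (fun j => Sum.inl (b.t j)) t)
    (Sum.inl j)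

/-- The inclusion of the base into the extension. -/
noncomputable def incl : Y ⥤ b.Ext s t :=
  b.free.lift (DGCat.empty.functorTo (b.Ext s t)) (fun y => ⟨.inl y⟩)
    (fun X => (DGCat.empty.elim X).elim) (b.oldGen s t)

instance : (b.incl s t).Additive := b.free.lift_additive _ _ _ _

instance : (b.incl s t).Linear k := b.free.lift_linear _ _ _ _

lemma incl_gen (j : b.ι) : (b.incl s t).map (b.gen j) = b.oldGen s t j :=
  b.free.lift_map_gen _ _ _ _ j

lemma incl_injective : Function.Injective (b.incl s t).obj := fun _ _ h =>
  Sum.inl_injective (congrArg FreeCat.of h)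

lemma ext_functor_ext {E : Type u} [Category.{u} E] [Preadditive E] [Linear k E]
    {H H' : b.Ext s t ⥤ E} [H.Additive] [H.Linear k] [H'.Additive] [H'.Linear k]
    (hobj : ∀ X, H.obj X = H'.obj X)
    (hold : ∀ j, HEq (H.map (b.oldGen s t j)) (H'.map (b.oldGen s t j)))
    (hnew : ∀ i, HEq (H.map (b.newGen s t i)) (H'.map (b.newGen s t i))) : H = H' := by
  refine FreeCat.functor_ext hobj ?_
  rintro (j | i)
  · exact hold j
  · exact hnew i

/-- The inclusion of the base is a free extension: a functor out of the extension is determined by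
its values on the old and the new generators, and the former are prescribed on the base. -/
lemma isFreeExtension : IsFreeExtension k (b.incl s t) (b.newGen s t) := by
  intro E _ _ _ G _ _ o ho φ
  let Φ : ∀ j : b.ι ⊕ ι, o ⟨Sum.elim (fun j => Sum.inl (b.s j)) s j⟩ ⟶
      o ⟨Sum.elim (fun j => Sum.inl (b.t j)) t j⟩ := fun j => match j with
    | .inl j => eqToHom (ho _) ≫ G.map (b.gen j) ≫ eqToHom (ho _).symm
    | .inr i => φ i
  let H : b.Ext s t ⥤ E := FreeCat.lift (fun v => o ⟨v⟩) Φ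
  have : H.Additive := inferInstanceAs (FreeCat.lift _ _).Additive
  have : H.Linear k := inferInstanceAs ((FreeCat.lift _ _).Linear k)
  have hold : ∀ j, H.map (b.oldGen s t j) =
      eqToHom (ho _) ≫ G.map (b.gen j) ≫ eqToHom (ho _).symm := fun j =>
    FreeCat.lift_gen (fun v => o ⟨v⟩) Φ (.inl j)
  have hnew : ∀ i, H.map (b.newGen s t i) = φ i := fun i =>
    FreeCat.lift_gen (fun v => o ⟨v⟩) Φ (.inr i)
  have e : b.incl s t ⋙ H = G := by
    refine b.free.hom_ext ho (DGCat.empty.functor_eq _ _) fun j => ?_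
    exact (conj_eqToHom_iff_heq _ _ (ho _) (ho _)).1
      ((congrArg H.map (b.incl_gen s t j)).trans (hold j))
  refine ⟨H, ⟨inferInstance, inferInstance, e, fun _ => rfl, fun i => ?_⟩, ?_⟩
  · exact (hnew i).trans ((Category.id_comp _).trans (Category.comp_id _)).symm
  · rintro H' ⟨_, _, e', h, hf⟩
    refine b.ext_functor_ext s t h (fun j => ?_) fun i => ?_
    · have hj : HEq ((b.incl s t ⋙ H').map (b.gen j)) ((b.incl s t ⋙ H).map (b.gen j)) := by
        rw [e', e]
      exact (heq_of_eq (congrArg H'.map (b.incl_gen s t j).symm)).trans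
        (hj.trans (heq_of_eq (congrArg H.map (b.incl_gen s t j))))
    · rw [hnew]
      exact (conj_eqToHom_iff_heq _ _ (h _) (h _)).1 (hf i)

lemma incl_faithful : (b.incl s t).Faithful where
  map_injective {X X'} f g h := by
    -- The identity of the base extends to a retraction that sends all new objects to `X`.
    have e := (b.isFreeExtension s t).comp_lift (𝟭 Y)
      (fun v => Sum.elim (fun y => y) (fun _ => X) v.of) (fun _ => rfl) (fun _ => 0)
    exact (Functor.Faithful.of_comp_eq e).map_injective h

variable (deg : ι → ℤ) (dgen : ∀ i, (⟨s i⟩ : b.Ext s t) ⟶ ⟨t i⟩)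

/-- The grading and derivation on the free extension that extend those of the base and have
prescribed values on the new generators. -/
noncomputable def preDG : PreDG k (b.Ext s t) :=
  FreeCat.preDG (Sum.elim b.deg deg) (fun j => match j with
    | .inl j => (b.incl s t).map (DGCat.d _ _ (b.gen j))
    | .inr i => dgen i)

lemma newGen_mem (i : ι) : b.newGen s t i ∈ (b.preDG s t deg dgen).hom _ _ (deg i) :=
  FreeCat.gen_mem (Sum.elim b.deg deg) (.inr i)

lemma oldGen_mem (j : b.ι) : b.oldGen s t j ∈ (b.preDG s t deg dgen).hom _ _ (b.deg j) :=
  FreeCat.gen_mem (Sum.elim b.deg deg) (.inl j)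

lemma d_newGen (i : ι) : (b.preDG s t deg dgen).d _ _ (b.newGen s t i) = dgen i :=
  FreeCat.der_gen (Sum.elim b.deg deg) _ (.inr i)

lemma d_oldGen (j : b.ι) : (b.preDG s t deg dgen).d _ _ (b.oldGen s t j) =
    (b.incl s t).map (DGCat.d _ _ (b.gen j)) :=
  FreeCat.der_gen (Sum.elim b.deg deg) _ (.inl j)

lemma preserves_incl : (b.preDG s t deg dgen).Preserves (b.incl s t) := by
  refine PreDG.preserves_of_isFreeExtension b.gen_mem b.free
    ⟨fun {X} => (DGCat.empty.elim X).elim, fun {X} => (DGCat.empty.elim X).elim⟩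
    (fun j => ?_) fun j => ?_
  · rw [incl_gen]
    exact b.oldGen_mem s t deg dgen j
  · rw [incl_gen]
    exact (b.d_oldGen s t deg dgen j).symm

/-- The derivation of the extension is homogeneous of degree `1` and squares to zero if this holds
on the new generators. -/
structure IsDG : Prop where
  dgen_mem (i : ι) : dgen i ∈ (b.preDG s t deg dgen).hom _ _ (deg i + 1)
  d_dgen (i : ι) : (b.preDG s t deg dgen).d _ _ (dgen i) = 0

variable {b s t deg dgen}

namespace IsDG

lemma d_mem (h : b.IsDG s t deg dgen) {X X' : b.Ext s t} {p : ℤ} {f : X ⟶ X'} (hf : f ∈ (b.preDG s t deg dgen).hom _ _ p) :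
    (b.preDG s t deg dgen).d _ _ f ∈ (b.preDG s t deg dgen).hom _ _ (p + 1) := by
  refine FreeCat.der_mem ?_ hf
  rintro (j | i)
  · exact (b.preserves_incl s t deg dgen).map_mem (DGCategory.d_mem (b.gen_mem j))
  · exact h.dgen_mem i

lemma d_d (h : b.IsDG s t deg dgen) {X X' : b.Ext s t} (f : X ⟶ X') :
    (b.preDG s t deg dgen).d _ _ ((b.preDG s t deg dgen).d _ _ f) = 0 := by
  refine FreeCat.der_der ?_ ?_ f
  · rintro (j | i)
    · exact (b.preserves_incl s t deg dgen).map_mem (DGCategory.d_mem (b.gen_mem j))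
    · exact h.dgen_mem i
  · rintro (j | i)
    · have := (b.preserves_incl s t deg dgen).map_d (DGCat.d _ _ (b.gen j))
      rw [DGCat.d_d, Functor.map_zero] at this
      exact this.symm
    · exact h.d_dgen i

variable (h : b.IsDG s t deg dgen)

/-- The free extension, as a dg category. -/
noncomputable def dgCat : DGCat k where
  carrier := b.Ext s t
  dg :=
    { hom := (b.preDG s t deg dgen).hom
      isInternal := FreeCat.isInternal _
      id_mem := (b.preDG s t deg dgen).id_mem
      comp_mem := (b.preDG s t deg dgen).comp_mem
      d := (b.preDG s t deg dgen).d
      d_mem := h.d_mem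
      d_d := h.d_d
      d_comp := (b.preDG s t deg dgen).d_comp }

/-- The inclusion of the base into the free extension, as a dg functor. -/
noncomputable def inclusion : DGFunctor Y h.dgCat :=
  letI H : Y ⥤ h.dgCat := b.incl s t
  haveI : H.Additive := inferInstanceAs (b.incl s t).Additive
  haveI : H.Linear k := inferInstanceAs ((b.incl s t).Linear k)
  { functor := H
    map_mem := (b.preserves_incl s t deg dgen).map_mem
    map_d := (b.preserves_incl s t deg dgen).map_d }

lemma isFreeExtension_inclusion :
    IsFreeExtension k (D := h.dgCat) h.inclusion.functor (b.newGen s t) :=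
  b.isFreeExtension s t

lemma isSemifreeExtension [LinearOrder ι] [WellFoundedLT ι]
    (hd : ∀ i, GeneratedBy k (ImageMor (b.incl s t) ⊔ FamilyBelow (b.newGen s t) i) (dgen i)) :
    IsSemifreeExtension h.inclusion := by
  refine ⟨b.incl_injective s t, b.incl_faithful s t, ι, inferInstance, inferInstance, _, _,
    b.newGen s t, deg, b.newGen_mem s t deg dgen, h.isFreeExtension_inclusion, fun i => ?_⟩
  have := hd i
  rw [← b.d_newGen s t deg dgen i] at this
  exact this

end IsDG

end FreeBasis

end

/-! ### Pushouts of semifree extensions -/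

section

variable {k : Type u} [CommRing k]

namespace SemifreePushout

variable {B A Y : DGCat k} {i : DGFunctor B A} (hi : Function.Injective i.functor.obj)
  {ι : Type u} {s t : ι → A} {f : ∀ j, s j ⟶ t j}
  {deg : ι → ℤ} (hdeg : ∀ j, f j ∈ DGCat.hom (s j) (t j) (deg j))
  (hf : IsFreeExtension k i.functor f) (φ : DGFunctor B Y) (b : FreeBasis Y)

variable (i) in
/-- The objects outside the image. -/
abbrev NewObj : Type u := {a : A // ∀ x, i.functor.obj x ≠ a}

open Classical in
variable (i) in
/-- The map from the objects of `A` to those of the pushout. -/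
noncomputable def objMap (a : A) : Y ⊕ NewObj i :=
  if h : ∃ x, i.functor.obj x = a then .inl (φ.functor.obj h.choose)
  else .inr ⟨a, fun x hx => h ⟨x, hx⟩⟩

include hi in
lemma objMap_obj (x : B) : objMap i φ (i.functor.obj x) = .inl (φ.functor.obj x) := by
  have h : ∃ x', i.functor.obj x' = i.functor.obj x := ⟨x, rfl⟩
  rw [objMap, dif_pos h, hi h.choose_spec]

lemma objMap_new (n : NewObj i) : objMap i φ n.1 = .inr n :=
  dif_neg fun ⟨x, hx⟩ => n.2 x hx

/-- The `k`-linear category underlying the pushout. -/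
abbrev Carrier (i : DGFunctor B A) (s t : ι → A) (φ : DGFunctor B Y) (b : FreeBasis Y) : Type u :=
  b.Ext (fun j => objMap i φ (s j)) (fun j => objMap i φ (t j))

/-- The inclusion of `Y` into the pushout. -/
noncomputable abbrev inr (i : DGFunctor B A) (s t : ι → A) (φ : DGFunctor B Y) (b : FreeBasis Y) :
    Y ⥤ Carrier i s t φ b :=
  b.incl _ _

/-- The functor from `A` to the pushout. -/
noncomputable def inl : A ⥤ Carrier i s t φ b :=
  hf.lift (φ.functor ⋙ inr i s t φ b) (fun a => ⟨objMap i φ a⟩)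
    (fun x => congrArg FreeCat.mk (objMap_obj hi φ x)) (b.newGen _ _)

instance : (inl hi hf φ b).Additive := hf.lift_additive _ _ _ _

instance : (inl hi hf φ b).Linear k := hf.lift_linear _ _ _ _

lemma comp_inl : i.functor ⋙ inl hi hf φ b = φ.functor ⋙ inr i s t φ b := hf.comp_lift _ _ _ _

lemma inl_gen (j : ι) : (inl hi hf φ b).map (f j) = b.newGen _ _ j := hf.lift_map_gen _ _ _ _ j

/-- The differentials of the new generators, which make the functor from `A` a dg functor. -/
noncomputable def dgen (j : ι) : (⟨objMap i φ (s j)⟩ : Carrier i s t φ b) ⟶ ⟨objMap i φ (t j)⟩ :=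
  (inl hi hf φ b).map (DGCat.d _ _ (f j))

include hdeg in
lemma preserves_inl : (b.preDG _ _ deg (dgen hi hf φ b)).Preserves (inl hi hf φ b) := by
  refine PreDG.preserves_of_isFreeExtension hdeg hf ?_ (fun j => ?_) fun j => ?_
  · rw [comp_inl]
    exact (b.preserves_incl _ _ deg (dgen hi hf φ b)).comp
  · rw [inl_gen]
    exact b.newGen_mem _ _ _ _ j
  · rw [inl_gen]
    exact (b.d_newGen _ _ deg (dgen hi hf φ b) j).symm

include hdeg in
lemma isDG : b.IsDG _ _ deg (dgen hi hf φ b) where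
  dgen_mem j := (preserves_inl hi hdeg hf φ b).map_mem (DGCategory.d_mem (hdeg j))
  d_dgen j := by
    have h := (preserves_inl hi hdeg hf φ b).map_d (DGCat.d _ _ (f j))
    rw [DGCat.d_d, Functor.map_zero] at h
    exact h.symm

/-- The pushout. -/
noncomputable abbrev pt : DGCat k := (isDG hi hdeg hf φ b).dgCat

/-- The dg functor from `A` to the pushout. -/
noncomputable def inlDG : DGFunctor A (pt hi hdeg hf φ b) :=
  letI H : A ⥤ pt hi hdeg hf φ b := inl hi hf φ b
  haveI : H.Additive := inferInstanceAs (inl hi hf φ b).Additive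
  haveI : H.Linear k := inferInstanceAs ((inl hi hf φ b).Linear k)
  { functor := H
    map_mem := (preserves_inl hi hdeg hf φ b).map_mem
    map_d := (preserves_inl hi hdeg hf φ b).map_d }

/-- The dg functor from `Y` to the pushout. -/
noncomputable abbrev inrDG : DGFunctor Y (pt hi hdeg hf φ b) := (isDG hi hdeg hf φ b).inclusion

lemma comm : i.comp (inlDG hi hdeg hf φ b) = φ.comp (inrDG hi hdeg hf φ b) :=
  DGFunctor.ext (comp_inl hi hf φ b)

lemma isSemifreeExtension_inr [LinearOrder ι] [WellFoundedLT ι]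
    (hd : ∀ j, GeneratedBy k (ImageMor i.functor ⊔ FamilyBelow f j) (DGCat.d _ _ (f j))) :
    IsSemifreeExtension (inrDG hi hdeg hf φ b) := by
  refine (isDG hi hdeg hf φ b).isSemifreeExtension fun j => (hd j).map (inl hi hf φ b) ?_
  rintro X X' m (⟨⟨c⟩⟩ | ⟨⟨j', hj⟩⟩)
  · have e := Functor.congr_hom (comp_inl hi hf φ b) c
    rw [Functor.comp_map] at e
    rw [e]
    exact .comp _ _ (.eqToHom _) (.comp _ _ (.of _ (Or.inl ⟨φ.functor.map c⟩)) (.eqToHom _))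
  · rw [inl_gen]
    exact .of _ (Or.inr (familyBelow_of (b.newGen _ _) j' hj))

variable {hi hdeg hf φ b} in
/-- Dg functors out of the pushout are determined by their restrictions to `A` and `Y`. -/
lemma hom_ext {T : DGCat k} {H H' : DGFunctor (pt hi hdeg hf φ b) T}
    (h₁ : (inlDG hi hdeg hf φ b).comp H = (inlDG hi hdeg hf φ b).comp H')
    (h₂ : (inrDG hi hdeg hf φ b).comp H = (inrDG hi hdeg hf φ b).comp H') : H = H' := by
  have e₁ : inl hi hf φ b ⋙ H.functor = inl hi hf φ b ⋙ H'.functor :=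
    congrArg DGFunctor.functor h₁
  have e₂ : inr i s t φ b ⋙ H.functor = inr i s t φ b ⋙ H'.functor :=
    congrArg DGFunctor.functor h₂
  refine DGFunctor.ext ((isDG hi hdeg hf φ b).isFreeExtension_inclusion.hom_ext ?_ e₂ fun j => ?_)
  · rintro ⟨y | n⟩
    · exact Functor.congr_obj e₂ y
    · have := Functor.congr_obj e₁ n.1
      change H.functor.obj ⟨objMap i φ n.1⟩ = H'.functor.obj ⟨objMap i φ n.1⟩ at this
      rwa [objMap_new] at this
  · have hj : HEq ((inl hi hf φ b ⋙ H.functor).map (f j))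
      ((inl hi hf φ b ⋙ H'.functor).map (f j)) := by rw [e₁]
    exact (heq_of_eq (congrArg H.functor.map (inl_gen hi hf φ b j).symm)).trans
      (hj.trans (heq_of_eq (congrArg H'.functor.map (inl_gen hi hf φ b j))))

lemma exists_desc {T : DGCat k} (a : DGFunctor A T) (y : DGFunctor Y T) (h : i.comp a = φ.comp y) :
    ∃ H : DGFunctor (pt hi hdeg hf φ b) T, (inlDG hi hdeg hf φ b).comp H = a ∧
      (inrDG hi hdeg hf φ b).comp H = y := by
  have h' : i.functor ⋙ a.functor = φ.functor ⋙ y.functor := congrArg DGFunctor.functor h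
  let o : Carrier i s t φ b → T := fun v => Sum.elim y.functor.obj (fun n => a.functor.obj n.1) v.of
  have ho : ∀ x : A, o ⟨objMap i φ x⟩ = a.functor.obj x := fun x => by
    by_cases hx : ∃ z, i.functor.obj z = x
    · obtain ⟨z, rfl⟩ := hx
      rw [objMap_obj hi]
      exact (Functor.congr_obj h' z).symm
    · exact congrArg (fun v => o ⟨v⟩) (objMap_new φ ⟨x, fun z hz => hx ⟨z, hz⟩⟩)
  have hJ := b.isFreeExtension (fun j => objMap i φ (s j)) (fun j => objMap i φ (t j))
  let H := hJ.lift y.functor o (fun _ => rfl)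
    (fun j => eqToHom (ho _) ≫ a.functor.map (f j) ≫ eqToHom (ho _).symm)
  have : H.Additive := hJ.lift_additive _ _ _ _
  have : H.Linear k := hJ.lift_linear _ _ _ _
  have e₂ : inr i s t φ b ⋙ H = y.functor := hJ.comp_lift _ _ _ _
  have hg : ∀ j, H.map (b.newGen _ _ j) =
      eqToHom (ho _) ≫ a.functor.map (f j) ≫ eqToHom (ho _).symm := hJ.lift_map_gen _ _ _ _
  have e₁ : inl hi hf φ b ⋙ H = a.functor := by
    refine hf.hom_ext ho ?_ fun j => ?_
    · rw [← Functor.assoc, comp_inl, Functor.assoc, e₂, h']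
    · exact (conj_eqToHom_iff_heq _ _ (ho _) (ho _)).1
        ((congrArg H.map (inl_gen hi hf φ b j)).trans (hg j))
  have ha : T.preDG.Preserves (inl hi hf φ b ⋙ H) := by
    rw [e₁]
    exact PreDG.preserves_dgFunctor a
  let H' : pt hi hdeg hf φ b ⥤ T := H
  have : H'.Additive := inferInstanceAs H.Additive
  have : H'.Linear k := inferInstanceAs (H.Linear k)
  have hH : T.preDG.Preserves H' := by
    refine PreDG.preserves_of_isFreeExtension (F := inrDG hi hdeg hf φ b)
      (b.newGen_mem _ _ deg (dgen hi hf φ b)) hJ ?_ (fun j => ?_) fun j => ?_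
    · have : T.preDG.Preserves (inr i s t φ b ⋙ H) := by
        rw [e₂]
        exact PreDG.preserves_dgFunctor y
      exact this
    · have := ha.map_mem (hdeg j)
      rw [Functor.comp_map, inl_gen] at this
      exact this
    · have := ha.map_d (f j)
      rw [Functor.comp_map, Functor.comp_map, inl_gen] at this
      refine Eq.trans (congrArg H.map ?_) this
      exact b.d_newGen _ _ deg (dgen hi hf φ b) j
  exact ⟨hH.toDGFunctor, DGFunctor.ext e₁, DGFunctor.ext e₂⟩

lemma isPushout : IsPushout (C := DGCat k) (Z := B) (X := A) (Y := Y) (P := pt hi hdeg hf φ b) i φ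
    (inlDG hi hdeg hf φ b) (inrDG hi hdeg hf φ b) := by
  refine ⟨⟨comm hi hdeg hf φ b⟩, ⟨PushoutCocone.IsColimit.mk _
    (fun c => (exists_desc hi hdeg hf φ b c.inl c.inr c.condition).choose) (fun c => ?_)
    (fun c => ?_) fun c m h₁ h₂ => ?_⟩⟩
  · exact (exists_desc hi hdeg hf φ b c.inl c.inr c.condition).choose_spec.1
  · exact (exists_desc hi hdeg hf φ b c.inl c.inr c.condition).choose_spec.2
  · have h := (exists_desc hi hdeg hf φ b c.inl c.inr c.condition).choose_spec
    exact hom_ext (h₁.trans h.1.symm) (h₂.trans h.2.symm)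

end SemifreePushout

/-- The pushout of a semifree extension along a dg functor to a semifree dg category exists and is
a semifree extension. -/
theorem IsSemifreeExtension.exists_isPushout {B A Y : DGCat k} {i : B ⟶ A}
    (hi : IsSemifreeExtension (C := B) (D := A) i) (φ : B ⟶ Y) (hY : IsSemifree Y) :
    ∃ (P : DGCat k) (φ' : A ⟶ P) (i' : Y ⟶ P), IsPushout i φ φ' i' ∧
      IsSemifreeExtension (C := Y) (D := P) i' := by
  obtain ⟨b⟩ := hY.nonempty_freeBasis
  obtain ⟨hi₁, -, ι, _, _, s, t, f, deg, hdeg, hf, hd⟩ := hi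
  exact ⟨_, _, _, SemifreePushout.isPushout hi₁ hdeg hf φ b,
    SemifreePushout.isSemifreeExtension_inr hi₁ hdeg hf φ b hd⟩

end

/-! ### Factorization of dg functors -/

section

variable {k : Type u} [CommRing k]

/-- Every type has a well-order that is compatible with a given rank function. -/
lemma exists_wellOrder_of_rank {ι : Type u} (r : ι → ℕ) :
    ∃ (_ : LinearOrder ι) (_ : WellFoundedLT ι), ∀ i j, r i < r j → i < j := by
  classical
  let W : LinearOrder ι := linearOrderOfSTO WellOrderingRel
  have hW : WellFoundedLT ι := ⟨WellOrderingRel.isWellOrder.wf⟩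
  let g : ι → ℕ ×ₗ ι := fun i => toLex (r i, i)
  have hg : Function.Injective g := fun i j h => congrArg Prod.snd (toLex.injective h)
  refine ⟨LinearOrder.lift' g hg, ⟨InvImage.wf g wellFounded_lt⟩, fun i j h => ?_⟩
  exact Prod.Lex.toLex_lt_toLex.2 (Or.inl h)

namespace Factorization

variable {B Y : DGCat k} (φ : DGFunctor B Y) (b : FreeBasis B)

/-- The objects of the middle dg category, and their images in `Y`. -/
abbrev qObj (x : B ⊕ Y) : Y := Sum.elim φ.functor.obj (fun y => y) x

/-- Formal expressions for the morphisms of the middle dg category. For every expression `a`, degree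
`p` and morphism `m` of `Y` parallel to `a` there is a generator, which is to have differential `a`
and image `m` whenever this makes sense. -/
inductive Tm : B ⊕ Y → B ⊕ Y → Type u
  | id (x : B ⊕ Y) : Tm x x
  | zero (x y : B ⊕ Y) : Tm x y
  | add {x y : B ⊕ Y} (f g : Tm x y) : Tm x y
  | smul {x y : B ⊕ Y} (r : k) (f : Tm x y) : Tm x y
  | base {x : B ⊕ Y} (j : b.ι) (f : Tm x (.inl (b.s j))) : Tm x (.inl (b.t j))
  | cell {x y z : B ⊕ Y} (f : Tm x y) (p : ℤ) (a : Tm y z) (m : qObj φ y ⟶ qObj φ z) : Tm x z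

/-- The index type of the new generators. -/
structure Cell where
  /-- the source -/
  s : B ⊕ Y
  /-- the target -/
  t : B ⊕ Y
  /-- the degree -/
  deg : ℤ
  /-- the prospective differential -/
  bdry : Tm φ b s t
  /-- the prospective image in `Y` -/
  image : qObj φ s ⟶ qObj φ t

/-- The `k`-linear category underlying the middle dg category. -/
abbrev Mid : Type u := b.Ext (N := Y) (Cell.s (φ := φ) (b := b)) Cell.t

/-- The generator attached to a cell. -/
noncomputable abbrev cellGen (c : Cell φ b) : (⟨c.s⟩ : Mid φ b) ⟶ ⟨c.t⟩ := b.newGen _ _ c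

/-- The inclusion of `B` into the middle dg category. -/
noncomputable abbrev incl : B ⥤ Mid φ b := b.incl _ _

/-- The differential of a generator of `B`, in the middle dg category. -/
noncomputable abbrev dOld (j : b.ι) : (⟨.inl (b.s j)⟩ : Mid φ b) ⟶ ⟨.inl (b.t j)⟩ :=
  (incl φ b).map (DGCat.d _ _ (b.gen j))

variable {φ b}

namespace Tm

/-- The number of constructors in an expression. -/
def size : ∀ {x y : B ⊕ Y}, Tm φ b x y → ℕ
  | _, _, id _ => 0
  | _, _, zero _ _ => 0
  | _, _, add f g => f.size + g.size
  | _, _, smul _ f => f.size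
  | _, _, base _ f => f.size
  | _, _, cell f _ a _ => f.size + a.size + 1

/-- The morphism denoted by an expression. -/
noncomputable def eval : ∀ {x y : B ⊕ Y}, Tm φ b x y → ((⟨x⟩ : Mid φ b) ⟶ ⟨y⟩)
  | _, _, id _ => 𝟙 _
  | _, _, zero _ _ => 0
  | _, _, add f g => f.eval + g.eval
  | _, _, smul r f => r • f.eval
  | _, _, base j f => f.eval ≫ b.oldGen _ _ j
  | _, _, cell f p a m => f.eval ≫ cellGen φ b ⟨_, _, p, a, m⟩

open Classical in
/-- The differential of the morphism denoted by an expression, and its image in `Y`. A cell has the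
prospective differential and image if these are consistent; otherwise both are zero. -/
noncomputable def dq : ∀ {x y : B ⊕ Y}, Tm φ b x y →
    ((⟨x⟩ : Mid φ b) ⟶ ⟨y⟩) × (qObj φ x ⟶ qObj φ y)
  | _, _, id _ => (0, 𝟙 _)
  | _, _, zero _ _ => (0, 0)
  | _, _, add f g => (f.dq.1 + g.dq.1, f.dq.2 + g.dq.2)
  | _, _, smul r f => (r • f.dq.1, r • f.dq.2)
  | _, _, base j f => (f.eval ≫ dOld φ b j +
      (b.deg j).negOnePow • (f.dq.1 ≫ b.oldGen _ _ j), f.dq.2 ≫ φ.functor.map (b.gen j))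
  | _, _, cell f p a m =>
    if a.eval ∈ FreeCat.homDeg (Sum.elim b.deg Cell.deg) _ _ (p + 1) ∧ a.dq.1 = 0 ∧
        a.dq.2 = DGCat.d _ _ m ∧ m ∈ DGCat.hom _ _ p then
      (f.eval ≫ a.eval + p.negOnePow • (f.dq.1 ≫ cellGen φ b ⟨_, _, p, a, m⟩), f.dq.2 ≫ m)
    else (p.negOnePow • (f.dq.1 ≫ cellGen φ b ⟨_, _, p, a, m⟩), 0)

end Tm

/-- A cell is consistent if its prospective differential is a cycle of the right degree, whose image
is the differential of the prospective image. -/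
def Cell.Valid (c : Cell φ b) : Prop :=
  c.bdry.eval ∈ FreeCat.homDeg (Sum.elim b.deg Cell.deg) _ _ (c.deg + 1) ∧ c.bdry.dq.1 = 0 ∧
    c.bdry.dq.2 = DGCat.d _ _ c.image ∧ c.image ∈ DGCat.hom _ _ c.deg

lemma Tm.dq_cell_of_valid {x y z : B ⊕ Y} (f : Tm φ b x y) {p : ℤ} {a : Tm φ b y z}
    {m : qObj φ y ⟶ qObj φ z} (h : Cell.Valid ⟨y, z, p, a, m⟩) : (Tm.cell f p a m).dq =
      (f.eval ≫ a.eval + p.negOnePow • (f.dq.1 ≫ cellGen φ b ⟨y, z, p, a, m⟩), f.dq.2 ≫ m) := by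
  rw [Tm.dq]
  exact if_pos h

lemma Tm.dq_cell_of_not_valid {x y z : B ⊕ Y} (f : Tm φ b x y) {p : ℤ} {a : Tm φ b y z}
    {m : qObj φ y ⟶ qObj φ z} (h : ¬ Cell.Valid ⟨y, z, p, a, m⟩) : (Tm.cell f p a m).dq =
      (p.negOnePow • (f.dq.1 ≫ cellGen φ b ⟨y, z, p, a, m⟩), 0) := by
  rw [Tm.dq]
  exact if_neg h

variable (φ b)

open Classical in
/-- The differential of the generator attached to a cell. -/
noncomputable def dgen (c : Cell φ b) : (⟨c.s⟩ : Mid φ b) ⟶ ⟨c.t⟩ :=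
  if c.Valid then c.bdry.eval else 0

open Classical in
/-- The image in `Y` of the generator attached to a cell. -/
noncomputable def qgen (c : Cell φ b) : qObj φ c.s ⟶ qObj φ c.t :=
  if c.Valid then c.image else 0

/-- The grading and derivation of the middle dg category. -/
noncomputable abbrev preDG : PreDG k (Mid φ b) := b.preDG _ _ Cell.deg (dgen φ b)

/-- The functor from the middle dg category to `Y`. -/
noncomputable def q : Mid φ b ⥤ Y :=
  (b.isFreeExtension _ _).lift φ.functor (fun x => qObj φ x.of) (fun _ => rfl) (qgen φ b)

instance : (q φ b).Additive := (b.isFreeExtension _ _).lift_additive _ _ _ _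

instance : (q φ b).Linear k := (b.isFreeExtension _ _).lift_linear _ _ _ _

lemma incl_q : incl φ b ⋙ q φ b = φ.functor := (b.isFreeExtension _ _).comp_lift _ _ _ _

lemma q_incl {X X' : B} (f : X ⟶ X') : (q φ b).map ((incl φ b).map f) = φ.functor.map f :=
  (Functor.congr_hom (incl_q φ b) f).trans ((Category.id_comp _).trans (Category.comp_id _))

lemma q_cellGen (c : Cell φ b) : (q φ b).map (cellGen φ b c) = qgen φ b c :=
  (b.isFreeExtension _ _).lift_map_gen _ _ _ _ c

lemma q_oldGen (j : b.ι) : (q φ b).map (b.oldGen _ _ j) = φ.functor.map (b.gen j) :=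
  (congrArg (q φ b).map (b.incl_gen _ _ j).symm).trans (q_incl φ b (b.gen j))

variable {φ b}

/-- The derivation of the middle dg category is computed by recursion on expressions. -/
lemma d_eval {x y : B ⊕ Y} (a : Tm φ b x y) : (preDG φ b).d _ _ a.eval = a.dq.1 := by
  induction a with
  | id x => exact (preDG φ b).d_id _
  | zero x y => exact map_zero _
  | add f g hf hg => exact (map_add _ _ _).trans (congrArg₂ _ hf hg)
  | smul r f hf => exact (map_smul _ r _).trans (congrArg _ hf)
  | base j f hf =>
    refine ((preDG φ b).d_comp _ (b.oldGen_mem _ _ Cell.deg (dgen φ b) j)).trans ?_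
    rw [b.d_oldGen, hf, Tm.dq]
  | cell f p a m hf _ =>
    refine ((preDG φ b).d_comp _ (b.newGen_mem _ _ Cell.deg (dgen φ b) ⟨_, _, p, a, m⟩)).trans ?_
    rw [b.d_newGen, hf, dgen]
    by_cases h : (⟨_, _, p, a, m⟩ : Cell φ b).Valid
    · rw [if_pos h, Tm.dq_cell_of_valid f h]
    · rw [if_neg h, Tm.dq_cell_of_not_valid f h, Limits.comp_zero, zero_add]

/-- The functor to `Y` is computed by recursion on expressions. -/
lemma q_eval {x y : B ⊕ Y} (a : Tm φ b x y) : (q φ b).map a.eval = a.dq.2 := by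
  induction a with
  | id x => exact (q φ b).map_id _
  | zero x y => exact (q φ b).map_zero _ _
  | add f g hf hg => exact (q φ b).map_add.trans (congrArg₂ _ hf hg)
  | smul r f hf => exact ((q φ b).map_smul r _).trans (congrArg _ hf)
  | base j f hf =>
    exact ((q φ b).map_comp _ _).trans (congrArg₂ (· ≫ ·) hf (q_oldGen φ b j))
  | cell f p a m hf _ =>
    refine ((q φ b).map_comp _ _).trans ((congrArg₂ (· ≫ ·) hf (q_cellGen φ b _)).trans ?_)
    rw [qgen]
    by_cases h : (⟨_, _, p, a, m⟩ : Cell φ b).Valid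
    · rw [if_pos h, Tm.dq_cell_of_valid f h]
      rfl
    · rw [if_neg h, Tm.dq_cell_of_not_valid f h]
      exact Limits.comp_zero

lemma exists_eval_word {x y : B ⊕ Y} (w : FPath _ _ x y) :
    ∃ a : Tm φ b x y, a.eval = FreeCat.word (X := ⟨x⟩) (Y := ⟨y⟩) w := by
  induction w with
  | nil => exact ⟨.id _, rfl⟩
  | cons i w ih =>
    obtain ⟨a, ha⟩ := ih
    obtain j | c := i
    · exact ⟨a.base j, (congrArg (· ≫ b.oldGen _ _ j) ha).trans (FreeCat.word_cons _ _).symm⟩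
    · exact ⟨a.cell c.deg c.bdry c.image,
        (congrArg (· ≫ cellGen φ b c) ha).trans (FreeCat.word_cons _ _).symm⟩

/-- Every morphism of the middle dg category is denoted by an expression. -/
lemma exists_eval {x y : B ⊕ Y} (f : (⟨x⟩ : Mid φ b) ⟶ ⟨y⟩) :
    ∃ a : Tm φ b x y, a.eval = f := by
  let S : Submodule k ((⟨x⟩ : Mid φ b) ⟶ ⟨y⟩) :=
    { carrier := {f | ∃ a : Tm φ b x y, a.eval = f}
      add_mem' := by rintro _ _ ⟨a, rfl⟩ ⟨c, rfl⟩; exact ⟨a.add c, rfl⟩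
      zero_mem' := ⟨.zero _ _, rfl⟩
      smul_mem' := by rintro r _ ⟨a, rfl⟩; exact ⟨a.smul r, rfl⟩ }
  have hS : ⊤ ≤ S := by
    rw [← FreeCat.span_word]
    refine Submodule.span_le.2 ?_
    rintro _ ⟨w, rfl⟩
    exact exists_eval_word w
  exact hS (Submodule.mem_top (x := f))

variable (φ b) in
lemma isDG : b.IsDG _ _ Cell.deg (dgen φ b) where
  dgen_mem c := by
    rw [dgen]
    split_ifs with h
    · exact h.1
    · exact zero_mem _
  d_dgen c := by
    rw [dgen]
    split_ifs with h
    · exact (d_eval _).trans h.2.1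
    · exact map_zero _

/-- The cells occurring in an expression have boundaries of smaller size. -/
lemma generatedBy_eval {W : MorphismProperty (Mid φ b)}
    (hW : ∀ ⦃X X' : B⦄ (f : X ⟶ X'), W ((incl φ b).map f)) (n : ℕ)
    (hc : ∀ c : Cell φ b, c.bdry.size < n → W (cellGen φ b c)) {x y : B ⊕ Y} (a : Tm φ b x y)
    (ha : a.size ≤ n) : GeneratedBy k W a.eval := by
  induction a with
  | id x => exact .id _
  | zero x y => exact .zero _ _
  | add f g hf hg =>
    rw [Tm.size] at ha
    exact .add _ _ (hf (by omega)) (hg (by omega))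
  | smul r f hf => exact .smul _ _ (hf ha)
  | base j f hf =>
    have := hW (b.gen j)
    rw [b.incl_gen] at this
    exact .comp _ _ (hf ha) (.of _ this)
  | cell f p a m hf _ =>
    rw [Tm.size] at ha
    exact .comp _ _ (hf (by omega)) (.of _ (hc ⟨_, _, p, a, m⟩ (by simp only; omega)))

variable (φ b)

lemma isSemifreeExtension : IsSemifreeExtension (isDG φ b).inclusion := by
  obtain ⟨_, _, h⟩ := exists_wellOrder_of_rank (fun c : Cell φ b => c.bdry.size)
  refine (isDG φ b).isSemifreeExtension fun c => ?_
  rw [dgen]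
  split_ifs
  · exact generatedBy_eval (fun _ _ f => Or.inl ⟨f⟩) c.bdry.size
      (fun c' hc' => Or.inr (familyBelow_of (b.newGen _ _) c' (h _ _ hc'))) _ le_rfl
  · exact .zero _ _

/-- The dg functor from the middle dg category to `Y`. -/
noncomputable def qDG : DGFunctor (isDG φ b).dgCat Y :=
  letI H : (isDG φ b).dgCat ⥤ Y := q φ b
  haveI : H.Additive := inferInstanceAs (q φ b).Additive
  haveI : H.Linear k := inferInstanceAs ((q φ b).Linear k)
  PreDG.Preserves.toDGFunctor (H := H) (by
    refine PreDG.preserves_of_isFreeExtension (F := (isDG φ b).inclusion)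
      (b.newGen_mem _ _ Cell.deg (dgen φ b)) (isDG φ b).isFreeExtension_inclusion ?_
      (fun c => ?_) fun c => ?_
    · have : Y.preDG.Preserves (incl φ b ⋙ q φ b) := by
        rw [incl_q]
        exact PreDG.preserves_dgFunctor φ
      exact this
    · have : qgen φ b c ∈ DGCat.hom (qObj φ c.s) (qObj φ c.t) c.deg := by
        rw [qgen]
        split_ifs with h
        · exact h.2.2.2
        · exact zero_mem _
      rw [← q_cellGen] at this
      exact this
    · have : (q φ b).map (dgen φ b c) = DGCat.d (qObj φ c.s) (qObj φ c.t) (qgen φ b c) := by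
        rw [qgen, dgen]
        split_ifs with h
        · exact (q_eval _).trans h.2.2.1
        · exact ((q φ b).map_zero _ _).trans (map_zero _).symm
      rw [← q_cellGen, ← b.d_newGen _ _ Cell.deg (dgen φ b) c] at this
      exact this)

lemma isTrivialFibration : IsTrivialFibration (qDG φ b) where
  surjective_obj y := ⟨⟨.inr y⟩, rfl⟩
  exists_boundary {x y p a m} ha hda hm hdm := by
    obtain ⟨x⟩ := x
    obtain ⟨y⟩ := y
    obtain ⟨a, rfl⟩ := exists_eval (φ := φ) (b := b) a
    -- The required morphism is one of the generators.
    let c : Cell φ b := ⟨x, y, p, a, m⟩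
    have hc : c.Valid := ⟨ha, (d_eval a).symm.trans hda, (q_eval a).symm.trans hdm.symm, hm⟩
    refine ⟨cellGen φ b c, b.newGen_mem _ _ Cell.deg (dgen φ b) c, ?_, ?_⟩
    · exact (b.d_newGen _ _ Cell.deg (dgen φ b) c).trans (if_pos hc)
    · exact (q_cellGen φ b c).trans (if_pos hc)

end Factorization

/-- Every dg functor out of a semifree dg category factors as a semifree extension followed by a
trivial fibration. -/
theorem DGFunctor.exists_factorization {B Y : DGCat k} (φ : DGFunctor B Y) (hB : IsSemifree B) :
    ∃ (M : DGCat k) (j : DGFunctor B M) (q : DGFunctor M Y), IsSemifreeExtension j ∧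
      IsTrivialFibration q ∧ j.comp q = φ := by
  obtain ⟨b⟩ := hB.nonempty_freeBasis
  exact ⟨_, _, Factorization.qDG φ b, Factorization.isSemifreeExtension φ b,
    Factorization.isTrivialFibration φ b, DGFunctor.ext (Factorization.incl_q φ b)⟩

end

/-! ### The category of semifree dg categories -/

section

variable {k : Type u} [CommRing k]

lemma isQuasiEquivalence_of_inverse {C D : DGCat k} {F : DGFunctor C D} {G : DGFunctor D C}
    (h₁ : F.comp G = DGFunctor.id C) (h₂ : G.comp F = DGFunctor.id D) : IsQuasiEquivalence F :=
  MapPath.isQuasiEquivalence_of_homotopy (MapPath.const (DGFunctor.id C)) h₁.symm rfl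
    (MapPath.const (DGFunctor.id D)) h₂.symm rfl

/-- Quasi-equivalences between semifree dg categories are stable under pushout along semifree
extensions. A quasi-equivalence factors as a trivial cofibration followed by a trivial fibration,
and both classes have this stability. -/
theorem IsQuasiEquivalence.pushout {B A Y P : DGCat k} {i : B ⟶ A} {f : B ⟶ Y} {f' : A ⟶ P}
    {i' : Y ⟶ P} (h : IsPushout i f f' i') (hB : IsSemifree B) (hY : IsSemifree Y)
    (hi : IsSemifreeExtension (C := B) (D := A) i)
    (hf : IsQuasiEquivalence (C := B) (D := Y) f) : IsQuasiEquivalence (C := A) (D := P) f' := by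
  obtain ⟨M, j₀, q₀, hj, hq, e₀⟩ := DGFunctor.exists_factorization (show DGFunctor B Y from f) hB
  let j : B ⟶ M := j₀
  let q : M ⟶ Y := q₀
  have e : j ≫ q = f := e₀
  have hM : IsSemifree M := hj.isSemifree hB
  have hjw : IsQuasiEquivalence j₀ := hq.isQuasiEquivalence.of_comp_right (by rwa [e₀])
  obtain ⟨Q, a, j', hQ, hj'⟩ := hi.exists_isPushout j hM
  have ha : IsQuasiEquivalence (C := A) (D := Q) a :=
    isQuasiEquivalence_pushout_of_trivialCofibration hQ.flip hj hjw
  let u : Q ⟶ P := hQ.desc f' (q ≫ i') (by rw [← Category.assoc, e, h.w])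
  have hu₁ : a ≫ u = f' := hQ.inl_desc _ _ _
  have hu₂ : j' ≫ u = q ≫ i' := hQ.inr_desc _ _ _
  have hs : IsPushout (j ≫ q) i i' (a ≫ u) := by
    rw [e, hu₁]
    exact h.flip
  have hR : IsPushout q j' i' u := .of_left hs hu₂.symm hQ.flip
  have hu : IsQuasiEquivalence (C := Q) (D := P) u :=
    hq.isQuasiEquivalence_pushout hM hY hR.flip hj'
  rw [← hu₁]
  exact ha.comp hu

/-- Trivial cofibrations have retractions. -/
lemma IsSemifreeExtension.exists_retraction {R Q : DGCat k} {i : DGFunctor R Q} (hi : IsSemifreeExtension i)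
    (hi' : IsQuasiEquivalence i) : ∃ r : DGFunctor Q R, i.comp r = DGFunctor.id R := by
  obtain ⟨K, hK, -⟩ := MapPath.exists_deformation hi hi'
  exact ⟨K.comp (MapPath.fstF i), congrArg (fun V => DGFunctor.comp V (MapPath.fstF i)) hK⟩

end

namespace SemifreeDGCat

variable {k : Type u} [CommRing k]

lemma exists_inverse {X Y : SemifreeDGCat k} (f : X ⟶ Y) [IsIso f] :
    ∃ G : DGFunctor Y.obj X.obj, DGFunctor.comp f.hom G = DGFunctor.id X.obj ∧
      G.comp f.hom = DGFunctor.id Y.obj :=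
  ⟨(inv f).hom, congrArg InducedCategory.Hom.hom (IsIso.hom_inv_id f),
    congrArg InducedCategory.Hom.hom (IsIso.inv_hom_id f)⟩

lemma semifreeExtensions_of_isIso {X Y : SemifreeDGCat k} (f : X ⟶ Y) (_ : IsIso f) :
    semifreeExtensions k f := by
  obtain ⟨G, h₁, h₂⟩ := exists_inverse f
  exact isSemifreeExtension_of_inverse h₁ h₂

lemma quasiEquivalences_of_isIso {X Y : SemifreeDGCat k} (f : X ⟶ Y) (_ : IsIso f) :
    quasiEquivalences k f := by
  obtain ⟨G, h₁, h₂⟩ := exists_inverse f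
  exact isQuasiEquivalence_of_inverse h₁ h₂

instance : (semifreeExtensions k).IsStableUnderComposition where
  comp_mem _ _ hf hg := IsSemifreeExtension.comp hf hg

instance : (quasiEquivalences k).HasTwoOutOfThreeProperty where
  comp_mem _ _ hf hg := IsQuasiEquivalence.comp hf hg
  of_postcomp _ _ hg hfg := IsQuasiEquivalence.of_comp_right hg hfg
  of_precomp _ _ hf hfg := IsQuasiEquivalence.of_comp_left hf hfg

/-- Semifree extensions have pushouts that are preserved by the inclusion into all dg categories. -/
lemma exists_isPushout {B A Y : SemifreeDGCat k} (i : B ⟶ A) (f : B ⟶ Y)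
    (hi : semifreeExtensions k i) :
    ∃ (P : SemifreeDGCat k) (f' : A ⟶ P) (i' : Y ⟶ P), IsPushout i f f' i' ∧
      IsPushout i.hom f.hom f'.hom i'.hom ∧ semifreeExtensions k i' := by
  obtain ⟨P, f', i', h, hi'⟩ := IsSemifreeExtension.exists_isPushout hi f.hom Y.property
  let P' : SemifreeDGCat k := ⟨P, hi'.isSemifree Y.property⟩
  let a : A ⟶ P' := ObjectProperty.homMk f'
  let b : Y ⟶ P' := ObjectProperty.homMk i'
  refine ⟨P', a, b, ?_, h, hi'⟩
  exact IsPushout.of_map (ObjectProperty.ι _) (ObjectProperty.hom_ext _ h.w) h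

/-- By uniqueness of pushouts, the inclusion into all dg categories preserves every pushout of a
semifree extension. -/
lemma isPushout_hom {B A Y P : SemifreeDGCat k} {i : B ⟶ A} {f : B ⟶ Y} {f' : A ⟶ P} {i' : Y ⟶ P}
    (h : IsPushout i f f' i') (hi : semifreeExtensions k i) :
    IsPushout i.hom f.hom f'.hom i'.hom := by
  obtain ⟨P', a, b, h₁, h₂, -⟩ := exists_isPushout i f hi
  let e := h₁.isoIsPushout _ _ h
  refine h₂.of_iso (Iso.refl _) (Iso.refl _) (Iso.refl _) ((ObjectProperty.ι _).mapIso e)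
    (by simp) (by simp) ?_ ?_
  · exact (congrArg InducedCategory.Hom.hom (IsPushout.inl_isoIsPushout_hom _ _ h₁ h)).trans
      (Category.id_comp _).symm
  · exact (congrArg InducedCategory.Hom.hom (IsPushout.inr_isoIsPushout_hom _ _ h₁ h)).trans
      (Category.id_comp _).symm

lemma hasPushout {B A Y : SemifreeDGCat k} (i : B ⟶ A) (f : B ⟶ Y)
    (hi : semifreeExtensions k i) : HasPushout i f := by
  obtain ⟨_, _, _, h, -⟩ := exists_isPushout i f hi
  exact h.hasPushout

lemma semifreeExtensions_pushout {B A Y P : SemifreeDGCat k} (i : B ⟶ A) (f : B ⟶ Y) (f' : A ⟶ P)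
    (i' : Y ⟶ P) (h : IsPushout i f f' i') (hi : semifreeExtensions k i) :
    semifreeExtensions k i' := by
  obtain ⟨P', a, b, h₁, -, hb⟩ := exists_isPushout i f hi
  rw [← IsPushout.inr_isoIsPushout_hom _ _ h₁ h]
  exact MorphismProperty.comp_mem _ _ _ hb (semifreeExtensions_of_isIso _ inferInstance)

lemma exists_factorization {B Y : SemifreeDGCat k} (f : B ⟶ Y) :
    ∃ (A : SemifreeDGCat k) (i : B ⟶ A) (g : A ⟶ Y),
      semifreeExtensions k i ∧ quasiEquivalences k g ∧ i ≫ g = f := by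
  obtain ⟨M, j, q, hj, hq, e⟩ := DGFunctor.exists_factorization f.hom B.property
  exact ⟨⟨M, hj.isSemifree B.property⟩, ObjectProperty.homMk j, ObjectProperty.homMk q, hj,
    hq.isQuasiEquivalence, ObjectProperty.hom_ext _ e⟩

lemma isFibrantObject (C : SemifreeDGCat k) :
    IsFibrantObject (quasiEquivalences k) (semifreeExtensions k) C := fun Q i hi hi' => by
  obtain ⟨r, hr⟩ := IsSemifreeExtension.exists_retraction hi hi'
  exact ⟨ObjectProperty.homMk r, ObjectProperty.hom_ext _ hr⟩

variable (k) in
/-- The empty dg category is an initial object. -/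
def isInitialEmpty :
    IsInitial (⟨DGCat.empty k, isSemifree_empty⟩ : SemifreeDGCat k) :=
  IsInitial.ofUniqueHom (fun X => ObjectProperty.homMk (DGCat.empty.desc X.obj))
    fun _ _ => ObjectProperty.hom_ext _ (DGCat.empty.dgFunctor_eq _ _)

lemma semifreeExtensions_isInitialEmpty_to (C : SemifreeDGCat k) :
    semifreeExtensions k ((isInitialEmpty k).to C) :=
  (isSemifree_iff _).1 C.property

lemma isCofibrantObject (C : SemifreeDGCat k) : IsCofibrantObject (semifreeExtensions k) C :=
  ⟨_, isInitialEmpty k, semifreeExtensions_isInitialEmpty_to C⟩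

variable (k) in
lemma hasFiniteCoproducts : HasFiniteCoproducts (SemifreeDGCat k) := by
  have : HasInitial (SemifreeDGCat k) := (isInitialEmpty k).hasInitial
  have : ∀ X Y : SemifreeDGCat k, HasColimit (pair X Y) := fun X Y => by
    obtain ⟨P, a, b, h, -⟩ := exists_isPushout ((isInitialEmpty k).to X) ((isInitialEmpty k).to Y)
      (semifreeExtensions_isInitialEmpty_to X)
    exact ⟨⟨_, isCoproductOfIsInitialIsPushout _ _ _ _ (isInitialEmpty k) h.isColimit⟩⟩
  have := hasBinaryCoproducts_of_hasColimit_pair (SemifreeDGCat k)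
  exact hasFiniteCoproducts_of_has_binary_and_initial

lemma quasiEquivalences_pushout_of_trivial {B A Y P : SemifreeDGCat k} (i : B ⟶ A) (f : B ⟶ Y)
    (f' : A ⟶ P) (i' : Y ⟶ P) (h : IsPushout i f f' i') (hi : semifreeExtensions k i)
    (hi' : quasiEquivalences k i) : quasiEquivalences k i' :=
  isQuasiEquivalence_pushout_of_trivialCofibration (isPushout_hom h hi) hi hi'

lemma isCofibrationCategory :
    IsCofibrationCategory (quasiEquivalences k) (semifreeExtensions k) where
  we_of_isIso _ _ f := quasiEquivalences_of_isIso f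
  cof_of_isIso _ _ f := semifreeExtensions_of_isIso f
  we_two_out_of_three := inferInstance
  cof_comp := inferInstance
  hasPushout _ _ _ := hasPushout
  cof_pushout _ _ _ _ := semifreeExtensions_pushout
  we_pushout_along_cof B _ Y _ _ _ _ _ h hi hf :=
    IsQuasiEquivalence.pushout (isPushout_hom h hi) B.property Y.property hi hf
  we_pushout_of_trivial_cof _ _ _ _ := quasiEquivalences_pushout_of_trivial
  factorization _ _ := exists_factorization
  fibrant_model X := ⟨X, 𝟙 X, semifreeExtensions_of_isIso _ inferInstance,
    quasiEquivalences_of_isIso _ inferInstance, isFibrantObject X⟩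

lemma isCategoryOfCofibrantObjects :
    IsCategoryOfCofibrantObjects (quasiEquivalences k) (semifreeExtensions k) where
  hasFiniteCoproducts := hasFiniteCoproducts k
  we_of_isIso _ _ f := quasiEquivalences_of_isIso f
  we_two_out_of_three := inferInstance
  cof_of_isIso _ _ f := semifreeExtensions_of_isIso f
  cof_comp := inferInstance
  hasPushout _ _ _ := hasPushout
  cof_pushout _ _ _ _ := semifreeExtensions_pushout
  we_pushout_of_trivial_cof _ _ _ _ := quasiEquivalences_pushout_of_trivial
  cylinder _ _ _ := exists_factorization _
  cofibrant := isCofibrantObject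

end SemifreeDGCat

theorem mainTheorem4 (k : Type u) [CommRing k] :
    IsCofibrationCategory (quasiEquivalences k) (semifreeExtensions k) ∧
    (∀ C : SemifreeDGCat k,
      IsFibrantObject (quasiEquivalences k) (semifreeExtensions k) C ∧
      IsCofibrantObject (semifreeExtensions k) C) ∧
    IsCategoryOfCofibrantObjects (quasiEquivalences k) (semifreeExtensions k) :=
  ⟨SemifreeDGCat.isCofibrationCategory,
    fun C => ⟨SemifreeDGCat.isFibrantObject C, SemifreeDGCat.isCofibrantObject C⟩,
    SemifreeDGCat.isCategoryOfCofibrantObjects⟩
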